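/- Let $H$ be a definite quaternion algebra over $\mathbb{Q}$, i.e. $H=\mathbb{Q}\langle i,j\rangle$ with $i^2=\alpha$, $j^2=\beta$, $ij=-ji$, where $\alpha,\beta\in\mathbb{Q}$ are negative. Let $N$ and $\mathrm{Tr}$ be its reduced norm and reduced trace. For a ($\mathbb{Z}$-)lattice $\mathfrak a\subset H$ of full rank put $N\mathfrak a=\gcd\{N x: x\in\mathfrak a\}$ (the positive generator of the subgroup of $\mathbb{Q}$ generated by these numbers); let $\mathrm{disc}(\mathfrak a)$ be the positive square root of the determinant of the quadratic form $x\mapsto Nx/N\mathfrak a$ on $\mathfrak a$ (the determinant of the Gram matrix of the polar form $Q(x+y)-Q(x)-Q(y)$), and, for a prime $p$, $\mathfrak a_p=\mathfrak a\otimes\mathbb{Z}_p\subset H_p=H\otimes\mathbb{Q}_p$. Let $O\subset H$ be an order (a subring that is a lattice of full rank); $\mathrm{disc}(O)$ is its reduced discriminant. A left $O$-ideal is a lattice $\mathfrak a\subset H$ such that for every prime $p$ there is $x_p\in H_p^\times$ with $\mathfrak a_p=O_p x_p$. Left $O$-ideals $\mathfrak a,\mathfrak b$ are in the same class if $\mathfrak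 a=\mathfrak b x$ for some $x\in H^\times$; write $[\mathfrak a]$ for the class of $\mathfrak a$. There are finitely many classes. Let $M(O)$ be the free $\mathbb{Z}$-module on the set of classes and $M_{\mathbb R}(O)=M(O)\otimes\mathbb{R}$, with the height pairing, the bilinear form given by $$\langle[\mathfrak a],[\mathfrak b]\rangle=\tfrac12\,\#\{x\in H^\times:\mathfrak a x=\mathfrak b\}.$$ For $m\ge 1$ let $T_m(\mathfrak a)$ be the set of left $O$-ideals $\mathfrak b\subseteq\mathfrak a$ with $N\mathfrak b=m\,N\mathfrak a$. The Hecke operator $t_m:M(O)\to M(O)$ is the linear map with $t_m[\mathfrak a]=\sum_{\mathfrak b\in T_m(\mathfrak a)}[\mathfrak b]$, extended $\mathbb{R}$-linearly to $M_{\mathbb R}(O)$; moreover $t_0:M_{\mathbb R}(O)\to M_{\mathbb R}(O)$ is the linear map with $t_0[\mathfrak a]=\tfrac12\sum_{[\mathfrak c]}\frac{1}{\langle[\mathfrak c],[\mathfrak c]\rangle}[\mathfrak c]$, the sum being over all classes. Then the sets $T_m(\mathfrak a)$, $m\ge1$, are finite, and: 1. $t_m$ is self-adjoint for the height pairing: $\langle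 t_m v,w\rangle=\langle v,t_m w\rangle$ for all $v,w\in M(O)$ if $m\ge 1$, and for all $v,w\in M_{\mathbb R}(O)$ if $m\ge 0$. 2. If $\gcd(m,m')=1$, then $t_{mm'}=t_m t_{m'}$, on $M(O)$ if $m,m'\ge 1$, and on $M_{\mathbb R}(O)$ if $m,m'\ge 0$. 3. If $p$ is a prime with $p\nmid\mathrm{disc}(O)$, then $t_{p^{k+2}}=t_{p^{k+1}}t_p-p\,t_{p^k}$ on $M(O)$ for every integer $k\ge 0$. -/

import Mathlib

open scoped Quaternion

noncomputable section

namespace QuatHecke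

/-! ### Reduced norm and trace -/

section Norm

variable {R : Type*} [CommRing R] {α β : R}

/-- Reduced norm `x * conj x` of the quaternion algebra with `i ^ 2 = α`, `j ^ 2 = β`, `ij = -ji`. -/
def nrd (x : ℍ[R,α,β]) : R := (x * star x).re

/-- Reduced trace `x + conj x`. -/
def trd (x : ℍ[R,α,β]) : R := (x + star x).re

theorem nrd_mul (x y : ℍ[R,α,β]) : nrd (x * y) = nrd x * nrd y := by
  simp only [nrd, QuaternionAlgebra.re_mul, QuaternionAlgebra.imI_mul, QuaternionAlgebra.imJ_mul,
    QuaternionAlgebra.imK_mul, QuaternionAlgebra.re_star, QuaternionAlgebra.imI_star,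
    QuaternionAlgebra.imJ_star, QuaternionAlgebra.imK_star]
  ring

theorem nrd_one : nrd (1 : ℍ[R,α,β]) = 1 := by
  simp [nrd]

theorem mul_star_eq (x : ℍ[R,α,β]) : x * star x = algebraMap R ℍ[R,α,β] (nrd x) := by
  rw [QuaternionAlgebra.mul_star_eq_coe]; rfl

theorem add_star_eq (x : ℍ[R,α,β]) : x + star x = algebraMap R ℍ[R,α,β] (trd x) := by
  ext <;> simp [trd, QuaternionAlgebra.coe_algebraMap]

end Norm

variable {α β : ℚ}

theorem nrd_unit_ne_zero (x : (ℍ[ℚ,α,β])ˣ) : nrd (x : ℍ[ℚ,α,β]) ≠ 0 := by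
  intro h
  have h1 : nrd ((x : ℍ[ℚ,α,β]) * ((x⁻¹ : (ℍ[ℚ,α,β])ˣ) : ℍ[ℚ,α,β])) = 1 := by
    rw [Units.mul_inv, nrd_one]
  rw [nrd_mul, h, zero_mul] at h1
  exact zero_ne_one h1

/-! ### Norm and discriminant of a lattice, orders -/

/-- `g` is the greatest common divisor of the set `S` of rational numbers: the non-negative
generator of the subgroup of `ℚ` generated by `S`. -/
def IsGCD (S : Set ℚ) (g : ℚ) : Prop :=
  0 ≤ g ∧ Submodule.span ℤ S = Submodule.span ℤ {g}

open Classical in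
/-- The greatest common divisor of a set of rational numbers (`0` if there is none). -/
def ratGCD (S : Set ℚ) : ℚ :=
  if h : ∃ g, IsGCD S g then h.choose else 0

/-- The norm of a lattice: the gcd of the reduced norms of its elements. -/
def latticeNorm (L : Submodule ℤ ℍ[ℚ,α,β]) : ℚ :=
  ratGCD {r | ∃ x ∈ L, r = nrd x}

/-- The normalized quadratic form `nrd x / latticeNorm L` of a lattice. -/
def normForm (L : Submodule ℤ ℍ[ℚ,α,β]) (x : ℍ[ℚ,α,β]) : ℚ :=
  nrd x / latticeNorm L

/-- The determinant of the normalized form of a lattice: the determinant of the Gram matrix of the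
polar form `Q (x + y) - Q x - Q y` in a `ℤ`-basis (all `ℤ`-bases give the same value). -/
def gramDet (L : Submodule ℤ ℍ[ℚ,α,β]) [L.IsLattice ℚ] : ℚ :=
  Matrix.det (Matrix.of fun i j : Module.Free.ChooseBasisIndex ℤ L =>
    QuadraticMap.polar (normForm L) (Module.Free.chooseBasis ℤ L i : ℍ[ℚ,α,β])
      (Module.Free.chooseBasis ℤ L j : ℍ[ℚ,α,β]))

/-- `disc L`: the positive square root of the determinant of the normalized form, which is the
square of a positive integer. For an order, this is its reduced discriminant. -/
def disc (L : Submodule ℤ ℍ[ℚ,α,β]) [L.IsLattice ℚ] : ℕ :=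
  Nat.sqrt (gramDet L).num.natAbs

/-- The additive group of a subring, as a `ℤ`-submodule. -/
abbrev toLat (O : Subring ℍ[ℚ,α,β]) : Submodule ℤ ℍ[ℚ,α,β] :=
  AddSubgroup.toIntSubmodule O.toAddSubgroup

/-- An order: a subring that is a lattice. -/
class IsOrder (O : Subring ℍ[ℚ,α,β]) : Prop where
  isLattice : (toLat O).IsLattice ℚ

instance (O : Subring ℍ[ℚ,α,β]) [h : IsOrder O] : (toLat O).IsLattice ℚ := h.isLattice

/-! ### Localization and ideals -/

/-- The canonical map from `H` to `H_p = H ⊗ ℚ_p`. -/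
def toLocal (p : ℕ) [Fact p.Prime] (x : ℍ[ℚ,α,β]) : ℍ[ℚ_[p],(α : ℚ_[p]),(β : ℚ_[p])] :=
  ⟨x.re, x.imI, x.imJ, x.imK⟩

theorem toLocal_mul (p : ℕ) [Fact p.Prime] (x y : ℍ[ℚ,α,β]) :
    toLocal p (x * y) = toLocal p x * toLocal p y := by
  ext <;> simp [toLocal]

theorem toLocal_one (p : ℕ) [Fact p.Prime] : toLocal p (1 : ℍ[ℚ,α,β]) = 1 := by
  ext <;> simp [toLocal]

/-- The image in `H_p` of an invertible element of `H`. -/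
def toLocalUnit (p : ℕ) [Fact p.Prime] (x : (ℍ[ℚ,α,β])ˣ) :
    (ℍ[ℚ_[p],(α : ℚ_[p]),(β : ℚ_[p])])ˣ where
  val := toLocal p x
  inv := toLocal p ((x⁻¹ : (ℍ[ℚ,α,β])ˣ) : ℍ[ℚ,α,β])
  val_inv := by rw [← toLocal_mul, Units.mul_inv, toLocal_one]
  inv_val := by rw [← toLocal_mul, Units.inv_mul, toLocal_one]

/-- The localization `L_p = L ⊗ ℤ_p`, as the `ℤ_p`-span of `L` in `H_p`. -/
def localize (p : ℕ) [Fact p.Prime] (L : Submodule ℤ ℍ[ℚ,α,β]) :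
    Submodule ℤ_[p] ℍ[ℚ_[p],(α : ℚ_[p]),(β : ℚ_[p])] :=
  Submodule.span ℤ_[p] (toLocal p '' L)

/-- The lattice `L x`. -/
def mulRight (L : Submodule ℤ ℍ[ℚ,α,β]) (x : ℍ[ℚ,α,β]) : Submodule ℤ ℍ[ℚ,α,β] :=
  L.map (AddMonoidHom.mulRight x).toIntLinearMap

/-- Left `O`-ideals: lattices `L` such that for every prime `p` there is an invertible `x_p` in
`H_p` with `L_p = O_p x_p`. -/
structure IsLeftIdeal (O : Subring ℍ[ℚ,α,β]) (L : Submodule ℤ ℍ[ℚ,α,β]) : Prop where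
  isLattice : L.IsLattice ℚ
  locallyPrincipal : ∀ (p : ℕ) [Fact p.Prime], ∃ x : (ℍ[ℚ_[p],(α : ℚ_[p]),(β : ℚ_[p])])ˣ,
    (localize p L : Set ℍ[ℚ_[p],(α : ℚ_[p]),(β : ℚ_[p])]) =
      (fun y => y * (x : ℍ[ℚ_[p],(α : ℚ_[p]),(β : ℚ_[p])])) '' (localize p (toLat O))

/-- The set of left `O`-ideals. -/
abbrev LeftIdeal (O : Subring ℍ[ℚ,α,β]) : Type := {L : Submodule ℤ ℍ[ℚ,α,β] // IsLeftIdeal O L}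

theorem mem_mulRight {L : Submodule ℤ ℍ[ℚ,α,β]} {x y : ℍ[ℚ,α,β]} :
    y ∈ mulRight L x ↔ ∃ z ∈ L, z * x = y := by
  simp [mulRight, Submodule.mem_map]

theorem mulRight_one (L : Submodule ℤ ℍ[ℚ,α,β]) : mulRight L 1 = L := by
  ext y; simp [mem_mulRight]

theorem mulRight_mulRight (L : Submodule ℤ ℍ[ℚ,α,β]) (x y : ℍ[ℚ,α,β]) :
    mulRight (mulRight L x) y = mulRight L (x * y) := by
  ext z; simp [mem_mulRight, mul_assoc]

theorem mulRight_unit_inv (L : Submodule ℤ ℍ[ℚ,α,β]) (x : (ℍ[ℚ,α,β])ˣ) :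
    mulRight (mulRight L x) ((x⁻¹ : (ℍ[ℚ,α,β])ˣ) : ℍ[ℚ,α,β]) = L := by
  rw [mulRight_mulRight, Units.mul_inv, mulRight_one]

theorem mulRight_inv_unit (L : Submodule ℤ ℍ[ℚ,α,β]) (x : (ℍ[ℚ,α,β])ˣ) :
    mulRight (mulRight L ((x⁻¹ : (ℍ[ℚ,α,β])ˣ) : ℍ[ℚ,α,β])) x = L := by
  rw [mulRight_mulRight, Units.inv_mul, mulRight_one]

theorem mulRight_mono {L M : Submodule ℤ ℍ[ℚ,α,β]} (h : L ≤ M) (x : ℍ[ℚ,α,β]) :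
    mulRight L x ≤ mulRight M x :=
  Submodule.map_mono h

theorem localize_mulRight (p : ℕ) [Fact p.Prime] (L : Submodule ℤ ℍ[ℚ,α,β]) (x : ℍ[ℚ,α,β]) :
    (localize p (mulRight L x) : Set ℍ[ℚ_[p],(α : ℚ_[p]),(β : ℚ_[p])]) =
      (fun y => y * toLocal p x) '' (localize p L) := by
  have h : localize p (mulRight L x) =
      (localize p L).map (LinearMap.mulRight ℤ_[p] (toLocal p x)) := by
    rw [localize, localize, Submodule.map_span]
    congr 1
    ext y
    constructor
    · rintro ⟨_, hw, rfl⟩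
      obtain ⟨z, hz, rfl⟩ := mem_mulRight.1 hw
      exact ⟨toLocal p z, ⟨z, hz, rfl⟩, (toLocal_mul p z x).symm⟩
    · rintro ⟨_, ⟨z, hz, rfl⟩, rfl⟩
      exact ⟨z * x, mem_mulRight.2 ⟨z, hz, rfl⟩, toLocal_mul p z x⟩
  rw [h]
  ext y
  simp

theorem isLattice_mulRight {L : Submodule ℤ ℍ[ℚ,α,β]} (h : L.IsLattice ℚ) (x : (ℍ[ℚ,α,β])ˣ) :
    (mulRight L x).IsLattice ℚ := by
  refine ⟨h.fg.map _, ?_⟩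
  rw [eq_top_iff]
  rintro y -
  have hy : y * ((x⁻¹ : (ℍ[ℚ,α,β])ˣ) : ℍ[ℚ,α,β]) ∈
      Submodule.span ℚ (L : Set ℍ[ℚ,α,β]) := by
    rw [h.span_eq_top]; trivial
  have := Submodule.mem_map_of_mem (f := LinearMap.mulRight ℚ (x : ℍ[ℚ,α,β])) hy
  rw [Submodule.map_span] at this
  simp only [LinearMap.mulRight_apply, mul_assoc, Units.inv_mul, mul_one] at this
  refine Submodule.span_mono ?_ this
  rintro _ ⟨z, hz, rfl⟩
  exact mem_mulRight.2 ⟨z, hz, rfl⟩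

theorem isLeftIdeal_mulRight {O : Subring ℍ[ℚ,α,β]} {L : Submodule ℤ ℍ[ℚ,α,β]}
    (h : IsLeftIdeal O L) (x : (ℍ[ℚ,α,β])ˣ) : IsLeftIdeal O (mulRight L x) := by
  refine ⟨isLattice_mulRight h.isLattice x, fun p _ => ?_⟩
  obtain ⟨y, hy⟩ := h.locallyPrincipal p
  refine ⟨y * toLocalUnit p x, ?_⟩
  rw [localize_mulRight, hy, Set.image_image]
  simp [toLocalUnit, mul_assoc]

/-- The left ideal `L x`, for `x` invertible. -/
def LeftIdeal.mul {O : Subring ℍ[ℚ,α,β]} (a : LeftIdeal O) (x : (ℍ[ℚ,α,β])ˣ) : LeftIdeal O :=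
  ⟨mulRight a.1 x, isLeftIdeal_mulRight a.2 x⟩

/-- Left ideals `a`, `b` are in the same class if `a = b x` with `x` invertible. -/
instance idealSetoid (O : Subring ℍ[ℚ,α,β]) : Setoid (LeftIdeal O) where
  r a b := ∃ x : (ℍ[ℚ,α,β])ˣ, a.1 = mulRight b.1 x
  iseqv :=
    { refl := fun a => ⟨1, by rw [Units.val_one, mulRight_one]⟩
      symm := by
        rintro a b ⟨x, hx⟩
        exact ⟨x⁻¹, by rw [hx, mulRight_unit_inv]⟩
      trans := by
        rintro a b c ⟨x, hx⟩ ⟨y, hy⟩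
        exact ⟨y * x, by rw [hx, hy, mulRight_mulRight, Units.val_mul]⟩ }

/-- The set of left `O`-ideal classes. -/
abbrev IdealClass (O : Subring ℍ[ℚ,α,β]) : Type := Quotient (idealSetoid O)

/-- The class of a left ideal. -/
def cls {O : Subring ℍ[ℚ,α,β]} (a : LeftIdeal O) : IdealClass O := Quotient.mk _ a

theorem cls_mul {O : Subring ℍ[ℚ,α,β]} (a : LeftIdeal O) (x : (ℍ[ℚ,α,β])ˣ) :
    cls (a.mul x) = cls a :=
  Quotient.sound ⟨x, rfl⟩

/-! ### Modules and the height pairing -/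

/-- The free `R`-module on the ideal classes: `M(O)` for `R = ℤ`, and `M_ℝ(O)` for `R = ℝ`. -/
abbrev IdealModule (R : Type*) [CommRing R] (O : Subring ℍ[ℚ,α,β]) : Type _ := IdealClass O →₀ R

/-- The inclusion of `M(O)` into `M_ℝ(O)`. -/
def toReal {O : Subring ℍ[ℚ,α,β]} (v : IdealModule ℤ O) : IdealModule ℝ O :=
  v.mapRange (fun n : ℤ => (n : ℝ)) Int.cast_zero

/-- The invertible `x` with `a x = b`. -/
def transporter {O : Subring ℍ[ℚ,α,β]} (a b : LeftIdeal O) : Set (ℍ[ℚ,α,β])ˣ :=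
  {x | mulRight a.1 x = b.1}

/-- The height pairing of two ideal classes: half the number of invertible `x` with `a x = b`. -/
def heightClass {O : Subring ℍ[ℚ,α,β]} : IdealClass O → IdealClass O → ℝ :=
  Quotient.lift₂ (fun a b => (1 / 2 : ℝ) * Nat.card (transporter a b)) (by
    rintro a b a' b' ⟨x, hx⟩ ⟨y, hy⟩
    have : Nat.card (transporter a b) = Nat.card (transporter a' b') := by
      refine Nat.card_congr
        { toFun := fun u => ⟨x * u.1 * y⁻¹, ?_⟩
          invFun := fun u => ⟨x⁻¹ * u.1 * y, ?_⟩
          left_inv := fun u => Subtype.ext (by simp [mul_assoc])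
          right_inv := fun u => Subtype.ext (by simp [mul_assoc]) }
      · have hu : mulRight a.1 u.1 = b.1 := u.2
        change mulRight a'.1 _ = b'.1
        rw [Units.val_mul, Units.val_mul, ← mulRight_mulRight, ← mulRight_mulRight, ← hx, hu, hy,
          mulRight_unit_inv]
      · have hu : mulRight a'.1 u.1 = b'.1 := u.2
        change mulRight a.1 _ = b.1
        rw [Units.val_mul, Units.val_mul, ← mulRight_mulRight, ← mulRight_mulRight, hx,
          mulRight_unit_inv, hu, hy]
    simp only [this])

/-- The height pairing on `M_ℝ(O)`, extended bilinearly. -/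
def height (O : Subring ℍ[ℚ,α,β]) : IdealModule ℝ O →ₗ[ℝ] IdealModule ℝ O →ₗ[ℝ] ℝ :=
  Finsupp.linearCombination ℝ fun c => Finsupp.linearCombination ℝ fun d => heightClass c d

/-- `e₀`, the sum over all classes `c` of the dual vectors `c / ⟨c, c⟩` (the number of classes is
finite). -/
def e₀ (O : Subring ℍ[ℚ,α,β]) : IdealModule ℝ O :=
  ∑ᶠ c : IdealClass O, Finsupp.single c (1 / heightClass c c)

/-! ### Hecke operators -/

/-- `T_m(a)`: the left ideals `b` contained in `a` with `N(b) = m N(a)`. -/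
def heckeSet {O : Subring ℍ[ℚ,α,β]} (m : ℕ) (a : LeftIdeal O) : Set (LeftIdeal O) :=
  {b | b.1 ≤ a.1 ∧ latticeNorm b.1 = m * latticeNorm a.1}

theorem isGCD_smul {S : Set ℚ} {g : ℚ} (h : IsGCD S g) (c : ℚ) :
    IsGCD ((fun r => c * r) '' S) (|c| * g) := by
  refine ⟨mul_nonneg (abs_nonneg c) h.1, ?_⟩
  have h1 : Submodule.span ℤ ((fun r => c * r) '' S) = Submodule.span ℤ {c * g} := by
    have := congrArg (Submodule.map (AddMonoidHom.mulLeft c).toIntLinearMap) h.2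
    rw [Submodule.map_span, Submodule.map_span, Set.image_singleton] at this
    exact this
  rw [h1]
  rcases abs_choice c with hc | hc <;> rw [hc]
  rw [neg_mul, ← Set.neg_singleton, Submodule.span_neg]

theorem isGCD_unique {S : Set ℚ} {g g' : ℚ} (h : IsGCD S g) (h' : IsGCD S g') : g = g' := by
  have e : Submodule.span ℤ {g} = Submodule.span ℤ {g'} := h.2.symm.trans h'.2
  obtain ⟨u, hu⟩ := Submodule.mem_span_singleton.1 (e ▸ Submodule.mem_span_singleton_self g)
  obtain ⟨v, hv⟩ := Submodule.mem_span_singleton.1 (e ▸ Submodule.mem_span_singleton_self g')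
  rw [zsmul_eq_mul] at hu hv
  have key : ∀ {s t : ℚ} {n : ℤ}, 0 ≤ s → 0 ≤ t → (n : ℚ) * s = t → t ≠ 0 → s ≤ t := by
    intro s t n hs ht hn h0
    have hs0 : 0 < s := lt_of_le_of_ne hs (by rintro rfl; simp at hn; exact h0 hn.symm)
    have hn0 : (0 : ℚ) < n := by
      by_contra hneg
      exact h0 (le_antisymm (hn ▸ mul_nonpos_of_nonpos_of_nonneg (not_lt.1 hneg) hs) ht)
    have : (1 : ℚ) ≤ n := by exact_mod_cast hn0
    nlinarith
  by_cases hg : g = 0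
  · rw [hg, mul_zero] at hv; rw [hg, hv]
  by_cases hg' : g' = 0
  · rw [hg', mul_zero] at hu; rw [hg', hu]
  exact le_antisymm (key h.1 h'.1 hv hg') (key h'.1 h.1 hu hg)

theorem ratGCD_eq {S : Set ℚ} {g : ℚ} (h : IsGCD S g) : ratGCD S = g := by
  have hex : ∃ g, IsGCD S g := ⟨g, h⟩
  rw [ratGCD, dif_pos hex]
  exact isGCD_unique hex.choose_spec h

theorem ratGCD_smul (S : Set ℚ) {c : ℚ} (hc : c ≠ 0) :
    ratGCD ((fun r => c * r) '' S) = |c| * ratGCD S := by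
  by_cases h : ∃ g, IsGCD S g
  · obtain ⟨g, hg⟩ := h
    rw [ratGCD_eq hg, ratGCD_eq (isGCD_smul hg c)]
  · have h' : ¬ ∃ g, IsGCD ((fun r => c * r) '' S) g := by
      rintro ⟨g, hg⟩
      apply h
      have := isGCD_smul hg c⁻¹
      simp only [Set.image_image, inv_mul_cancel_left₀ hc, Set.image_id'] at this
      exact ⟨_, this⟩
    rw [ratGCD, ratGCD, dif_neg h, dif_neg h', mul_zero]

theorem latticeNorm_mulRight (L : Submodule ℤ ℍ[ℚ,α,β]) (x : (ℍ[ℚ,α,β])ˣ) :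
    latticeNorm (mulRight L x) = |nrd (x : ℍ[ℚ,α,β])| * latticeNorm L := by
  rw [latticeNorm, latticeNorm, ← ratGCD_smul _ (nrd_unit_ne_zero x)]
  congr 1
  ext r
  constructor
  · rintro ⟨y, hy, rfl⟩
    obtain ⟨z, hz, rfl⟩ := mem_mulRight.1 hy
    exact ⟨nrd z, ⟨z, hz, rfl⟩, by simp only [nrd_mul]; ring⟩
  · rintro ⟨_, ⟨z, hz, rfl⟩, rfl⟩
    exact ⟨z * x, mem_mulRight.2 ⟨z, hz, rfl⟩, by simp only [nrd_mul]; ring⟩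

theorem mul_mem_heckeSet {O : Subring ℍ[ℚ,α,β]} {m : ℕ} {a b : LeftIdeal O}
    (h : b ∈ heckeSet m a) (x : (ℍ[ℚ,α,β])ˣ) : b.mul x ∈ heckeSet m (a.mul x) := by
  refine ⟨mulRight_mono h.1 _, ?_⟩
  change latticeNorm (mulRight b.1 x) = m * latticeNorm (mulRight a.1 x)
  rw [latticeNorm_mulRight, latticeNorm_mulRight, h.2]
  ring

/-- `t_m [a] = ∑_{b ∈ T_m(a)} [b]` (the set `T_m(a)` is finite for `m ≥ 1`). -/
def heckeClass {O : Subring ℍ[ℚ,α,β]} (R : Type*) [CommRing R] (m : ℕ) :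
    IdealClass O → IdealModule R O :=
  Quotient.lift (fun a => ∑ᶠ b : heckeSet m a, Finsupp.single (cls b.1) (1 : R)) (by
    rintro a a' ⟨x, hx⟩
    have ha : a = a'.mul x := Subtype.ext hx
    subst ha
    have h1 : ∀ c : LeftIdeal O, (c.mul x).mul x⁻¹ = c := fun c =>
      Subtype.ext (mulRight_unit_inv c.1 x)
    have h2 : ∀ c : LeftIdeal O, (c.mul x⁻¹).mul x = c := fun c =>
      Subtype.ext (mulRight_inv_unit c.1 x)
    let e : heckeSet m a' ≃ heckeSet m (a'.mul x) :=
      { toFun := fun b => ⟨b.1.mul x, mul_mem_heckeSet b.2 x⟩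
        invFun := fun b => ⟨b.1.mul x⁻¹, by
          have := mul_mem_heckeSet b.2 x⁻¹
          rwa [h1] at this⟩
        left_inv := fun b => Subtype.ext (h1 b.1)
        right_inv := fun b => Subtype.ext (h2 b.1) }
    refine (finsum_eq_of_bijective e e.bijective fun b => ?_).symm
    change _ = Finsupp.single (cls (b.1.mul x)) (1 : R)
    rw [cls_mul])

/-- The Hecke operator `t_m`, `m ≥ 1`, on the free `R`-module on the ideal classes. -/
def hecke (R : Type*) [CommRing R] (O : Subring ℍ[ℚ,α,β]) (m : ℕ) :
    IdealModule R O →ₗ[R] IdealModule R O :=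
  Finsupp.linearCombination R (heckeClass R m)

/-- The operator `t_0`, with `t_0 [a] = e₀ / 2` for all `a`. -/
def heckeZero (O : Subring ℍ[ℚ,α,β]) : IdealModule ℝ O →ₗ[ℝ] IdealModule ℝ O :=
  Finsupp.linearCombination ℝ fun _ => (1 / 2 : ℝ) • e₀ O

/-- The operators `t_m`, `m ≥ 0`, on `M_ℝ(O)`. -/
def heckeReal (O : Subring ℍ[ℚ,α,β]) (m : ℕ) : IdealModule ℝ O →ₗ[ℝ] IdealModule ℝ O :=
  if m = 0 then heckeZero O else hecke ℝ O m

end QuatHecke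

end

noncomputable section

namespace QuatHecke

/-! ### Norm and trace -/

section Algebra

variable {R : Type*} [CommRing R] {a b : R}

/-! Everything rests on describing left ideals by local generators taken in `H` itself. A generator
of the completion at `p` can be replaced by a nearby element of the ideal
(`IsLeftIdeal.exists_isGen`), and conversely a lattice with such generators at all primes is a left
ideal (`isLeftIdeal_of_isGen`). The `p`-part of the norm of an ideal is that of the reduced norm of
its generator at `p` (`IsGen.padicNorm_latticeNorm`).

The key consequence is `smul_mem_of_mem_heckeSet`: an ideal `b ⊆ a` of norm `m N(a)` contains `m a`.
Hence `T_m(a)` injects into the subgroups of the finite group `a / m a`, and `b ⊆ a` with equal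
norms forces `b = a`. It also gives self-adjointness: if `c ∈ T_m(a)` and `c x = b`, then `m a x ∈
T_m(b)`, and `x ↦ m x` is a bijection between the incidences counted on the two sides
(`heckeTransporterEquiv`).

A product `t_m t_{m'}` applied to `[a]` weights each `c ∈ T_{mm'}(a)` by the number of `b ∈
T_{m'}(a)` containing it (`hecke_heckeClass`). For coprime indices the only such `b` is `c + m' a`,
which agrees with `a` at primes not dividing `m'` and with `c` at the others.

For `p` prime to the discriminant, the trace form on `O / pO` is nondegenerate. Chevalley–Warning
provides an isotropic vector, from which matrix units are built, so `O / pO` is the algebra of `2 ×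
2` matrices over `𝔽_p` (`exists_reduction`). After moving `a` in its class so that it agrees with
`O` at `p`, the ideals in `T_p(a)` correspond to the `p + 1` lines of the plane, each consisting of
the elements that kill its line. A given `c ∈ T_{p^{k+2}}(a)` lies in all of them if `c ⊆ p a`, and
in exactly one otherwise (`card_intermediate`). The excess `p` over the ideals in `p a` is the term
`p t_{p^k}`.

The operator `t_0` sends `v` to half its degree times the vector `e₀`, which represents the degree
for the height pairing. Its self-adjointness needs only the finiteness of the class number
(`finite_idealClass`), proved by division by an element of least norm and a pigeonhole argument. -/

theorem nrd_eq (x : ℍ[R,a,b]) :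
    nrd x = x.re ^ 2 - a * x.imI ^ 2 - b * x.imJ ^ 2 + a * b * x.imK ^ 2 := by
  simp only [nrd, QuaternionAlgebra.re_mul, QuaternionAlgebra.re_star, QuaternionAlgebra.imI_star,
    QuaternionAlgebra.imJ_star, QuaternionAlgebra.imK_star]
  ring

theorem trd_eq (x : ℍ[R,a,b]) : trd x = 2 * x.re := by
  simp [trd]; ring

theorem nrd_star (x : ℍ[R,a,b]) : nrd (star x) = nrd x := by
  simp [nrd_eq]

theorem star_mul_eq (x : ℍ[R,a,b]) : star x * x = algebraMap R ℍ[R,a,b] (nrd x) := by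
  rw [← nrd_star, ← mul_star_eq, star_star]

theorem trd_add (x y : ℍ[R,a,b]) : trd (x + y) = trd x + trd y := by
  simp [trd_eq]; ring

theorem trd_mul_comm (x y : ℍ[R,a,b]) : trd (x * y) = trd (y * x) := by
  simp [trd_eq]; ring

theorem trd_smul (c : R) (x : ℍ[R,a,b]) : trd (c • x) = c * trd x := by
  simp [trd_eq]; ring

theorem trd_star (x : ℍ[R,a,b]) : trd (star x) = trd x := by
  simp [trd_eq]

theorem nrd_add (x y : ℍ[R,a,b]) : nrd (x + y) = nrd x + nrd y + trd (x * star y) := by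
  simp [nrd_eq, trd_eq]; ring

theorem nrd_smul (c : R) (x : ℍ[R,a,b]) : nrd (c • x) = c ^ 2 * nrd x := by
  simp [nrd_eq]; ring

theorem nrd_zero : nrd (0 : ℍ[R,a,b]) = 0 := by simp [nrd]

theorem star_eq_trd_sub (x : ℍ[R,a,b]) : star x = algebraMap R ℍ[R,a,b] (trd x) - x := by
  rw [← add_star_eq]; abel

theorem trd_eq_nrd (x : ℍ[R,a,b]) : trd x = nrd (1 + x) - 1 - nrd x := by
  simp [trd_eq, nrd_eq]; ring

/-- The identity `x w x = tr(x w) x - N(x) w̄`. -/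
theorem mul_mul_self_eq (x w : ℍ[R,a,b]) : x * w * x = trd (x * w) • x - nrd x • star w := by
  ext <;> simp [trd_eq, nrd_eq] <;> ring

end Algebra

section Rational

variable {α β : ℚ}

theorem nrd_zsmul (n : ℤ) (x : ℍ[ℚ,α,β]) : nrd (n • x) = (n : ℚ) ^ 2 * nrd x := by
  rw [← Int.cast_smul_eq_zsmul ℚ, nrd_smul]

theorem trd_zsmul (n : ℤ) (x : ℍ[ℚ,α,β]) : trd (n • x) = (n : ℚ) * trd x := by
  rw [← Int.cast_smul_eq_zsmul ℚ, trd_smul]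

theorem nrd_pos (hα : α < 0) (hβ : β < 0) {x : ℍ[ℚ,α,β]} (hx : x ≠ 0) : 0 < nrd x := by
  rw [nrd_eq]
  have h1 : 0 ≤ -α * x.imI ^ 2 := mul_nonneg (by linarith) (sq_nonneg _)
  have h2 : 0 ≤ -β * x.imJ ^ 2 := mul_nonneg (by linarith) (sq_nonneg _)
  have h3 : 0 ≤ α * β * x.imK ^ 2 := mul_nonneg (mul_pos_of_neg_of_neg hα hβ).le (sq_nonneg _)
  have h0 := sq_nonneg x.re
  by_contra h
  apply hx
  have e0 : x.re ^ 2 = 0 := by linarith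
  have e1 : -α * x.imI ^ 2 = 0 := by linarith
  have e2 : -β * x.imJ ^ 2 = 0 := by linarith
  have e3 : α * β * x.imK ^ 2 = 0 := by linarith
  ext <;> simp_all [hα.ne, hβ.ne]

theorem nrd_nonneg (hα : α < 0) (hβ : β < 0) (x : ℍ[ℚ,α,β]) : 0 ≤ nrd x := by
  rcases eq_or_ne x 0 with rfl | h
  · rw [nrd_zero]
  · exact (nrd_pos hα hβ h).le

theorem nrd_eq_zero (hα : α < 0) (hβ : β < 0) {x : ℍ[ℚ,α,β]} : nrd x = 0 ↔ x = 0 :=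
  ⟨fun h => by_contra fun hx => (nrd_pos hα hβ hx).ne' h, fun h => h ▸ nrd_zero⟩

/-- In a definite quaternion algebra every nonzero element is invertible. -/
theorem exists_unit (hα : α < 0) (hβ : β < 0) {x : ℍ[ℚ,α,β]} (hx : x ≠ 0) :
    ∃ u : (ℍ[ℚ,α,β])ˣ, (u : ℍ[ℚ,α,β]) = x := by
  have h := (nrd_pos hα hβ hx).ne'
  refine ⟨⟨x, (nrd x)⁻¹ • star x, ?_, ?_⟩, rfl⟩
  · rw [mul_smul_comm, mul_star_eq, Algebra.algebraMap_eq_smul_one, smul_smul, inv_mul_cancel₀ h,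
      one_smul]
  · rw [smul_mul_assoc, star_mul_eq, Algebra.algebraMap_eq_smul_one, smul_smul, inv_mul_cancel₀ h,
      one_smul]

theorem unit_inv_eq (x : (ℍ[ℚ,α,β])ˣ) :
    ((x⁻¹ : (ℍ[ℚ,α,β])ˣ) : ℍ[ℚ,α,β]) = (nrd (x : ℍ[ℚ,α,β]))⁻¹ • star (x : ℍ[ℚ,α,β]) := by
  have h := nrd_unit_ne_zero x
  have h1 : (x : ℍ[ℚ,α,β]) * ((nrd (x : ℍ[ℚ,α,β]))⁻¹ • star (x : ℍ[ℚ,α,β])) = 1 := by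
    rw [mul_smul_comm, mul_star_eq, Algebra.algebraMap_eq_smul_one, smul_smul, inv_mul_cancel₀ h,
      one_smul]
  rw [← Units.inv_mul_cancel_left x ((nrd (x : ℍ[ℚ,α,β]))⁻¹ • star (x : ℍ[ℚ,α,β])), h1, mul_one]

theorem nrd_unit_inv (x : (ℍ[ℚ,α,β])ˣ) :
    nrd ((x⁻¹ : (ℍ[ℚ,α,β])ˣ) : ℍ[ℚ,α,β]) = (nrd (x : ℍ[ℚ,α,β]))⁻¹ := by
  refine eq_inv_of_mul_eq_one_left ?_
  rw [← nrd_mul, Units.inv_mul, nrd_one]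

theorem mem_mulRight_unit {L : Submodule ℤ ℍ[ℚ,α,β]} {x : (ℍ[ℚ,α,β])ˣ} {y : ℍ[ℚ,α,β]} :
    y ∈ mulRight L x ↔ y * ((x⁻¹ : (ℍ[ℚ,α,β])ˣ) : ℍ[ℚ,α,β]) ∈ L := by
  rw [mem_mulRight]
  constructor
  · rintro ⟨z, hz, rfl⟩
    rwa [mul_assoc, Units.mul_inv, mul_one]
  · intro h
    exact ⟨_, h, by rw [mul_assoc, Units.inv_mul, mul_one]⟩

/-- A nonzero integer as a unit of the quaternion algebra. -/
def intUnit (m : ℤ) (hm : m ≠ 0) : (ℍ[ℚ,α,β])ˣ :=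
  Units.map (algebraMap ℚ ℍ[ℚ,α,β]).toMonoidHom (Units.mk0 (m : ℚ) (by exact_mod_cast hm))

theorem mul_intUnit (m : ℤ) (hm : m ≠ 0) (y : ℍ[ℚ,α,β]) :
    y * (intUnit m hm : (ℍ[ℚ,α,β])ˣ) = m • y := by
  simp only [intUnit, Units.coe_map, Units.val_mk0, MonoidHom.coe_coe, RingHom.toMonoidHom_eq_coe]
  rw [← Algebra.commutes, ← Algebra.smul_def, Int.cast_smul_eq_zsmul]

end Rational

variable {α β : ℚ}

/-! ### Lattices and localization -/

/-- A lattice has a basis over `ℤ` that is a basis of the algebra over `ℚ`. -/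
theorem exists_basis (L : Submodule ℤ ℍ[ℚ,α,β]) [L.IsLattice ℚ] :
    ∃ b : Module.Basis (Fin 4) ℚ ℍ[ℚ,α,β], L = Submodule.span ℤ (Set.range b) := by
  let e := Module.Free.chooseBasis ℤ L
  have hc : Fintype.card (Module.Free.ChooseBasisIndex ℤ L) = 4 := by
    rw [← Module.finrank_eq_card_basis (e.extendOfIsLattice ℚ), QuaternionAlgebra.finrank_eq_four]
  refine ⟨(e.extendOfIsLattice ℚ).reindex (Fintype.equivFinOfCardEq hc), ?_⟩
  rw [Module.Basis.range_reindex]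
  have h1 : Set.range (e.extendOfIsLattice ℚ) = L.subtype '' Set.range e := by
    rw [← Set.range_comp]; congr 1; ext1 i; simp
  rw [h1, ← Submodule.map_span, e.span_eq, Submodule.map_top, Submodule.range_subtype]

theorem mem_span_basis (b : Module.Basis (Fin 4) ℚ ℍ[ℚ,α,β]) (y : ℍ[ℚ,α,β]) :
    y ∈ Submodule.span ℤ (Set.range b) ↔ ∀ i, ∃ n : ℤ, b.repr y i = n := by
  rw [b.mem_span_iff_repr_mem ℤ]
  simp [eq_comm]

section Local

variable (p : ℕ) [hp : Fact p.Prime]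

theorem prime_not_dvd_mul {s t : ℤ} (hs : ¬ (p : ℤ) ∣ s) (ht : ¬ (p : ℤ) ∣ t) :
    ¬ (p : ℤ) ∣ s * t := fun h =>
  ((Nat.prime_iff_prime_int.1 hp.out).dvd_or_dvd h).elim hs ht

theorem prime_not_dvd_one : ¬ (p : ℤ) ∣ 1 := fun h =>
  (Nat.prime_iff_prime_int.1 hp.out).not_isUnit (isUnit_of_dvd_one h)

/-- The localization at `p` inside the rational algebra: the `y` with a multiple in `L` by an
integer prime to `p`. -/
def loc (L : Submodule ℤ ℍ[ℚ,α,β]) : Submodule ℤ ℍ[ℚ,α,β] where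
  carrier := {y | ∃ s : ℤ, ¬ (p : ℤ) ∣ s ∧ s • y ∈ L}
  add_mem' := by
    rintro x y ⟨s, hs, hx⟩ ⟨t, ht, hy⟩
    refine ⟨s * t, prime_not_dvd_mul p hs ht, ?_⟩
    rw [smul_add]
    refine L.add_mem ?_ ?_
    · rw [mul_comm, mul_smul]; exact L.smul_mem _ hx
    · rw [mul_smul]; exact L.smul_mem _ hy
  zero_mem' := ⟨1, prime_not_dvd_one p, by simp⟩
  smul_mem' := by
    rintro n x ⟨s, hs, hx⟩
    exact ⟨s, hs, by rw [smul_comm]; exact L.smul_mem _ hx⟩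

variable {p}

theorem mem_loc {L : Submodule ℤ ℍ[ℚ,α,β]} {y : ℍ[ℚ,α,β]} :
    y ∈ loc p L ↔ ∃ s : ℤ, ¬ (p : ℤ) ∣ s ∧ s • y ∈ L := Iff.rfl

theorem le_loc (L : Submodule ℤ ℍ[ℚ,α,β]) : L ≤ loc p L := fun y hy =>
  ⟨1, prime_not_dvd_one p, by rwa [one_smul]⟩

theorem loc_mono {L M : Submodule ℤ ℍ[ℚ,α,β]} (h : L ≤ M) : loc p L ≤ loc p M := by
  rintro y ⟨s, hs, hy⟩
  exact ⟨s, hs, h hy⟩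

theorem mem_loc_of_smul {L : Submodule ℤ ℍ[ℚ,α,β]} {y : ℍ[ℚ,α,β]} {s : ℤ} (hs : ¬ (p : ℤ) ∣ s)
    (h : s • y ∈ loc p L) : y ∈ loc p L := by
  obtain ⟨t, ht, h⟩ := h
  exact ⟨t * s, prime_not_dvd_mul p ht hs, by rwa [mul_smul]⟩

/-- An index prime to `p` is invisible at `p`. This is how sums and sublattices are later seen to be
locally principal. -/
theorem loc_eq_of_le_of_smul_le {L M : Submodule ℤ ℍ[ℚ,α,β]} (h : L ≤ M) {s : ℤ}
    (hs : ¬ (p : ℤ) ∣ s) (h' : ∀ y ∈ M, s • y ∈ L) : loc p L = loc p M :=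
  le_antisymm (loc_mono h) fun _ ⟨t, ht, hy⟩ =>
    ⟨s * t, prime_not_dvd_mul p hs ht, by rw [mul_smul]; exact h' _ hy⟩

theorem loc_mulRight (L : Submodule ℤ ℍ[ℚ,α,β]) (x : (ℍ[ℚ,α,β])ˣ) :
    loc p (mulRight L x) = mulRight (loc p L) x := by
  ext y
  rw [mem_mulRight_unit, mem_loc, mem_loc]
  simp only [mem_mulRight_unit, smul_mul_assoc]

end Local

/-- A submodule is determined by its localizations. -/
theorem le_of_loc_le {L M : Submodule ℤ ℍ[ℚ,α,β]}
    (h : ∀ (p : ℕ) [Fact p.Prime], L ≤ loc p M) : L ≤ M := by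
  intro y hy
  -- The integers carrying `y` into `M` form an ideal. A prime dividing its generator would
  -- contradict the hypothesis at that prime, so the ideal contains `1`.
  let I : Ideal ℤ :=
    { carrier := {n | n • y ∈ M}
      add_mem' := fun {m n} hm hn => by
        change (m + n) • y ∈ M
        rw [add_smul]; exact M.add_mem hm hn
      zero_mem' := by change (0 : ℤ) • y ∈ M; simp
      smul_mem' := fun c n hn => by
        change (c * n) • y ∈ M
        rw [mul_smul]; exact M.smul_mem _ hn }
  have hI : I = ⊤ := by
    obtain ⟨d, hd⟩ := (IsPrincipalIdealRing.principal I).principal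
    by_contra hne
    have hd1 : d.natAbs ≠ 1 := fun h1 =>
      hne (by rw [hd]; exact Ideal.span_singleton_eq_top.2 (Int.isUnit_iff_natAbs_eq.2 h1))
    obtain ⟨p, hp, hpd⟩ := Nat.exists_prime_and_dvd hd1
    have : Fact p.Prime := ⟨hp⟩
    obtain ⟨s, hs, hsy⟩ := h p hy
    have : s ∈ I := hsy
    rw [hd] at this
    exact hs ((Int.natCast_dvd.2 hpd).trans (Ideal.mem_span_singleton.1 this))
  have : (1 : ℤ) ∈ I := hI ▸ trivial
  have h1 : (1 : ℤ) • y ∈ M := this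
  rwa [one_smul] at h1

/-! ### Comparison of the rational localization with the completion -/

section Padic

variable (p : ℕ) [hp : Fact p.Prime]

theorem toLocal_add (x y : ℍ[ℚ,α,β]) : toLocal p (x + y) = toLocal p x + toLocal p y := by
  ext <;> simp [toLocal]

theorem toLocal_zsmul (n : ℤ) (x : ℍ[ℚ,α,β]) : toLocal p (n • x) = (n : ℤ_[p]) • toLocal p x := by
  ext <;> simp [toLocal, Algebra.smul_def]

theorem nrd_toLocal (x : ℍ[ℚ,α,β]) : nrd (toLocal p x) = (nrd x : ℚ) := by
  simp [nrd_eq, toLocal]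

/-- Extension of a rational linear form to the completion. -/
def localForm (f : ℍ[ℚ,α,β] →ₗ[ℚ] ℚ) :
    ℍ[ℚ_[p],(α : ℚ_[p]),(β : ℚ_[p])] →ₗ[ℤ_[p]] ℚ_[p] where
  toFun y := y.re * (f ⟨1, 0, 0, 0⟩ : ℚ) + y.imI * (f ⟨0, 1, 0, 0⟩ : ℚ)
    + y.imJ * (f ⟨0, 0, 1, 0⟩ : ℚ) + y.imK * (f ⟨0, 0, 0, 1⟩ : ℚ)
  map_add' x y := by simp; ring
  map_smul' c x := by
    simp only [QuaternionAlgebra.re_smul, QuaternionAlgebra.imI_smul, QuaternionAlgebra.imJ_smul,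
      QuaternionAlgebra.imK_smul, RingHom.id_apply]
    simp only [Algebra.smul_def]
    ring

theorem localForm_toLocal (f : ℍ[ℚ,α,β] →ₗ[ℚ] ℚ) (y : ℍ[ℚ,α,β]) :
    localForm p f (toLocal p y) = (f y : ℚ) := by
  have h : y = y.re • (⟨1, 0, 0, 0⟩ : ℍ[ℚ,α,β]) + y.imI • (⟨0, 1, 0, 0⟩ : ℍ[ℚ,α,β])
      + y.imJ • (⟨0, 0, 1, 0⟩ : ℍ[ℚ,α,β]) + y.imK • (⟨0, 0, 0, 1⟩ : ℍ[ℚ,α,β]) := by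
    ext <;> simp
  have h' := congrArg f h
  simp only [map_add, map_smul, smul_eq_mul] at h'
  rw [h']
  simp [localForm, toLocal]

variable {p}

theorem mem_localize_of_smul {L : Submodule ℤ ℍ[ℚ,α,β]}
    {y : ℍ[ℚ_[p],(α : ℚ_[p]),(β : ℚ_[p])]} {s : ℤ} (hs : ¬ (p : ℤ) ∣ s)
    (h : (s : ℤ_[p]) • y ∈ localize p L) : y ∈ localize p L := by
  have hu : IsUnit (s : ℤ_[p]) := by
    rw [PadicInt.isUnit_iff]
    by_contra hne
    exact hs ((PadicInt.norm_int_lt_one_iff_dvd s).1 (lt_of_le_of_ne (PadicInt.norm_le_one _) hne))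
  obtain ⟨u, hu⟩ := hu
  rw [← hu] at h
  have := (localize p L).smul_mem ((u⁻¹ : (ℤ_[p])ˣ) : ℤ_[p]) h
  rwa [smul_smul, Units.inv_mul, one_smul] at this

theorem toLocal_mem_localize {L : Submodule ℤ ℍ[ℚ,α,β]} {y : ℍ[ℚ,α,β]} (hy : y ∈ loc p L) :
    toLocal p y ∈ localize p L := by
  obtain ⟨s, hs, hy⟩ := hy
  refine mem_localize_of_smul hs ?_
  rw [← toLocal_zsmul]
  exact Submodule.subset_span ⟨_, hy, rfl⟩

theorem localize_loc (L : Submodule ℤ ℍ[ℚ,α,β]) : localize p (loc p L) = localize p L := by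
  refine le_antisymm (Submodule.span_le.2 ?_) (Submodule.span_mono (Set.image_mono (le_loc L)))
  rintro _ ⟨y, hy, rfl⟩
  exact toLocal_mem_localize hy

/-- If `p` divided the denominator, the numerator would be a `p`-adic unit, yet equal to a product
of norm less than one. -/
theorem not_dvd_den_of_padicNorm_le_one {c : ℚ} (hc : padicNorm p c ≤ 1) : ¬ (p : ℤ) ∣ c.den := by
  intro hi
  have hn : padicNorm p c.num = 1 := by
    rw [padicNorm.int_eq_one_iff]
    intro hd
    have h2 := Nat.dvd_gcd (Int.natCast_dvd.1 hd) (Int.natCast_dvd_natCast.1 hi)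
    rw [Nat.Coprime.gcd_eq_one c.reduced] at h2
    exact hp.out.one_lt.ne' (Nat.dvd_one.1 h2)
  have hd : padicNorm p (c.den : ℤ) < 1 := (padicNorm.int_lt_one_iff _).2 hi
  rw [← Rat.den_mul_eq_num, padicNorm.mul] at hn
  have h3 : padicNorm p (c.den : ℚ) < 1 := by exact_mod_cast hd
  have h4 := padicNorm.nonneg (p := p) (c.den : ℚ)
  nlinarith

/-- An element of the rational algebra lies in the completion of a lattice if and only if it lies in
its localization. -/
theorem toLocal_mem_localize_iff (L : Submodule ℤ ℍ[ℚ,α,β]) [L.IsLattice ℚ] (y : ℍ[ℚ,α,β]) :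
    toLocal p y ∈ localize p L ↔ y ∈ loc p L := by
  refine ⟨fun h => ?_, toLocal_mem_localize⟩
  obtain ⟨b, hb⟩ := exists_basis L
  -- The coordinate forms of a `ℤ`-basis of `L`, extended to the completion, take values in `ℤ_p` on
  -- all of `localize p L`.
  have hint : ∀ i, ‖((b.repr y i : ℚ) : ℚ_[p])‖ ≤ 1 := by
    intro i
    have key : localize p L ≤
        (LinearMap.range (Algebra.linearMap ℤ_[p] ℚ_[p])).comap (localForm p (b.coord i)) := by
      refine Submodule.span_le.2 ?_
      rintro _ ⟨z, hz, rfl⟩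
      have hz' : z ∈ L := hz
      rw [hb, mem_span_basis] at hz'
      obtain ⟨n, hn⟩ := hz' i
      rw [SetLike.mem_coe, Submodule.mem_comap, localForm_toLocal, b.coord_apply, hn]
      exact ⟨n, by simp⟩
    have := key h
    rw [Submodule.mem_comap, localForm_toLocal, b.coord_apply] at this
    obtain ⟨z, hz⟩ := this
    rw [← hz]
    exact z.2
  have hden : ∀ i, ¬ (p : ℤ) ∣ (b.repr y i).den := fun i => by
    have h1 := hint i
    rw [Padic.eq_padicNorm] at h1
    exact not_dvd_den_of_padicNorm_le_one (by exact_mod_cast h1)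
  -- The product of the coordinate denominators clears them all and is prime to `p`.
  refine ⟨∏ i, ((b.repr y i).den : ℤ), ?_, ?_⟩
  · rw [Prime.dvd_finsetProd_iff (Nat.prime_iff_prime_int.1 hp.out)]
    rintro ⟨i, -, hi⟩
    exact hden i hi
  · rw [hb, mem_span_basis]
    intro i
    refine ⟨(∏ j ∈ Finset.univ.erase i, ((b.repr y j).den : ℤ)) * (b.repr y i).num, ?_⟩
    rw [← Finset.mul_prod_erase _ _ (Finset.mem_univ i), ← Int.cast_smul_eq_zsmul ℚ]
    simp only [map_smul, Finsupp.smul_apply, smul_eq_mul]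
    push_cast
    have := Rat.den_mul_eq_num (b.repr y i)
    rw [← this]
    ring

end Padic

/-! ### Denominators and integrality -/

theorem exists_denominator {L : Submodule ℤ ℍ[ℚ,α,β]} (hL : L.FG) (f : ℍ[ℚ,α,β] →ₗ[ℤ] ℚ) :
    ∃ d : ℤ, 0 < d ∧ ∀ x ∈ L, ∃ n : ℤ, d * f x = n := by
  classical
  obtain ⟨S, rfl⟩ := hL
  refine ⟨∏ s ∈ S, ((f s).den : ℤ), Finset.prod_pos fun s _ => by exact_mod_cast (f s).den_pos,
    fun x hx => ?_⟩
  induction hx using Submodule.span_induction with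
  | mem x hx =>
    refine ⟨(∏ j ∈ S.erase x, ((f j).den : ℤ)) * (f x).num, ?_⟩
    rw [← Finset.mul_prod_erase _ _ hx]
    push_cast
    rw [← Rat.den_mul_eq_num (f x)]
    ring
  | zero => exact ⟨0, by simp⟩
  | add x y _ _ hx hy =>
    obtain ⟨m, hm⟩ := hx
    obtain ⟨n, hn⟩ := hy
    exact ⟨m + n, by rw [map_add, mul_add, hm, hn]; push_cast; rfl⟩
  | smul a x _ hx =>
    obtain ⟨m, hm⟩ := hx
    refine ⟨a * m, ?_⟩
    rw [map_smul, zsmul_eq_mul, mul_left_comm, hm]; push_cast; rfl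

/-- The standard coordinates of the elements of a lattice have a common denominator. -/
theorem exists_coord_denominator {L : Submodule ℤ ℍ[ℚ,α,β]} (hL : L.FG) :
    ∃ d : ℤ, 0 < d ∧ ∀ x ∈ L, ∃ n₀ n₁ n₂ n₃ : ℤ,
      d * x.re = n₀ ∧ d * x.imI = n₁ ∧ d * x.imJ = n₂ ∧ d * x.imK = n₃ := by
  obtain ⟨d₀, h₀, H₀⟩ := exists_denominator hL
    (⟨⟨fun x => x.re, fun _ _ => rfl⟩, fun _ _ => by simp⟩ : ℍ[ℚ,α,β] →ₗ[ℤ] ℚ)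
  obtain ⟨d₁, h₁, H₁⟩ := exists_denominator hL
    (⟨⟨fun x => x.imI, fun _ _ => rfl⟩, fun _ _ => by simp⟩ : ℍ[ℚ,α,β] →ₗ[ℤ] ℚ)
  obtain ⟨d₂, h₂, H₂⟩ := exists_denominator hL
    (⟨⟨fun x => x.imJ, fun _ _ => rfl⟩, fun _ _ => by simp⟩ : ℍ[ℚ,α,β] →ₗ[ℤ] ℚ)
  obtain ⟨d₃, h₃, H₃⟩ := exists_denominator hL
    (⟨⟨fun x => x.imK, fun _ _ => rfl⟩, fun _ _ => by simp⟩ : ℍ[ℚ,α,β] →ₗ[ℤ] ℚ)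
  refine ⟨d₀ * d₁ * d₂ * d₃, by positivity, fun x hx => ?_⟩
  obtain ⟨n₀, e₀⟩ := H₀ x hx
  obtain ⟨n₁, e₁⟩ := H₁ x hx
  obtain ⟨n₂, e₂⟩ := H₂ x hx
  obtain ⟨n₃, e₃⟩ := H₃ x hx
  simp only [LinearMap.coe_mk, AddHom.coe_mk] at e₀ e₁ e₂ e₃
  refine ⟨d₁ * d₂ * d₃ * n₀, d₀ * d₂ * d₃ * n₁, d₀ * d₁ * d₃ * n₂, d₀ * d₁ * d₂ * n₃,
    ?_, ?_, ?_, ?_⟩ <;> push_cast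
  · rw [← e₀]; ring
  · rw [← e₁]; ring
  · rw [← e₂]; ring
  · rw [← e₃]; ring

theorem exists_nrd_denominator {L : Submodule ℤ ℍ[ℚ,α,β]} (hL : L.FG) :
    ∃ d : ℤ, 0 < d ∧ ∀ x ∈ L, ∃ n : ℤ, d * nrd x = n := by
  obtain ⟨d, hd, H⟩ := exists_coord_denominator hL
  refine ⟨d ^ 2 * α.den * β.den, ?_, fun x hx => ?_⟩
  · have := α.den_pos
    have := β.den_pos
    positivity
  obtain ⟨n₀, n₁, n₂, n₃, e₀, e₁, e₂, e₃⟩ := H x hx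
  refine ⟨α.den * β.den * n₀ ^ 2 - α.num * β.den * n₁ ^ 2 - α.den * β.num * n₂ ^ 2
    + α.num * β.num * n₃ ^ 2, ?_⟩
  push_cast
  rw [← e₀, ← e₁, ← e₂, ← e₃, ← Rat.den_mul_eq_num α, ← Rat.den_mul_eq_num β, nrd_eq]
  ring

/-- A rational number whose powers have bounded denominators is an integer. -/
theorem exists_int_of_pow_denominator {q : ℚ} {d : ℤ} (hd : d ≠ 0)
    (h : ∀ k : ℕ, ∃ n : ℤ, d * q ^ k = n) : ∃ n : ℤ, q = n := by
  -- Powers of the denominator are coprime to powers of the numerator, so all of them divide `d`;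
  -- the exponent `|d|` is already too large unless the denominator is one.
  have hdvd : ∀ k : ℕ, (q.den : ℤ) ^ k ∣ d := by
    intro k
    obtain ⟨n, hn⟩ := h k
    have h1 : d * q.num ^ k = n * (q.den : ℤ) ^ k := by
      have : (d : ℚ) * (q.num : ℚ) ^ k = n * (q.den : ℚ) ^ k := by
        rw [← Rat.den_mul_eq_num q, mul_pow, ← hn]; ring
      exact_mod_cast this
    have hc : IsCoprime ((q.den : ℤ) ^ k) (q.num ^ k) := by
      refine IsCoprime.pow ?_
      rw [Int.isCoprime_iff_gcd_eq_one, Int.gcd, Int.natAbs_natCast, Nat.gcd_comm]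
      exact q.reduced
    exact hc.dvd_of_dvd_mul_right (Dvd.intro_left _ h1.symm)
  have h1 : q.den = 1 := by
    by_contra hne
    have h2 : 1 < q.den := lt_of_le_of_ne q.den_pos (Ne.symm hne)
    have h3 := Int.le_of_dvd (abs_pos.2 hd) ((dvd_abs _ _).2 (hdvd d.natAbs))
    have h4 : d.natAbs < q.den ^ d.natAbs := Nat.lt_pow_self h2
    have h5 : (|d| : ℤ) = d.natAbs := Int.abs_eq_natAbs d
    rw [h5] at h3
    have h6 : ((q.den ^ d.natAbs : ℕ) : ℤ) ≤ d.natAbs := by exact_mod_cast h3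
    exact absurd (Int.ofNat_le.1 h6) (not_le.2 h4)
  exact ⟨q.num, (Rat.den_eq_one_iff q |>.1 h1).symm⟩

section Order

variable {O : Subring ℍ[ℚ,α,β]}

variable [IsOrder O]

/-- All powers of `x` stay in the order, whose norms have a common denominator; so the powers of
`nrd x` have bounded denominators. -/
theorem nrd_int {x : ℍ[ℚ,α,β]} (hx : x ∈ O) : ∃ n : ℤ, nrd x = n := by
  obtain ⟨d, hd, H⟩ := exists_nrd_denominator (IsOrder.isLattice (O := O)).fg
  refine exists_int_of_pow_denominator hd.ne' fun k => ?_
  have hk : ∀ k : ℕ, nrd (x ^ k) = nrd x ^ k := by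
    intro k
    induction k with
    | zero => simp [nrd_one]
    | succ k ih => rw [pow_succ, pow_succ, nrd_mul, ih]
  rw [← hk]
  exact H _ (O.pow_mem hx k)

theorem trd_int {x : ℍ[ℚ,α,β]} (hx : x ∈ O) : ∃ n : ℤ, trd x = n := by
  obtain ⟨m, hm⟩ := nrd_int hx
  obtain ⟨n, hn⟩ := nrd_int (O.add_mem O.one_mem hx)
  exact ⟨n - 1 - m, by rw [trd_eq_nrd, hm, hn]; push_cast; rfl⟩

theorem star_mem_order {x : ℍ[ℚ,α,β]} (hx : x ∈ O) : star x ∈ O := by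
  obtain ⟨n, hn⟩ := trd_int hx
  rw [star_eq_trd_sub, hn, map_intCast]
  exact O.sub_mem (intCast_mem O n) hx

end Order

/-! ### The norm of a lattice -/

/-- The norms have a common denominator `d`, so they span a subgroup of the cyclic group `(1/d)ℤ`.
Thus the gcd exists and `ratGCD` does not fall back to its default value. -/
theorem isGCD_latticeNorm (L : Submodule ℤ ℍ[ℚ,α,β]) (hL : L.FG) :
    IsGCD {r | ∃ x ∈ L, r = nrd x} (latticeNorm L) := by
  obtain ⟨d, hd, H⟩ := exists_nrd_denominator hL
  have hd' : (d : ℚ) ≠ 0 := by exact_mod_cast hd.ne'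
  set S : Set ℚ := {r | ∃ x ∈ L, r = nrd x} with hS
  let f : ℤ →ₗ[ℤ] ℚ := LinearMap.toSpanSingleton ℤ ℚ ((d : ℚ)⁻¹)
  have hle : Submodule.span ℤ S ≤ LinearMap.range f := by
    refine Submodule.span_le.2 ?_
    rintro _ ⟨x, hx, rfl⟩
    obtain ⟨n, hn⟩ := H x hx
    refine ⟨n, ?_⟩
    simp only [f, LinearMap.toSpanSingleton_apply, zsmul_eq_mul]
    rw [← hn]; field_simp
  obtain ⟨g, hg⟩ := (IsPrincipalIdealRing.principal ((Submodule.span ℤ S).comap f)).principal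
  have h1 : Submodule.span ℤ S = Submodule.span ℤ {f g} := by
    rw [← Submodule.map_comap_eq_of_le hle, hg, Submodule.map_span, Set.image_singleton]
  have hex : ∃ g, IsGCD S g := by
    refine ⟨|f g|, abs_nonneg _, ?_⟩
    rw [h1]
    rcases abs_choice (f g) with h | h <;> rw [h]
    rw [← Set.neg_singleton, Submodule.span_neg]
  obtain ⟨r, hr⟩ := hex
  have : latticeNorm L = r := ratGCD_eq hr
  rwa [this]

theorem exists_nrd_eq_mul_latticeNorm {L : Submodule ℤ ℍ[ℚ,α,β]} (hL : L.FG) {x : ℍ[ℚ,α,β]}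
    (hx : x ∈ L) : ∃ n : ℤ, nrd x = n * latticeNorm L := by
  have h : nrd x ∈ Submodule.span ℤ {latticeNorm L} := by
    rw [← (isGCD_latticeNorm L hL).2]
    exact Submodule.subset_span ⟨x, hx, rfl⟩
  obtain ⟨n, hn⟩ := Submodule.mem_span_singleton.1 h
  exact ⟨n, by rw [← hn, zsmul_eq_mul]⟩

theorem exists_ne_zero_mem (L : Submodule ℤ ℍ[ℚ,α,β]) [h : L.IsLattice ℚ] : ∃ x ∈ L, x ≠ 0 := by
  by_contra! hne
  have hbot : L = ⊥ := (Submodule.eq_bot_iff _).2 hne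
  have h1 := h.span_eq_top
  rw [hbot, Submodule.bot_coe, Submodule.span_zero_singleton] at h1
  exact bot_ne_top h1

theorem latticeNorm_pos (hα : α < 0) (hβ : β < 0) (L : Submodule ℤ ℍ[ℚ,α,β]) [h : L.IsLattice ℚ] :
    0 < latticeNorm L := by
  refine lt_of_le_of_ne (isGCD_latticeNorm L h.fg).1 fun h0 => ?_
  obtain ⟨x, hx, hx0⟩ := exists_ne_zero_mem L
  obtain ⟨n, hn⟩ := exists_nrd_eq_mul_latticeNorm h.fg hx
  rw [← h0, mul_zero, nrd_eq_zero hα hβ] at hn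
  exact hx0 hn

theorem latticeNorm_order (O : Subring ℍ[ℚ,α,β]) [h : IsOrder O] : latticeNorm (toLat O) = 1 := by
  refine ratGCD_eq ⟨zero_le_one, le_antisymm (Submodule.span_le.2 ?_) (Submodule.span_mono ?_)⟩
  · rintro _ ⟨x, hx, rfl⟩
    obtain ⟨n, hn⟩ := nrd_int (O := O) hx
    exact Submodule.mem_span_singleton.2 ⟨n, by rw [hn]; simp⟩
  · rintro _ rfl
    exact ⟨1, O.one_mem, nrd_one.symm⟩

/-- Finitely many elements of a lattice have bounded norm. -/
theorem finite_nrd_le (hα : α < 0) (hβ : β < 0) {L : Submodule ℤ ℍ[ℚ,α,β]} (hL : L.FG) (C : ℚ) :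
    {x | x ∈ L ∧ nrd x ≤ C}.Finite := by
  obtain ⟨d, hd, H⟩ := exists_coord_denominator hL
  have hd' : (d : ℚ) ≠ 0 := by exact_mod_cast hd.ne'
  -- The norm is a positive diagonal form in the standard coordinates, so each term alone is
  -- bounded. For an integer, `n ^ 2 < B` already gives `|n| ≤ B`; no square root is needed.
  have hbd : ∀ c : ℚ, 0 < c → ∃ B : ℤ, ∀ n : ℤ, c * (n : ℚ) ^ 2 ≤ d ^ 2 * C → n ∈ Set.Icc (-B) B := by
    intro c hc
    obtain ⟨B, hB⟩ := exists_nat_gt (d ^ 2 * C / c)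
    refine ⟨B, fun n hn => ?_⟩
    have h1 : (n : ℚ) ^ 2 < B := by
      rw [div_lt_iff₀ hc] at hB
      nlinarith
    have h2 : n ^ 2 < (B : ℤ) := by exact_mod_cast h1
    have h3 : |n| ≤ B := by
      rcases eq_or_ne n 0 with rfl | h0
      · simp
      · have := Int.one_le_abs h0
        nlinarith [sq_abs n]
    exact abs_le.1 h3
  obtain ⟨B₀, hB₀⟩ := hbd 1 one_pos
  obtain ⟨B₁, hB₁⟩ := hbd (-α) (by linarith)
  obtain ⟨B₂, hB₂⟩ := hbd (-β) (by linarith)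
  obtain ⟨B₃, hB₃⟩ := hbd (α * β) (mul_pos_of_neg_of_neg hα hβ)
  refine Set.Finite.subset ((((Set.finite_Icc (-B₀) B₀).prod (Set.finite_Icc (-B₁) B₁)).prod
    ((Set.finite_Icc (-B₂) B₂).prod (Set.finite_Icc (-B₃) B₃))).image
    fun n => (⟨n.1.1 / d, n.1.2 / d, n.2.1 / d, n.2.2 / d⟩ : ℍ[ℚ,α,β])) ?_
  rintro x ⟨hx, hC⟩
  obtain ⟨n₀, n₁, n₂, n₃, e₀, e₁, e₂, e₃⟩ := H x hx
  have hN : 1 * (n₀ : ℚ) ^ 2 + -α * (n₁ : ℚ) ^ 2 + -β * (n₂ : ℚ) ^ 2 + α * β * (n₃ : ℚ) ^ 2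
      ≤ d ^ 2 * C := by
    rw [← e₀, ← e₁, ← e₂, ← e₃]
    rw [nrd_eq] at hC
    have := mul_le_mul_of_nonneg_left hC (sq_nonneg (d : ℚ))
    nlinarith
  have p₀ : 0 ≤ 1 * (n₀ : ℚ) ^ 2 := by positivity
  have p₁ : 0 ≤ -α * (n₁ : ℚ) ^ 2 := mul_nonneg (by linarith) (sq_nonneg _)
  have p₂ : 0 ≤ -β * (n₂ : ℚ) ^ 2 := mul_nonneg (by linarith) (sq_nonneg _)
  have p₃ : 0 ≤ α * β * (n₃ : ℚ) ^ 2 :=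
    mul_nonneg (mul_pos_of_neg_of_neg hα hβ).le (sq_nonneg _)
  refine ⟨((n₀, n₁), (n₂, n₃)), ⟨⟨hB₀ _ (by linarith), hB₁ _ (by linarith)⟩,
    ⟨hB₂ _ (by linarith), hB₃ _ (by linarith)⟩⟩, ?_⟩
  ext
  · simp only [← e₀]; field_simp
  · simp only [← e₁]; field_simp
  · simp only [← e₂]; field_simp
  · simp only [← e₃]; field_simp

/-! ### The localized order: products, conjugation and norms -/

section LocalOrder

variable {p : ℕ} [hp : Fact p.Prime] {O : Subring ℍ[ℚ,α,β]}

theorem loc_order_mul {x y : ℍ[ℚ,α,β]} (hx : x ∈ loc p (toLat O)) (hy : y ∈ loc p (toLat O)) :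
    x * y ∈ loc p (toLat O) := by
  obtain ⟨s, hs, hx⟩ := hx
  obtain ⟨t, ht, hy⟩ := hy
  refine ⟨s * t, prime_not_dvd_mul p hs ht, ?_⟩
  have := O.mul_mem hx hy
  rwa [smul_mul_smul_comm] at this

theorem one_mem_loc_order : (1 : ℍ[ℚ,α,β]) ∈ loc p (toLat O) := le_loc _ O.one_mem

theorem padicNorm_int_eq_one {s : ℤ} (hs : ¬ (p : ℤ) ∣ s) : padicNorm p s = 1 :=
  (padicNorm.int_eq_one_iff s).2 hs

variable [IsOrder O]

theorem loc_order_star {x : ℍ[ℚ,α,β]} (hx : x ∈ loc p (toLat O)) : star x ∈ loc p (toLat O) := by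
  obtain ⟨s, hs, hx⟩ := hx
  refine ⟨s, hs, ?_⟩
  have := star_mem_order (O := O) hx
  rwa [star_zsmul] at this

theorem padicNorm_nrd_le_one {x : ℍ[ℚ,α,β]} (hx : x ∈ loc p (toLat O)) :
    padicNorm p (nrd x) ≤ 1 := by
  obtain ⟨s, hs, hx⟩ := hx
  obtain ⟨n, hn⟩ := nrd_int (O := O) hx
  rw [nrd_zsmul] at hn
  have h1 : padicNorm p ((s : ℚ) ^ 2 * nrd x) = padicNorm p (nrd x) := by
    rw [padicNorm.mul, sq, padicNorm.mul, padicNorm_int_eq_one hs, one_mul, one_mul]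
  rw [← h1, hn]
  exact padicNorm.of_int n

end LocalOrder

/-! ### Local generators -/

section Gen

variable (p : ℕ) [hp : Fact p.Prime] (O : Subring ℍ[ℚ,α,β])

/-- `x` generates `L` at `p`: `L_(p) = O_(p) x`. -/
def IsGen (L : Submodule ℤ ℍ[ℚ,α,β]) (x : (ℍ[ℚ,α,β])ˣ) : Prop :=
  loc p L = mulRight (loc p (toLat O)) x

variable {p O} {L M : Submodule ℤ ℍ[ℚ,α,β]} {x y : (ℍ[ℚ,α,β])ˣ}

theorem IsGen.mem_iff (h : IsGen p O L x) {z : ℍ[ℚ,α,β]} :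
    z ∈ loc p L ↔ z * ((x⁻¹ : (ℍ[ℚ,α,β])ˣ) : ℍ[ℚ,α,β]) ∈ loc p (toLat O) := by
  rw [h, mem_mulRight_unit]

theorem IsGen.self_mem (h : IsGen p O L x) : (x : ℍ[ℚ,α,β]) ∈ loc p L := by
  rw [h.mem_iff, Units.mul_inv]
  exact one_mem_loc_order

theorem IsGen.mul_right (h : IsGen p O L x) (y : (ℍ[ℚ,α,β])ˣ) :
    IsGen p O (mulRight L y) (x * y) := by
  rw [IsGen, loc_mulRight, h, mulRight_mulRight, Units.val_mul]

theorem IsGen.congr (h : IsGen p O L x) (hLM : loc p M = loc p L) : IsGen p O M x :=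
  hLM.trans h

theorem IsGen.mul_mem (h : IsGen p O L x) {o z : ℍ[ℚ,α,β]} (ho : o ∈ loc p (toLat O))
    (hz : z ∈ loc p L) : o * z ∈ loc p L := by
  rw [h.mem_iff] at hz ⊢
  rw [mul_assoc]
  exact loc_order_mul ho hz

variable [IsOrder O]

theorem IsGen.padicNorm_nrd_le (h : IsGen p O L x) {z : ℍ[ℚ,α,β]} (hz : z ∈ loc p L) :
    padicNorm p (nrd z) ≤ padicNorm p (nrd (x : ℍ[ℚ,α,β])) := by
  have h1 := padicNorm_nrd_le_one (h.mem_iff.1 hz)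
  have h2 : z = z * ((x⁻¹ : (ℍ[ℚ,α,β])ˣ) : ℍ[ℚ,α,β]) * x := by
    rw [mul_assoc, Units.inv_mul, mul_one]
  rw [h2, nrd_mul, padicNorm.mul]
  exact mul_le_of_le_one_left (padicNorm.nonneg _) h1

/-- Every element of `L` is a multiple of `x` by an element of integral norm at `p`, which bounds
the gcd; the bound is attained because some multiple of `x` by an integer prime to `p` lies in `L`.
-/
theorem IsGen.padicNorm_latticeNorm (h : IsGen p O L x) (hL : L.FG) :
    padicNorm p (latticeNorm L) = padicNorm p (nrd (x : ℍ[ℚ,α,β])) := by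
  refine le_antisymm ?_ ?_
  · have hmem : latticeNorm L ∈ Submodule.span ℤ {r | ∃ z ∈ L, r = nrd z} := by
      rw [(isGCD_latticeNorm L hL).2]
      exact Submodule.mem_span_singleton_self _
    generalize latticeNorm L = g at hmem ⊢
    induction hmem using Submodule.span_induction with
    | mem r hr =>
      obtain ⟨z, hz, rfl⟩ := hr
      exact h.padicNorm_nrd_le (le_loc L hz)
    | zero => rw [padicNorm.zero]; exact padicNorm.nonneg _
    | add r s _ _ hr hs => exact padicNorm.nonarchimedean.trans (max_le hr hs)
    | smul n r _ hr =>
      rw [zsmul_eq_mul, padicNorm.mul]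
      exact (mul_le_of_le_one_left (padicNorm.nonneg _) (padicNorm.of_int n)).trans hr
  · obtain ⟨s, hs, hx⟩ := h.self_mem
    obtain ⟨n, hn⟩ := exists_nrd_eq_mul_latticeNorm hL hx
    rw [nrd_zsmul] at hn
    have h1 : padicNorm p ((s : ℚ) ^ 2 * nrd (x : ℍ[ℚ,α,β]))
        = padicNorm p (nrd (x : ℍ[ℚ,α,β])) := by
      rw [padicNorm.mul, sq, padicNorm.mul, padicNorm_int_eq_one hs, one_mul, one_mul]
    rw [← h1, hn, padicNorm.mul]
    exact mul_le_of_le_one_left (padicNorm.nonneg _) (padicNorm.of_int n)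

end Gen

/-! ### Left ideals in terms of local generators -/

section LeftIdeals

variable {O : Subring ℍ[ℚ,α,β]}

/-- Allows ideals to be constructed from rational local generators, without further reference to
completions. -/
theorem isLeftIdeal_of_isGen {L : Submodule ℤ ℍ[ℚ,α,β]} (hL : L.IsLattice ℚ)
    (h : ∀ (p : ℕ) [Fact p.Prime], ∃ x, IsGen p O L x) : IsLeftIdeal O L := by
  refine ⟨hL, fun p _ => ?_⟩
  obtain ⟨x, hx⟩ := h p
  refine ⟨toLocalUnit p x, ?_⟩
  rw [← localize_loc, hx, localize_mulRight, localize_loc]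
  rfl

/-! ### The completed order: density and integrality -/

section Completion

variable {p : ℕ} [hp : Fact p.Prime]

theorem localize_mul {x y : ℍ[ℚ_[p],(α : ℚ_[p]),(β : ℚ_[p])]} (hx : x ∈ localize p (toLat O))
    (hy : y ∈ localize p (toLat O)) : x * y ∈ localize p (toLat O) := by
  have := Submodule.mul_mem_mul hx hy
  rw [localize, Submodule.span_mul_span] at this
  refine Submodule.span_mono ?_ this
  rintro _ ⟨_, ⟨a, ha, rfl⟩, _, ⟨b, hb, rfl⟩, rfl⟩
  exact ⟨a * b, O.mul_mem ha hb, toLocal_mul p a b⟩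

theorem one_mem_localize : (1 : ℍ[ℚ_[p],(α : ℚ_[p]),(β : ℚ_[p])]) ∈ localize p (toLat O) :=
  Submodule.subset_span ⟨1, O.one_mem, toLocal_one p⟩

/-- A lattice is dense in its completion. -/
theorem exists_sub_mem_localize (L : Submodule ℤ ℍ[ℚ,α,β])
    {y : ℍ[ℚ_[p],(α : ℚ_[p]),(β : ℚ_[p])]} (hy : y ∈ localize p L) :
    ∃ x ∈ L, ∃ z ∈ localize p L, y = toLocal p x + (p : ℤ_[p]) • z := by
  induction hy using Submodule.span_induction with
  | mem y hy =>
    obtain ⟨x, hx, rfl⟩ := hy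
    exact ⟨x, hx, 0, Submodule.zero_mem _, by simp⟩
  | zero => exact ⟨0, L.zero_mem, 0, Submodule.zero_mem _, by ext <;> simp [toLocal]⟩
  | add y y' _ _ h h' =>
    obtain ⟨x, hx, z, hz, rfl⟩ := h
    obtain ⟨x', hx', z', hz', rfl⟩ := h'
    exact ⟨x + x', L.add_mem hx hx', z + z', Submodule.add_mem _ hz hz', by
      rw [toLocal_add, smul_add]; abel⟩
  | smul c y _ h =>
    obtain ⟨x, hx, z, hz, rfl⟩ := h
    obtain ⟨w, hw⟩ : ∃ w, c = (c.zmodRepr : ℤ_[p]) + p * w := by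
      have := c.sub_zmodRepr_mem
      rw [PadicInt.maximalIdeal_eq_span_p, Ideal.mem_span_singleton] at this
      obtain ⟨w, hw⟩ := this
      exact ⟨w, by rw [← hw]; ring⟩
    refine ⟨(c.zmodRepr : ℤ) • x, L.smul_mem _ hx, w • toLocal p x + c • z,
      Submodule.add_mem _ (Submodule.smul_mem _ _ (Submodule.subset_span ⟨x, hx, rfl⟩))
        (Submodule.smul_mem _ _ hz), ?_⟩
    have h1 : c • toLocal p x
        = (c.zmodRepr : ℤ_[p]) • toLocal p x + (p : ℤ_[p]) • w • toLocal p x := by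
      rw [smul_smul, ← add_smul, ← hw]
    rw [toLocal_zsmul, smul_add, smul_add, smul_comm c, h1]
    push_cast
    abel

section Integral

variable [IsOrder O]

theorem star_mem_localize {y : ℍ[ℚ_[p],(α : ℚ_[p]),(β : ℚ_[p])]} (hy : y ∈ localize p (toLat O)) :
    star y ∈ localize p (toLat O) := by
  induction hy using Submodule.span_induction with
  | mem y hy =>
    obtain ⟨x, hx, rfl⟩ := hy
    refine Submodule.subset_span ⟨star x, star_mem_order (O := O) hx, ?_⟩
    ext <;> simp [toLocal]
  | zero => rw [star_zero]; exact Submodule.zero_mem _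
  | add y y' _ _ h h' => rw [star_add]; exact Submodule.add_mem _ h h'
  | smul c y _ h =>
    have : star (c • y) = c • star y := by
      ext <;> simp only [QuaternionAlgebra.re_smul, QuaternionAlgebra.imI_smul,
        QuaternionAlgebra.imJ_smul, QuaternionAlgebra.imK_smul, QuaternionAlgebra.re_star,
        QuaternionAlgebra.imI_star, QuaternionAlgebra.imJ_star, QuaternionAlgebra.imK_star] <;>
        simp [smul_neg]
    rw [this]
    exact Submodule.smul_mem _ _ h

theorem trd_padicInt_smul (c : ℤ_[p]) (y : ℍ[ℚ_[p],(α : ℚ_[p]),(β : ℚ_[p])]) :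
    trd (c • y) = (c : ℚ_[p]) * trd y := by
  rw [trd_eq, trd_eq, QuaternionAlgebra.re_smul, Algebra.smul_def, mul_left_comm]; rfl

theorem nrd_padicInt_smul (c : ℤ_[p]) (y : ℍ[ℚ_[p],(α : ℚ_[p]),(β : ℚ_[p])]) :
    nrd (c • y) = (c : ℚ_[p]) ^ 2 * nrd y := by
  rw [nrd_eq, nrd_eq, QuaternionAlgebra.re_smul, QuaternionAlgebra.imI_smul,
    QuaternionAlgebra.imJ_smul, QuaternionAlgebra.imK_smul]
  simp only [Algebra.smul_def]
  change ((c : ℚ_[p]) * _) ^ 2 - _ * ((c : ℚ_[p]) * _) ^ 2 - _ * ((c : ℚ_[p]) * _) ^ 2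
    + _ * ((c : ℚ_[p]) * _) ^ 2 = _
  ring

theorem norm_trd_le_one {y : ℍ[ℚ_[p],(α : ℚ_[p]),(β : ℚ_[p])]} (hy : y ∈ localize p (toLat O)) :
    ‖trd y‖ ≤ 1 := by
  induction hy using Submodule.span_induction with
  | mem y hy =>
    obtain ⟨x, hx, rfl⟩ := hy
    obtain ⟨n, hn⟩ := trd_int (O := O) hx
    have : trd (toLocal p x) = (trd x : ℚ) := by simp [trd_eq, toLocal]
    rw [this, hn]
    exact_mod_cast Padic.norm_int_le_one n
  | zero => simp [trd_eq]
  | add y y' _ _ h h' => rw [trd_add]; exact (Padic.nonarchimedean _ _).trans (max_le h h')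
  | smul c y _ h =>
    rw [trd_padicInt_smul, norm_mul]
    exact mul_le_one₀ c.2 (norm_nonneg _) h

/-- The norm is not additive; the polar term is the trace of `y * star y'`, which lies in the
completed order again. -/
theorem norm_nrd_le_one {y : ℍ[ℚ_[p],(α : ℚ_[p]),(β : ℚ_[p])]} (hy : y ∈ localize p (toLat O)) :
    ‖nrd y‖ ≤ 1 := by
  induction hy using Submodule.span_induction with
  | mem y hy =>
    obtain ⟨x, hx, rfl⟩ := hy
    obtain ⟨n, hn⟩ := nrd_int (O := O) hx
    rw [nrd_toLocal, hn]
    exact_mod_cast Padic.norm_int_le_one n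
  | zero => simp [nrd_zero]
  | add y y' hy hy' h h' =>
    rw [nrd_add]
    refine (Padic.nonarchimedean _ _).trans (max_le
      ((Padic.nonarchimedean _ _).trans (max_le h h')) ?_)
    exact norm_trd_le_one (localize_mul hy (star_mem_localize hy'))
  | smul c y _ h =>
    rw [nrd_padicInt_smul, norm_mul, norm_pow]
    exact mul_le_one₀ (pow_le_one₀ (norm_nonneg _) c.2) (norm_nonneg _) h

end Integral

end Completion

variable [IsOrder O]

/-- A left ideal is generated at every prime by an element of the rational algebra. -/
theorem IsLeftIdeal.exists_isGen (hα : α < 0) (hβ : β < 0) {L : Submodule ℤ ℍ[ℚ,α,β]}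
    (h : IsLeftIdeal O L) (p : ℕ) [hp : Fact p.Prime] : ∃ x, IsGen p O L x := by
  have := h.isLattice
  obtain ⟨X, hX⟩ := h.locallyPrincipal p
  have hmem : ∀ y, y ∈ localize p L ↔ ∃ o ∈ localize p (toLat O), o * (X : ℍ[ℚ_[p],(α : ℚ_[p]),(β : ℚ_[p])]) = y := by
    intro y
    rw [← SetLike.mem_coe, hX]; rfl
  -- The generator `X` lies in `L_p`. Approximating it by `x ∈ L` modulo `p L_p = p O_p X` gives `x
  -- = (1 - p o) X` with `o ∈ O_p`, and it remains to see that `v = 1 - p o` is a unit of `O_p`.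
  obtain ⟨x, hx, z, hz, hxz⟩ := exists_sub_mem_localize L
    ((hmem X).2 ⟨1, one_mem_localize, one_mul _⟩)
  obtain ⟨o, ho, rfl⟩ := (hmem z).1 hz
  set v : ℍ[ℚ_[p],(α : ℚ_[p]),(β : ℚ_[p])] := 1 + (-(p : ℤ_[p])) • o with hv
  have hvX : toLocal p x = v * X := by
    rw [hv, add_mul, one_mul, neg_smul, neg_mul, smul_mul_assoc, ← sub_eq_add_neg, eq_sub_iff_add_eq,
      ← hxz]
  have hvO : v ∈ localize p (toLat O) := Submodule.add_mem _ one_mem_localize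
    (Submodule.smul_mem _ _ ho)
  have hp1 : ‖(p : ℚ_[p])‖ < 1 := Padic.norm_p_lt_one
  -- The norm of `v` is congruent to `1` modulo `p`, since the trace and norm of `o` are integral.
  have hnv : ‖nrd v‖ = 1 := by
    have h1 : nrd v = 1 + ((p : ℚ_[p]) ^ 2 * nrd o - p * trd (star o)) := by
      have e : trd ((-(p : ℤ_[p])) • o) = -(p : ℚ_[p]) * trd o := by
        rw [trd_padicInt_smul]; push_cast; rfl
      rw [hv, nrd_add, nrd_one, one_mul, nrd_padicInt_smul, trd_star, trd_star, e]
      push_cast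
      ring
    have h2 : ‖(p : ℚ_[p]) ^ 2 * nrd o - p * trd (star o)‖ < 1 := by
      have e : (p : ℚ_[p]) ^ 2 * nrd o - p * trd (star o) = p * (p * nrd o - trd (star o)) := by ring
      rw [e, norm_mul]
      refine mul_lt_one_of_nonneg_of_lt_one_left (norm_nonneg _) hp1 ?_
      rw [sub_eq_add_neg]
      refine (Padic.nonarchimedean _ _).trans (max_le ?_ ?_)
      · rw [norm_mul]
        exact mul_le_one₀ hp1.le (norm_nonneg _) (norm_nrd_le_one ho)
      · rw [norm_neg]; exact norm_trd_le_one (star_mem_localize ho)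
    rw [h1, Padic.add_eq_max_of_ne]
    · rw [norm_one, max_eq_left h2.le]
    · rw [norm_one]; exact h2.ne'
  have hnv0 : nrd v ≠ 0 := by
    intro h0; rw [h0, norm_zero] at hnv; exact zero_ne_one hnv
  have hXnrd : nrd (X : ℍ[ℚ_[p],(α : ℚ_[p]),(β : ℚ_[p])]) ≠ 0 := by
    intro h0
    have := nrd_mul (X : ℍ[ℚ_[p],(α : ℚ_[p]),(β : ℚ_[p])]) (X⁻¹ : (ℍ[ℚ_[p],(α : ℚ_[p]),(β : ℚ_[p])])ˣ)
    rw [Units.mul_inv, nrd_one, h0, zero_mul] at this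
    exact one_ne_zero this
  have hx0 : x ≠ 0 := by
    rintro rfl
    have := congrArg nrd hvX
    rw [nrd_mul, nrd_toLocal, nrd_zero, Rat.cast_zero] at this
    exact mul_ne_zero hnv0 hXnrd this.symm
  obtain ⟨u, rfl⟩ := exists_unit hα hβ hx0
  -- The inverse is the conjugate divided by the norm, here a `p`-adic unit.
  obtain ⟨v', hv'O, hv'⟩ : ∃ v' ∈ localize p (toLat O), v' * v = 1 := by
    have hinv : ‖(nrd v)⁻¹‖ ≤ 1 := by rw [norm_inv, hnv, inv_one]
    obtain ⟨c, hc⟩ : ∃ c : ℤ_[p], (c : ℚ_[p]) = (nrd v)⁻¹ := ⟨⟨_, hinv⟩, rfl⟩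
    refine ⟨c • star v, Submodule.smul_mem _ _ (star_mem_localize hvO), ?_⟩
    rw [smul_mul_assoc, star_mul_eq, Algebra.smul_def]
    change algebraMap ℚ_[p] _ (c : ℚ_[p]) * _ = _
    rw [hc, ← map_mul, inv_mul_cancel₀ hnv0, map_one]
  refine ⟨u, ?_⟩
  ext z
  rw [mem_mulRight_unit, ← toLocal_mem_localize_iff L, ← toLocal_mem_localize_iff (toLat O), hmem,
    toLocal_mul]
  have huu : toLocal p (u : ℍ[ℚ,α,β]) * toLocal p ((u⁻¹ : (ℍ[ℚ,α,β])ˣ) : ℍ[ℚ,α,β]) = 1 := by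
    rw [← toLocal_mul, Units.mul_inv, toLocal_one]
  have huu' : toLocal p ((u⁻¹ : (ℍ[ℚ,α,β])ˣ) : ℍ[ℚ,α,β]) * toLocal p (u : ℍ[ℚ,α,β]) = 1 := by
    rw [← toLocal_mul, Units.inv_mul, toLocal_one]
  constructor
  · rintro ⟨o', ho', h⟩
    have e : toLocal p z * toLocal p ((u⁻¹ : (ℍ[ℚ,α,β])ˣ) : ℍ[ℚ,α,β]) = o' * v' := by
      have e1 : (X : ℍ[ℚ_[p],(α : ℚ_[p]),(β : ℚ_[p])]) = v' * toLocal p u := by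
        rw [hvX, ← mul_assoc, hv', one_mul]
      rw [← h, e1, mul_assoc, mul_assoc, huu, mul_one]
    rw [e]
    exact localize_mul ho' hv'O
  · intro h
    refine ⟨_, localize_mul h hvO, ?_⟩
    rw [mul_assoc, ← hvX, mul_assoc, huu', mul_one]

end LeftIdeals

/-! ### Recovering rational numbers and lattices from local data -/

theorem padicNorm_eq_one_forall {q : ℚ} (hq : 0 < q)
    (h : ∀ (p : ℕ) [Fact p.Prime], padicNorm p q = 1) : q = 1 := by
  have hmul := Rat.den_mul_eq_num q
  have hnum : 0 < q.num := Rat.num_pos.2 hq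
  have key : ∀ p : ℕ, p.Prime → (p ∣ q.den ↔ (p : ℤ) ∣ q.num) := by
    intro p hp
    have : Fact p.Prime := ⟨hp⟩
    have h1 : padicNorm p (q.den : ℤ) = padicNorm p q.num := by
      rw [← hmul, padicNorm.mul, h p, mul_one]; rfl
    rw [← Int.natCast_dvd_natCast, ← padicNorm.int_lt_one_iff, ← padicNorm.int_lt_one_iff, h1]
  have hno : ∀ p : ℕ, p.Prime → ¬ p ∣ q.den := fun p hp hd => by
    have h2 := Nat.dvd_gcd (Int.natCast_dvd.1 ((key p hp).1 hd)) hd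
    rw [Nat.Coprime.gcd_eq_one q.reduced] at h2
    exact hp.one_lt.ne' (Nat.dvd_one.1 h2)
  have hden : q.den = 1 := by
    by_contra hne
    obtain ⟨p, hp, hd⟩ := Nat.exists_prime_and_dvd hne
    exact hno p hp hd
  have hn1 : q.num.natAbs = 1 := by
    by_contra hne
    obtain ⟨p, hp, hd⟩ := Nat.exists_prime_and_dvd hne
    exact hno p hp ((key p hp).2 (Int.natCast_dvd.2 hd))
  have h1 : q.num = 1 := by omega
  rwa [hden, h1, Nat.cast_one, one_mul, Int.cast_one] at hmul

/-- Positive rational numbers with the same `p`-adic norms are equal. -/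
theorem eq_of_padicNorm_eq {q r : ℚ} (hq : 0 < q) (hr : 0 < r)
    (h : ∀ (p : ℕ) [Fact p.Prime], padicNorm p q = padicNorm p r) : q = r := by
  have := padicNorm_eq_one_forall (div_pos hq hr) fun p _ => by
    rw [padicNorm.div, h p, div_self (padicNorm.nonzero hr.ne')]
  rwa [div_eq_one_iff_eq hr.ne'] at this

section

variable {p : ℕ} [hp : Fact p.Prime]

theorem rat_smul_mem_loc {L : Submodule ℤ ℍ[ℚ,α,β]} {c : ℚ} (hc : padicNorm p c ≤ 1)
    {y : ℍ[ℚ,α,β]} (hy : y ∈ loc p L) : c • y ∈ loc p L := by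
  refine mem_loc_of_smul (not_dvd_den_of_padicNorm_le_one hc) ?_
  have : (c.den : ℤ) • c • y = c.num • y := by
    rw [← Int.cast_smul_eq_zsmul ℚ, ← Int.cast_smul_eq_zsmul ℚ, smul_smul]
    congr 1
    exact_mod_cast Rat.den_mul_eq_num c
  rw [this]
  exact Submodule.smul_mem _ _ hy

end

theorem mem_of_mem_loc {L : Submodule ℤ ℍ[ℚ,α,β]} {y : ℍ[ℚ,α,β]}
    (h : ∀ (p : ℕ) [Fact p.Prime], y ∈ loc p L) : y ∈ L := by
  have : Submodule.span ℤ {y} ≤ L := le_of_loc_le fun p _ => by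
    rw [Submodule.span_singleton_le_iff_mem]; exact h p
  rwa [Submodule.span_singleton_le_iff_mem] at this

/-- A lattice of finite rank has finitely many sublattices containing a fixed multiple of it. -/
theorem finite_sublattices (L : Submodule ℤ ℍ[ℚ,α,β]) (hL : L.FG) {m : ℤ} (hm : m ≠ 0) :
    {M : Submodule ℤ ℍ[ℚ,α,β] | M ≤ L ∧ ∀ z ∈ L, m • z ∈ M}.Finite := by
  have : Module.Finite ℤ L := Module.Finite.iff_fg.2 hL
  let K : Submodule ℤ L := LinearMap.range (LinearMap.lsmul ℤ L m)
  have hfin : Finite (L ⧸ K) := by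
    refine Module.finite_of_fg_torsion _ fun {q} => ?_
    obtain ⟨z, rfl⟩ := K.mkQ_surjective q
    refine ⟨⟨m, mem_nonZeroDivisors_of_ne_zero hm⟩, ?_⟩
    change m • K.mkQ z = 0
    rw [← map_smul, Submodule.mkQ_apply, Submodule.Quotient.mk_eq_zero]
    exact ⟨z, rfl⟩
  -- A sublattice containing `m L` is recovered from its image in the quotient `L / m L`, which is
  -- finite, being finitely generated and torsion.
  let F : Submodule ℤ ℍ[ℚ,α,β] → Set (L ⧸ K) := fun M => {q | ∃ z : L, z.1 ∈ M ∧ K.mkQ z = q}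
  refine Set.Finite.of_finite_image (f := F) (Set.toFinite _) ?_
  have aux : ∀ M N : Submodule ℤ ℍ[ℚ,α,β], M ≤ L → (∀ z ∈ L, m • z ∈ N) → F M = F N → M ≤ N := by
    intro M N hM hN h y hy
    have h1 : K.mkQ ⟨y, hM hy⟩ ∈ F M := ⟨⟨y, hM hy⟩, hy, rfl⟩
    rw [h] at h1
    obtain ⟨z, hz, hzq⟩ := h1
    rw [Submodule.mkQ_apply, Submodule.mkQ_apply, Submodule.Quotient.eq] at hzq
    obtain ⟨w, hw⟩ := hzq
    have h2 : m • (w : ℍ[ℚ,α,β]) = z - y := congrArg Subtype.val hw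
    have h3 : y = z - m • (w : ℍ[ℚ,α,β]) := by rw [h2]; abel
    rw [h3]
    exact N.sub_mem hz (hN _ w.2)
  rintro M ⟨hM, hM'⟩ N ⟨hN, hN'⟩ h
  exact le_antisymm (aux M N hM hN' h) (aux N M hN hM' h.symm)

/-! ### Finiteness of transporters and of the sets `T_m(a)` -/

section Hecke

variable {O : Subring ℍ[ℚ,α,β]}

theorem LeftIdeal.fg (a : LeftIdeal O) : a.1.FG := a.2.isLattice.fg

theorem LeftIdeal.norm_pos (hα : α < 0) (hβ : β < 0) (a : LeftIdeal O) : 0 < latticeNorm a.1 :=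
  have := a.2.isLattice
  latticeNorm_pos hα hβ a.1

theorem LeftIdeal.norm_mul (a : LeftIdeal O) (x : (ℍ[ℚ,α,β])ˣ) :
    latticeNorm (a.mul x).1 = |nrd (x : ℍ[ℚ,α,β])| * latticeNorm a.1 :=
  latticeNorm_mulRight a.1 x

theorem LeftIdeal.mul_mul (a : LeftIdeal O) (x y : (ℍ[ℚ,α,β])ˣ) :
    (a.mul x).mul y = a.mul (x * y) :=
  Subtype.ext (mulRight_mulRight a.1 x y)

theorem LeftIdeal.mul_one (a : LeftIdeal O) : a.mul 1 = a :=
  Subtype.ext (mulRight_one a.1)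

/-- For a fixed nonzero `u ∈ a`, the unit `x` is determined by `u x`, an element of `b` of norm
bounded in terms of `u`, `a` and `b`. -/
theorem transporter_finite (hα : α < 0) (hβ : β < 0) (a b : LeftIdeal O) :
    (transporter a b).Finite := by
  have := a.2.isLattice
  obtain ⟨z, hz, hz0⟩ := exists_ne_zero_mem a.1
  obtain ⟨u, rfl⟩ := exists_unit hα hβ hz0
  refine Set.Finite.of_finite_image (f := fun x : (ℍ[ℚ,α,β])ˣ => (u * x : ℍ[ℚ,α,β]))
    ((finite_nrd_le hα hβ b.fg
      (nrd (u : ℍ[ℚ,α,β]) * (latticeNorm b.1 / latticeNorm a.1))).subset ?_) ?_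
  · rintro _ ⟨x, hx, rfl⟩
    have hx' : mulRight a.1 x = b.1 := hx
    refine ⟨hx' ▸ mem_mulRight.2 ⟨u, hz, rfl⟩, ?_⟩
    rw [nrd_mul]
    refine mul_le_mul_of_nonneg_left ?_ (nrd_nonneg hα hβ _)
    rw [← hx', latticeNorm_mulRight, mul_div_assoc, div_self (a.norm_pos hα hβ).ne', mul_one]
    exact le_abs_self _
  · intro x _ y _ h
    exact Units.ext ((Units.mul_right_inj u).1 h)

theorem height_single (c d : IdealClass O) (r s : ℝ) :
    height O (Finsupp.single c r) (Finsupp.single d s) = r * (s * heightClass c d) := by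
  simp [height]

theorem heightClass_cls (a b : LeftIdeal O) :
    heightClass (cls a) (cls b) = (1 / 2 : ℝ) * Nat.card (transporter a b) := rfl

theorem hecke_single (R : Type*) [CommRing R] (m : ℕ) (c : IdealClass O) (r : R) :
    hecke R O m (Finsupp.single c r) = r • heckeClass R m c := by
  simp [hecke]

theorem toReal_add (v w : IdealModule ℤ O) : toReal (v + w) = toReal v + toReal w :=
  Finsupp.mapRange_add (fun _ _ => Int.cast_add _ _) v w

theorem toReal_single (c : IdealClass O) (n : ℤ) :
    toReal (Finsupp.single c n) = Finsupp.single c (n : ℝ) :=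
  Finsupp.mapRange_single

variable [IsOrder O]

/-- Stability under `O` is not part of the definition of a left ideal; it follows from local
principality. -/
theorem LeftIdeal.order_mul_mem (hα : α < 0) (hβ : β < 0) (a : LeftIdeal O) {o z : ℍ[ℚ,α,β]}
    (ho : o ∈ O) (hz : z ∈ a.1) : o * z ∈ a.1 :=
  mem_of_mem_loc fun p _ => by
    obtain ⟨x, hx⟩ := a.2.exists_isGen hα hβ p
    exact hx.mul_mem (le_loc _ ho) (le_loc _ hz)

/-- If `b ⊆ a` has norm `m N(a)`, then `m a ⊆ b`. -/
theorem smul_mem_of_mem_heckeSet (hα : α < 0) (hβ : β < 0) {m : ℕ} (hm : 1 ≤ m) {a b : LeftIdeal O}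
    (h : b ∈ heckeSet m a) {z : ℍ[ℚ,α,β]} (hz : z ∈ a.1) : (m : ℤ) • z ∈ b.1 := by
  refine mem_of_mem_loc fun p _ => ?_
  obtain ⟨x, hx⟩ := a.2.exists_isGen hα hβ p
  obtain ⟨y, hy⟩ := b.2.exists_isGen hα hβ p
  have hm0 : (m : ℚ) ≠ 0 := by exact_mod_cast (by omega : m ≠ 0)
  have ho : (y : ℍ[ℚ,α,β]) * ((x⁻¹ : (ℍ[ℚ,α,β])ˣ) : ℍ[ℚ,α,β]) ∈ loc p (toLat O) :=
    hx.mem_iff.1 (loc_mono h.1 hy.self_mem)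
  have hN : padicNorm p (nrd (y : ℍ[ℚ,α,β])) = padicNorm p (m * nrd (x : ℍ[ℚ,α,β])) := by
    rw [← hy.padicNorm_latticeNorm b.fg, h.2, padicNorm.mul, hx.padicNorm_latticeNorm a.fg,
      padicNorm.mul]
  -- Put `o = y x⁻¹`, an element of `O` at `p`. Then `m z y⁻¹ = (m N(x) / N(y)) · (z x⁻¹) · ō`,
  -- where the rational factor is a `p`-adic unit by the norm condition.
  have hc : padicNorm p (m * nrd (x : ℍ[ℚ,α,β]) / nrd (y : ℍ[ℚ,α,β])) = 1 := by
    rw [padicNorm.div, hN, div_self]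
    exact padicNorm.nonzero (mul_ne_zero hm0 (nrd_unit_ne_zero x))
  have hz' := hx.mem_iff.1 (le_loc (p := p) _ hz)
  rw [hy.mem_iff]
  have key := rat_smul_mem_loc hc.le (loc_order_mul hz' (loc_order_star ho))
  convert key using 1
  rw [unit_inv_eq x, unit_inv_eq y, ← Int.cast_smul_eq_zsmul ℚ]
  simp only [mul_smul_comm, smul_mul_assoc, star_smul, StarMul.star_mul, star_star, smul_smul]
  rw [mul_assoc z, ← mul_assoc (star (x : ℍ[ℚ,α,β])), star_mul_eq, Algebra.algebraMap_eq_smul_one,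
    smul_mul_assoc, one_mul, mul_smul_comm, smul_smul]
  congr 1
  have := nrd_unit_ne_zero x
  have := nrd_unit_ne_zero y
  push_cast
  simp
  field_simp

theorem heckeSet_finite (hα : α < 0) (hβ : β < 0) {m : ℕ} (hm : 1 ≤ m) (a : LeftIdeal O) :
    (heckeSet m a).Finite := by
  refine Set.Finite.of_finite_image (f := Subtype.val)
    ((finite_sublattices a.1 a.fg (m := m) (by exact_mod_cast (by omega : m ≠ 0))).subset ?_)
    Subtype.val_injective.injOn
  rintro _ ⟨b, hb, rfl⟩
  exact ⟨hb.1, fun z hz => smul_mem_of_mem_heckeSet hα hβ hm hb hz⟩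

/-- A left ideal is determined by its norm among the left ideals containing it. -/
theorem eq_of_le_of_norm_eq (hα : α < 0) (hβ : β < 0) {a b : LeftIdeal O} (h : b.1 ≤ a.1)
    (hN : latticeNorm b.1 = latticeNorm a.1) : b = a := by
  refine Subtype.ext (le_antisymm h fun z hz => ?_)
  have := smul_mem_of_mem_heckeSet hα hβ le_rfl (m := 1) (a := a) (b := b)
    ⟨h, by rw [hN, Nat.cast_one, one_mul]⟩ hz
  rwa [Nat.cast_one, one_smul] at this

theorem heckeSet_one (hα : α < 0) (hβ : β < 0) (a : LeftIdeal O) : heckeSet 1 a = {a} := by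
  ext b
  constructor
  · rintro ⟨h1, h2⟩
    exact eq_of_le_of_norm_eq hα hβ h1 (by rw [h2, Nat.cast_one, one_mul])
  · rintro rfl
    exact ⟨le_rfl, by rw [Nat.cast_one, one_mul]⟩

/-! ### Self-adjointness -/

theorem nrd_intUnit (m : ℤ) (hm : m ≠ 0) :
    nrd ((intUnit m hm : (ℍ[ℚ,α,β])ˣ) : ℍ[ℚ,α,β]) = (m : ℚ) ^ 2 := by
  have := mul_intUnit m hm (1 : ℍ[ℚ,α,β])
  rw [one_mul] at this
  rw [this, nrd_zsmul, nrd_one, mul_one]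

theorem mul_intUnit_mul (m : ℤ) (hm : m ≠ 0) (y x : ℍ[ℚ,α,β]) :
    y * ((intUnit m hm : (ℍ[ℚ,α,β])ˣ) * x) = m • (y * x) := by
  rw [← mul_assoc, mul_intUnit, smul_mul_assoc]

theorem intUnit_mul_comm (m : ℤ) (hm : m ≠ 0) (x : (ℍ[ℚ,α,β])ˣ) :
    intUnit m hm * x = x * intUnit m hm :=
  Units.ext (by
    have := mul_intUnit_mul m hm 1 (x : ℍ[ℚ,α,β])
    rw [one_mul, one_mul] at this
    rw [Units.val_mul, Units.val_mul, this, mul_intUnit])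

/-- The incidences counted by `⟨t_m a, b⟩` and by `⟨a, t_m b⟩` correspond by `x ↦ m x`. -/
def heckeTransporterEquiv (hα : α < 0) (hβ : β < 0) {m : ℕ} (hm : 1 ≤ m) (a b : LeftIdeal O) :
    (Σ c : heckeSet m a, transporter c.1 b) ≃ Σ c : heckeSet m b, transporter a c.1 :=
  have hm0 : (m : ℤ) ≠ 0 := by exact_mod_cast (by omega : m ≠ 0)
  -- If `c x = b` then `m a x ⊆ c x = b` because `m a ⊆ c`, and its norm is `m² |N(x)| N(a) = m
  -- N(b)`.
  { toFun := fun s => ⟨⟨a.mul (intUnit m hm0 * s.2.1), by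
        obtain ⟨⟨c, hc⟩, ⟨x, hx⟩⟩ := s
        have hx : mulRight c.1 x = b.1 := hx
        refine ⟨?_, ?_⟩
        · intro y hy
          obtain ⟨z, hz, rfl⟩ := mem_mulRight.1 hy
          rw [Units.val_mul, mul_intUnit_mul, ← smul_mul_assoc, ← hx]
          exact mem_mulRight.2 ⟨_, smul_mem_of_mem_heckeSet hα hβ hm hc hz, rfl⟩
        · rw [LeftIdeal.norm_mul, ← hx, latticeNorm_mulRight, hc.2, Units.val_mul, nrd_mul,
            nrd_intUnit, abs_mul, abs_of_nonneg (sq_nonneg _)]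
          push_cast; ring⟩, ⟨intUnit m hm0 * s.2.1, rfl⟩⟩
    -- Conversely, if `a x = c ⊆ b` then `m b ⊆ c`, so `m b x⁻¹ ⊆ a`; the element `m⁻¹ x` carries
    -- this ideal to `b`.
    invFun := fun s => ⟨⟨b.mul (intUnit m hm0 * s.2.1⁻¹), by
        obtain ⟨⟨c, hc⟩, ⟨x, hx⟩⟩ := s
        have hx : mulRight a.1 x = c.1 := hx
        refine ⟨?_, ?_⟩
        · intro y hy
          obtain ⟨z, hz, rfl⟩ := mem_mulRight.1 hy
          rw [Units.val_mul, mul_intUnit_mul, ← smul_mul_assoc, ← mem_mulRight_unit, hx]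
          exact smul_mem_of_mem_heckeSet hα hβ hm hc hz
        · have h2 := hc.2
          rw [← hx, latticeNorm_mulRight] at h2
          have h3 : (m : ℚ) ≠ 0 := by exact_mod_cast hm0
          have h4 : |nrd (x : ℍ[ℚ,α,β])| ≠ 0 := abs_ne_zero.2 (nrd_unit_ne_zero x)
          rw [LeftIdeal.norm_mul, Units.val_mul, nrd_mul, nrd_intUnit, abs_mul, nrd_unit_inv,
            abs_of_nonneg (sq_nonneg _), abs_inv]
          push_cast
          field_simp
          linear_combination -h2⟩, ⟨(intUnit m hm0)⁻¹ * s.2.1, by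
        obtain ⟨⟨c, hc⟩, ⟨x, hx⟩⟩ := s
        change ((b.mul _).mul _).1 = b.1
        rw [LeftIdeal.mul_mul, intUnit_mul_comm, mul_assoc, mul_inv_cancel_left, inv_mul_cancel,
          LeftIdeal.mul_one]⟩⟩
    left_inv := fun s => by
      obtain ⟨⟨c, hc⟩, ⟨x, hx⟩⟩ := s
      have hx' : c.mul x = b := Subtype.ext hx
      refine Sigma.subtype_ext (Subtype.ext ?_) ?_
      · change b.mul (intUnit m hm0 * (intUnit m hm0 * x)⁻¹) = c
        rw [mul_inv_rev, intUnit_mul_comm, inv_mul_cancel_right, ← hx', LeftIdeal.mul_mul,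
          mul_inv_cancel, LeftIdeal.mul_one]
      · exact inv_mul_cancel_left _ _
    right_inv := fun s => by
      obtain ⟨⟨c, hc⟩, ⟨x, hx⟩⟩ := s
      have hx' : a.mul x = c := Subtype.ext hx
      refine Sigma.subtype_ext (Subtype.ext ?_) ?_
      · change a.mul (intUnit m hm0 * ((intUnit m hm0)⁻¹ * x)) = c
        rw [mul_inv_cancel_left, hx']
      · exact mul_inv_cancel_left _ _ }

/-- Finiteness of `T_m(a)` excludes the default value zero of the `finsum`. -/
theorem heckeClass_cls (hα : α < 0) (hβ : β < 0) (R : Type*) [CommRing R] {m : ℕ} (hm : 1 ≤ m)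
    (a : LeftIdeal O) : heckeClass R m (cls a)
      = ∑ b ∈ (heckeSet_finite hα hβ hm a).toFinset, Finsupp.single (cls b) (1 : R) := by
  change ∑ᶠ b : heckeSet m a, Finsupp.single (cls b.1) (1 : R) = _
  rw [finsum_set_coe_eq_finsum_mem (f := fun b => Finsupp.single (cls b) (1 : R)),
    finsum_mem_eq_finite_toFinset_sum]

theorem sum_card_transporter (hα : α < 0) (hβ : β < 0) {m : ℕ} (hm : 1 ≤ m) (a b : LeftIdeal O) :
    ∑ c ∈ (heckeSet_finite hα hβ hm a).toFinset, (Nat.card (transporter c b) : ℝ)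
      = ∑ c ∈ (heckeSet_finite hα hβ hm b).toFinset, (Nat.card (transporter a c) : ℝ) := by
  have := (heckeSet_finite hα hβ hm a).fintype
  have := (heckeSet_finite hα hβ hm b).fintype
  have h := Nat.card_congr (heckeTransporterEquiv hα hβ hm a b)
  have (c d : LeftIdeal O) : Finite (transporter c d) := transporter_finite hα hβ c d
  rw [Nat.card_sigma, Nat.card_sigma] at h
  rw [Finset.sum_subtype _ (fun c => (heckeSet_finite hα hβ hm a).mem_toFinset),
    Finset.sum_subtype _ (fun c => (heckeSet_finite hα hβ hm b).mem_toFinset)]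
  exact_mod_cast h

/-- The operators `t_m`, `m ≥ 1`, are self-adjoint. -/
theorem height_hecke (hα : α < 0) (hβ : β < 0) {m : ℕ} (hm : 1 ≤ m) (v w : IdealModule ℝ O) :
    height O (hecke ℝ O m v) w = height O v (hecke ℝ O m w) := by
  induction v using Finsupp.induction_linear with
  | zero => simp
  | add v v' h h' => simp only [map_add, LinearMap.add_apply, h, h']
  | single c r =>
    induction w using Finsupp.induction_linear with
    | zero => simp
    | add w w' h h' => simp only [map_add, h, h']
    | single d s =>
      induction c using Quotient.inductionOn with | _ a
      induction d using Quotient.inductionOn with | _ b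
      change height O (hecke ℝ O m (Finsupp.single (cls a) r)) (Finsupp.single (cls b) s)
        = height O (Finsupp.single (cls a) r) (hecke ℝ O m (Finsupp.single (cls b) s))
      rw [hecke_single, hecke_single, heckeClass_cls hα hβ ℝ hm, heckeClass_cls hα hβ ℝ hm]
      simp only [map_smul, map_sum, LinearMap.smul_apply, LinearMap.sum_apply, height_single,
        heightClass_cls, smul_eq_mul, one_mul, ← Finset.mul_sum]
      rw [sum_card_transporter hα hβ hm]
      ring

/-- Reduces self-adjointness on `M(O)` to self-adjointness on `M_ℝ(O)`. -/
theorem toReal_hecke (hα : α < 0) (hβ : β < 0) {m : ℕ} (hm : 1 ≤ m) (v : IdealModule ℤ O) :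
    toReal (hecke ℤ O m v) = hecke ℝ O m (toReal v) := by
  let F : IdealModule ℤ O →+ IdealModule ℝ O := ⟨⟨toReal, Finsupp.mapRange_zero⟩, toReal_add⟩
  change F (hecke ℤ O m v) = hecke ℝ O m (F v)
  induction v using Finsupp.induction_linear with
  | zero => simp
  | add v v' h h' => simp only [map_add, h, h']
  | single c n =>
    induction c using Quotient.inductionOn with | _ a
    change F (hecke ℤ O m (Finsupp.single (cls a) n)) = hecke ℝ O m (toReal (Finsupp.single (cls a) n))
    rw [toReal_single, hecke_single, hecke_single, heckeClass_cls hα hβ ℝ hm,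
      heckeClass_cls hα hβ ℤ hm, map_zsmul, map_sum, Int.cast_smul_eq_zsmul]
    congr 1
    refine Finset.sum_congr rfl fun b _ => ?_
    change toReal _ = _
    rw [toReal_single, Int.cast_one]

end Hecke

/-! ### Composition of Hecke operators -/

section

variable {O : Subring ℍ[ℚ,α,β]}

theorem hecke_ext {R : Type*} [CommRing R] {f g : IdealModule R O →ₗ[R] IdealModule R O}
    (h : ∀ a : LeftIdeal O, f (Finsupp.single (cls a) 1) = g (Finsupp.single (cls a) 1)) :
    f = g := by
  refine Finsupp.lhom_ext' fun c => LinearMap.ext_ring ?_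
  induction c using Quotient.inductionOn with | _ a
  exact h a

/-- Relative norms multiply along a chain, so once `b` is fixed only the inclusion `c ⊆ b` remains
as a condition. This permits interchanging the two sums in a product of operators. -/
theorem mem_heckeSet_trans {m m' : ℕ} {a b c : LeftIdeal O} (hb : b ∈ heckeSet m' a) :
    c ∈ heckeSet m b ↔ c ∈ heckeSet (m * m') a ∧ c.1 ≤ b.1 := by
  have e : ((m * m' : ℕ) : ℚ) * latticeNorm a.1 = m * latticeNorm b.1 := by
    rw [hb.2]; push_cast; ring
  constructor
  · intro hc
    exact ⟨⟨hc.1.trans hb.1, by rw [hc.2, e]⟩, hc.1⟩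
  · rintro ⟨hc, h⟩
    exact ⟨h, by rw [hc.2, e]⟩

variable [IsOrder O]

open Classical in
/-- The product `t_m t_{m'}` counts the `b` between `c` and `a`. -/
theorem hecke_heckeClass (hα : α < 0) (hβ : β < 0) (R : Type*) [CommRing R] {m m' : ℕ}
    (hm : 1 ≤ m) (hm' : 1 ≤ m') (hmm : 1 ≤ m * m') (a : LeftIdeal O) :
    hecke R O m (heckeClass R m' (cls a))
      = ∑ c ∈ (heckeSet_finite hα hβ hmm a).toFinset,
        ({b ∈ (heckeSet_finite hα hβ hm' a).toFinset | c.1 ≤ b.1}).card •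
          Finsupp.single (cls c) (1 : R) := by
  rw [heckeClass_cls hα hβ R hm', map_sum]
  simp only [hecke_single, one_smul, heckeClass_cls hα hβ R hm, ← Finset.sum_const]
  refine Finset.sum_comm' fun b c => ?_
  simp only [Set.Finite.mem_toFinset, Finset.mem_filter]
  constructor
  · rintro ⟨hb, hc⟩
    rw [mem_heckeSet_trans hb] at hc
    exact ⟨⟨hb, hc.2⟩, hc.1⟩
  · rintro ⟨⟨hb, hcb⟩, hc⟩
    exact ⟨hb, (mem_heckeSet_trans hb).2 ⟨hc, hcb⟩⟩

/-! ### Coprime indices -/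

/-- The intermediate ideal `c + m' a`. -/
theorem exists_intermediate (hα : α < 0) (hβ : β < 0) {m m' : ℕ} (hm : 1 ≤ m) (hm' : 1 ≤ m')
    (hmm : Nat.Coprime m m') {a c : LeftIdeal O} (hc : c ∈ heckeSet (m * m') a) :
    ∃ b ∈ heckeSet m' a, c.1 ≤ b.1 ∧ ∀ z ∈ b.1, (m : ℤ) • z ∈ c.1 := by
  have hm0 : (m' : ℤ) ≠ 0 := by exact_mod_cast (by omega : m' ≠ 0)
  have hc1 : 1 ≤ m * m' := Nat.mul_pos hm hm'
  have := c.2.isLattice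
  have := (a.mul (intUnit m' hm0)).2.isLattice
  set B : Submodule ℤ ℍ[ℚ,α,β] := c.1 ⊔ (a.mul (intUnit m' hm0)).1 with hB
  have hBL : B.IsLattice ℚ := Submodule.IsLattice.sup ℚ _ _
  have hm'a : ∀ z ∈ a.1, (m' : ℤ) • z ∈ B := fun z hz => by
    rw [← mul_intUnit m' hm0]
    exact Submodule.mem_sup_right (mem_mulRight.2 ⟨z, hz, rfl⟩)
  have hBa : B ≤ a.1 := by
    refine sup_le hc.1 ?_
    intro y hy
    obtain ⟨z, hz, rfl⟩ := mem_mulRight.1 hy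
    rw [mul_intUnit]
    exact a.1.smul_mem _ hz
  have hcB : c.1 ≤ B := le_sup_left
  -- Since `c` has relative norm `m m'`, it contains `m m' a`.
  have hmB : ∀ z ∈ B, (m : ℤ) • z ∈ c.1 := by
    intro z hz
    obtain ⟨u, hu, y, hy, rfl⟩ := Submodule.mem_sup.1 hz
    obtain ⟨w, hw, rfl⟩ := mem_mulRight.1 hy
    rw [smul_add, mul_intUnit, smul_smul]
    refine c.1.add_mem (c.1.smul_mem _ hu) ?_
    have := smul_mem_of_mem_heckeSet hα hβ hc1 hc hw
    rwa [Nat.cast_mul] at this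
  -- From `m' a ⊆ B ⊆ a`, the lattice `B` agrees with `a` where `m'` is a unit; from `m B ⊆ c ⊆ B`,
  -- it agrees with `c` where `m` is a unit. By coprimality every prime is covered, which yields
  -- both local generators and the norm of `B`.
  have hloc : ∀ (p : ℕ) [Fact p.Prime],
      (¬ (p : ℤ) ∣ m' ∧ loc p B = loc p a.1) ∨ (¬ (p : ℤ) ∣ m ∧ loc p B = loc p c.1) := by
    intro p hp
    by_cases h : (p : ℤ) ∣ m'
    · right
      have h' : ¬ (p : ℤ) ∣ m := by
        rw [Int.natCast_dvd_natCast] at h ⊢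
        exact fun h' => Nat.Prime.not_coprime_iff_dvd.2 ⟨p, hp.out, h', h⟩ hmm
      exact ⟨h', (loc_eq_of_le_of_smul_le hcB h' hmB).symm⟩
    · exact Or.inl ⟨h, loc_eq_of_le_of_smul_le hBa h hm'a⟩
  have hBI : IsLeftIdeal O B := isLeftIdeal_of_isGen hBL fun p _ => by
    rcases hloc p with ⟨-, h⟩ | ⟨-, h⟩
    · obtain ⟨x, hx⟩ := a.2.exists_isGen hα hβ p
      exact ⟨x, hx.congr h⟩
    · obtain ⟨x, hx⟩ := c.2.exists_isGen hα hβ p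
      exact ⟨x, hx.congr h⟩
  refine ⟨⟨B, hBI⟩, ⟨hBa, ?_⟩, hcB, hmB⟩
  have hm'pos : (0 : ℚ) < m' := by exact_mod_cast hm'
  refine eq_of_padicNorm_eq (latticeNorm_pos hα hβ B) (mul_pos hm'pos (a.norm_pos hα hβ))
    fun p _ => ?_
  rcases hloc p with ⟨hd, h⟩ | ⟨hd, h⟩
  · obtain ⟨x, hx⟩ := a.2.exists_isGen hα hβ p
    rw [padicNorm.mul, hx.padicNorm_latticeNorm a.fg, (hx.congr h).padicNorm_latticeNorm hBL.fg]
    have := padicNorm_int_eq_one hd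
    rw [Int.cast_natCast] at this
    rw [this, one_mul]
  · obtain ⟨x, hx⟩ := c.2.exists_isGen hα hβ p
    rw [(hx.congr h).padicNorm_latticeNorm hBL.fg, ← hx.padicNorm_latticeNorm c.fg, hc.2]
    have := padicNorm_int_eq_one hd
    rw [Int.cast_natCast] at this
    rw [Nat.cast_mul, mul_assoc, padicNorm.mul, this, one_mul]

/-- `t_{m m'} = t_m t_{m'}` for coprime `m, m' ≥ 1`. -/
theorem hecke_mul_of_coprime (hα : α < 0) (hβ : β < 0) (R : Type*) [CommRing R] {m m' : ℕ}
    (hm : 1 ≤ m) (hm' : 1 ≤ m') (hmm : Nat.Coprime m m') :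
    hecke R O (m * m') = hecke R O m ∘ₗ hecke R O m' := by
  classical
  have hmul : 1 ≤ m * m' := Nat.mul_pos hm hm'
  refine hecke_ext fun a => ?_
  rw [LinearMap.comp_apply, hecke_single, hecke_single, one_smul, one_smul,
    hecke_heckeClass hα hβ R hm hm' hmul, heckeClass_cls hα hβ R hmul]
  refine Finset.sum_congr rfl fun c hc => ?_
  rw [Set.Finite.mem_toFinset] at hc
  obtain ⟨b, hb, hcb, hmb⟩ := exists_intermediate hα hβ hm hm' hmm hc
  have : ({b ∈ (heckeSet_finite hα hβ hm' a).toFinset | c.1 ≤ b.1}) = {b} := by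
    ext d
    simp only [Finset.mem_filter, Set.Finite.mem_toFinset, Finset.mem_singleton]
    constructor
    · rintro ⟨hd, hcd⟩
      symm
      refine eq_of_le_of_norm_eq hα hβ ?_ (hb.2.trans hd.2.symm)
      -- A competitor `d` contains `m b`, because `m b ⊆ c`, and `m' b`, because `m' a ⊆ d`; by
      -- Bézout it contains `b`, and the norms agree.
      intro z hz
      have h1 : (m : ℤ) • z ∈ d.1 := hcd (hmb z hz)
      have h2 : (m' : ℤ) • z ∈ d.1 := smul_mem_of_mem_heckeSet hα hβ hm' hd (hb.1 hz)
      obtain ⟨u, v, huv⟩ := Nat.isCoprime_iff_coprime.2 hmm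
      have := d.1.add_mem (d.1.smul_mem u h1) (d.1.smul_mem v h2)
      rwa [smul_smul, smul_smul, ← add_smul, huv, one_smul] at this
    · rintro rfl
      exact ⟨hb, hcb⟩
  rw [this, Finset.card_singleton, one_smul]

theorem hecke_one (hα : α < 0) (hβ : β < 0) (R : Type*) [CommRing R] :
    hecke R O 1 = LinearMap.id := by
  refine hecke_ext fun a => ?_
  have : (heckeSet_finite hα hβ le_rfl a).toFinset = {a} := by
    ext b; simp [heckeSet_one hα hβ]
  rw [hecke_single, one_smul, heckeClass_cls hα hβ R le_rfl, this, Finset.sum_singleton,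
    LinearMap.id_apply]

end

/-! ### Finiteness of the class number -/

theorem nrd_add_le (hα : α < 0) (hβ : β < 0) (x y : ℍ[ℚ,α,β]) :
    nrd (x + y) ≤ 2 * (nrd x + nrd y) := by
  have h1 := nrd_nonneg hα hβ (x - y)
  have h2 : nrd (x + y) + nrd (x - y) = 2 * (nrd x + nrd y) := by
    simp [nrd_eq]; ring
  linarith

/-- Some multiple of `w` by a bounded positive integer is at distance less than one from `L`. -/
theorem exists_bounded_multiple (hα : α < 0) (hβ : β < 0) (L : Submodule ℤ ℍ[ℚ,α,β])
    [L.IsLattice ℚ] : ∃ M : ℕ, ∀ w : ℍ[ℚ,α,β], ∃ n : ℕ, 1 ≤ n ∧ n ≤ M ∧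
      ∃ o ∈ L, nrd ((n : ℤ) • w - o) < 1 := by
  obtain ⟨b, hb⟩ := exists_basis L
  have hbL : ∀ i, b i ∈ L := fun i => hb ▸ Submodule.subset_span ⟨i, rfl⟩
  set S : ℚ := ∑ i, nrd (b i) with hS
  have hS0 : 0 ≤ S := Finset.sum_nonneg fun i _ => nrd_nonneg hα hβ _
  -- With coordinates smaller than `1 / K` the norm is at most `4 S / K ^ 2 < 1`; the factor `4`
  -- comes from two uses of `nrd_add_le`.
  obtain ⟨K, hK⟩ := exists_nat_gt (4 * S)
  have hKpos : (0 : ℚ) < K := by linarith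
  have hK1 : (1 : ℚ) ≤ K := by
    have : 0 < K := by exact_mod_cast hKpos
    exact_mod_cast this
  have hbound : ∀ c : Fin 4 → ℚ, (∀ i, |K * c i| < 1) → nrd (∑ i, c i • b i) < 1 := by
    intro c hc
    have h1 : nrd (∑ i, c i • b i) ≤ 4 * ∑ i, nrd (c i • b i) := by
      rw [Fin.sum_univ_four, Fin.sum_univ_four]
      have e1 := nrd_add_le hα hβ (c 0 • b 0) (c 1 • b 1)
      have e2 := nrd_add_le hα hβ (c 2 • b 2) (c 3 • b 3)
      have e3 := nrd_add_le hα hβ (c 0 • b 0 + c 1 • b 1) (c 2 • b 2 + c 3 • b 3)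
      rw [← add_assoc] at e3
      linarith
    have h2 : (K : ℚ) ^ 2 * ∑ i, nrd (c i • b i) ≤ S := by
      rw [Finset.mul_sum]
      refine Finset.sum_le_sum fun i _ => ?_
      rw [nrd_smul, ← mul_assoc, ← mul_pow]
      refine mul_le_of_le_one_left (nrd_nonneg hα hβ _) ?_
      exact (sq_lt_one_iff_abs_lt_one _).2 (hc i) |>.le
    nlinarith
  refine ⟨K ^ 4, fun w => ?_⟩
  have hfl : ∀ (n : ℕ) (i : Fin 4), ⌊(K : ℚ) * Int.fract ((n : ℚ) * b.repr w i)⌋.toNat < K := by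
    intro n i
    have h1 : (K : ℚ) * Int.fract ((n : ℚ) * b.repr w i) < K :=
      mul_lt_of_lt_one_right hKpos (Int.fract_lt_one _)
    have h2 : ⌊(K : ℚ) * Int.fract ((n : ℚ) * b.repr w i)⌋ < K := Int.floor_lt.2 (by exact_mod_cast h1)
    have : 0 < K := by exact_mod_cast hKpos
    omega
  -- Dirichlet's pigeonhole principle: two of the multiples `0, w, …, K ^ 4 w` have fractional
  -- coordinates in the same box of side `1 / K`, and the multiplier sought is the difference of
  -- their indices.
  let F : Fin (K ^ 4 + 1) → (Fin 4 → Fin K) := fun n i => ⟨_, hfl n i⟩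
  obtain ⟨n₁, n₂, hne, hF⟩ := Fintype.exists_ne_map_eq_of_card_lt F (by simp)
  wlog hlt : n₁ < n₂ generalizing n₁ n₂
  · exact this n₂ n₁ hne.symm hF.symm (lt_of_le_of_ne (not_lt.1 hlt) hne.symm)
  have hlt' : (n₁ : ℕ) < n₂ := hlt
  refine ⟨n₂ - n₁, by omega, by have := n₂.2; omega, ?_⟩
  refine ⟨∑ i, (⌊((n₂ : ℕ) : ℚ) * b.repr w i⌋ - ⌊((n₁ : ℕ) : ℚ) * b.repr w i⌋) • b i,
    L.sum_mem fun i _ => L.smul_mem _ (hbL i), ?_⟩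
  have e : (((n₂ - n₁ : ℕ) : ℤ) • w
      - ∑ i, (⌊((n₂ : ℕ) : ℚ) * b.repr w i⌋ - ⌊((n₁ : ℕ) : ℚ) * b.repr w i⌋) • b i)
      = ∑ i, (Int.fract (((n₂ : ℕ) : ℚ) * b.repr w i)
          - Int.fract (((n₁ : ℕ) : ℚ) * b.repr w i)) • b i := by
    nth_rewrite 1 [← b.sum_repr w]
    rw [Finset.smul_sum, ← Finset.sum_sub_distrib]
    refine Finset.sum_congr rfl fun i _ => ?_
    rw [← Int.cast_smul_eq_zsmul ℚ, ← Int.cast_smul_eq_zsmul ℚ, smul_smul, ← sub_smul]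
    congr 1
    rw [Int.fract, Int.fract]
    push_cast [Nat.cast_sub hlt'.le]
    ring
  rw [e]
  refine hbound _ fun i => ?_
  rw [mul_sub]
  refine Int.abs_sub_lt_one_of_floor_eq_floor ?_
  have h1 : ⌊(K : ℚ) * Int.fract (((n₁ : ℕ) : ℚ) * b.repr w i)⌋.toNat
      = ⌊(K : ℚ) * Int.fract (((n₂ : ℕ) : ℚ) * b.repr w i)⌋.toNat :=
    congrArg Fin.val (congrFun hF i)
  have h2 : ∀ n : ℕ, 0 ≤ ⌊(K : ℚ) * Int.fract ((n : ℚ) * b.repr w i)⌋ := fun n =>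
    Int.floor_nonneg.2 (mul_nonneg hKpos.le (Int.fract_nonneg _))
  have h3 := h2 n₁
  have h4 := h2 n₂
  omega

/-- Let `u` be a nonzero element of least norm in `a`. Then `a u⁻¹` contains `O` and lies in `(1 /
M!) O`, with `M` the bound of `exists_bounded_multiple`, and only finitely many lattices lie in
between. -/
theorem finite_idealClass (hα : α < 0) (hβ : β < 0) (O : Subring ℍ[ℚ,α,β]) [hO : IsOrder O] :
    Finite (IdealClass O) := by
  obtain ⟨M, hM⟩ := exists_bounded_multiple hα hβ (toLat O)
  have hf0 : (M.factorial : ℤ) ≠ 0 := by exact_mod_cast M.factorial_ne_zero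
  let D : (ℍ[ℚ,α,β])ˣ := intUnit (M.factorial : ℤ) hf0
  let L := mulRight (toLat O) ((D⁻¹ : (ℍ[ℚ,α,β])ˣ) : ℍ[ℚ,α,β])
  have hmemL : ∀ z, z ∈ L ↔ (M.factorial : ℤ) • z ∈ toLat O := by
    intro z
    rw [mem_mulRight_unit, inv_inv, mul_intUnit]
  have hLfg : L.FG := hO.isLattice.fg.map _
  let T : Set (LeftIdeal O) := {a | a.1 ≤ L ∧ toLat O ≤ a.1}
  have hT : T.Finite := by
    refine Set.Finite.of_finite_image (f := Subtype.val)
      ((finite_sublattices L hLfg hf0).subset ?_) Subtype.val_injective.injOn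
    rintro _ ⟨a, ha, rfl⟩
    exact ⟨ha.1, fun z hz => ha.2 ((hmemL z).1 hz)⟩
  have := hT.to_subtype
  refine Finite.of_surjective (fun a : T => cls a.1) fun c => ?_
  induction c using Quotient.inductionOn with | _ a
  have := a.2.isLattice
  obtain ⟨x₀, hx₀, hx₀0⟩ := exists_ne_zero_mem a.1
  obtain ⟨x, ⟨⟨hx, hxle⟩, hx0⟩, hmin⟩ := Set.exists_min_image
    ({x | x ∈ a.1 ∧ nrd x ≤ nrd x₀} \ {0}) nrd
    ((finite_nrd_le hα hβ a.fg (nrd x₀)).sdiff) ⟨x₀, ⟨hx₀, le_rfl⟩, hx₀0⟩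
  obtain ⟨u, rfl⟩ := exists_unit hα hβ hx0
  have hu : 0 < nrd (u : ℍ[ℚ,α,β]) := nrd_pos hα hβ hx0
  refine ⟨⟨a.mul u⁻¹, ?_, ?_⟩, cls_mul a u⁻¹⟩
  · intro y hy
    obtain ⟨z, hz, rfl⟩ := mem_mulRight.1 hy
    rw [hmemL]
    obtain ⟨n, hn1, hnM, o, ho, hlt⟩ := hM (z * ((u⁻¹ : (ℍ[ℚ,α,β])ˣ) : ℍ[ℚ,α,β]))
    set t := (n : ℤ) • (z * ((u⁻¹ : (ℍ[ℚ,α,β])ˣ) : ℍ[ℚ,α,β])) - o with ht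
    have htu : t * (u : ℍ[ℚ,α,β]) = (n : ℤ) • z - o * (u : ℍ[ℚ,α,β]) := by
      rw [ht, sub_mul, smul_mul_assoc, mul_assoc, Units.inv_mul, mul_one]
    have htu_mem : t * (u : ℍ[ℚ,α,β]) ∈ a.1 := by
      rw [htu]
      exact a.1.sub_mem (a.1.smul_mem _ hz) (a.order_mul_mem hα hβ ho hx)
    have hlt' : nrd (t * (u : ℍ[ℚ,α,β])) < nrd (u : ℍ[ℚ,α,β]) := by
      rw [nrd_mul]
      exact mul_lt_of_lt_one_left hu hlt
    -- The remainder `n z - o u` lies in `a` and is shorter than `u`, hence zero by minimality.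
    have h0 : t * (u : ℍ[ℚ,α,β]) = 0 := by
      by_contra hne
      exact absurd (hmin _ ⟨⟨htu_mem, hlt'.le.trans hxle⟩, hne⟩) (not_le.2 hlt')
    have ht0 : t = 0 := by simpa using h0
    have h1 : (n : ℤ) • (z * ((u⁻¹ : (ℍ[ℚ,α,β])ˣ) : ℍ[ℚ,α,β])) ∈ toLat O := by
      rw [sub_eq_zero.1 (ht.symm.trans ht0)]; exact ho
    obtain ⟨k, hk⟩ := Nat.dvd_factorial hn1 hnM
    rw [hk, Nat.cast_mul, mul_comm, mul_smul]
    exact (toLat O).smul_mem _ h1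
  · intro o ho
    exact mem_mulRight.2 ⟨o * (u : ℍ[ℚ,α,β]), a.order_mul_mem hα hβ ho hx, Units.mul_inv_cancel_right _ _⟩

/-! ### The operator `t_0` -/

variable {O : Subring ℍ[ℚ,α,β]}

theorem heightClass_self_pos (hα : α < 0) (hβ : β < 0) (c : IdealClass O) :
    0 < heightClass c c := by
  induction c using Quotient.inductionOn with | _ a
  have := (transporter_finite hα hβ a a).to_subtype
  have : Nonempty (transporter a a) := ⟨⟨1, mulRight_one a.1⟩⟩
  change 0 < (1 / 2 : ℝ) * Nat.card (transporter a a)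
  have : 0 < Nat.card (transporter a a) := Nat.card_pos
  positivity

theorem heightClass_of_ne {c d : IdealClass O} (h : c ≠ d) : heightClass c d = 0 := by
  induction c using Quotient.inductionOn with | _ a
  induction d using Quotient.inductionOn with | _ b
  change (1 / 2 : ℝ) * Nat.card (transporter a b) = 0
  have : IsEmpty (transporter a b) := ⟨fun x => h (Quotient.sound ⟨x.1⁻¹, by
    have hx : mulRight a.1 x.1 = b.1 := x.2
    rw [← hx, mulRight_unit_inv]⟩)⟩
  rw [Nat.card_of_isEmpty]; simp

theorem heightClass_comm (c d : IdealClass O) : heightClass c d = heightClass d c := by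
  rcases eq_or_ne c d with rfl | h
  · rfl
  · rw [heightClass_of_ne h, heightClass_of_ne h.symm]

theorem height_comm (v w : IdealModule ℝ O) : height O v w = height O w v := by
  induction v using Finsupp.induction_linear with
  | zero => simp
  | add v v' h h' => simp only [map_add, LinearMap.add_apply, h, h']
  | single c r =>
    induction w using Finsupp.induction_linear with
    | zero => simp
    | add w w' h h' => simp only [map_add, LinearMap.add_apply, h, h']
    | single d s =>
      rw [height_single, height_single, heightClass_comm]; ring

variable [IsOrder O]

/-- `e₀` pairs to one with every class. -/
theorem height_e₀ (hα : α < 0) (hβ : β < 0) (d : IdealClass O) (s : ℝ) :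
    height O (e₀ O) (Finsupp.single d s) = s := by
  -- Without finitely many classes the `finsum` defining `e₀` could take its default value zero.
  have := finite_idealClass hα hβ O
  have := Fintype.ofFinite (IdealClass O)
  rw [e₀, finsum_eq_sum_of_fintype, map_sum, LinearMap.sum_apply, Finset.sum_eq_single d]
  · rw [height_single, mul_left_comm, one_div_mul_cancel (heightClass_self_pos hα hβ d).ne', mul_one]
  · intro c _ hc
    rw [height_single, heightClass_of_ne hc, mul_zero, mul_zero]
  · intro h; exact absurd (Finset.mem_univ d) h

/-- Both sides are half the product of the degrees (sums of coefficients) of `v` and `w`. -/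
theorem height_heckeZero (hα : α < 0) (hβ : β < 0) (v w : IdealModule ℝ O) :
    height O (heckeZero O v) w = height O v (heckeZero O w) := by
  induction v using Finsupp.induction_linear with
  | zero => simp
  | add v v' h h' => simp only [map_add, LinearMap.add_apply, h, h']
  | single c r =>
    induction w using Finsupp.induction_linear with
    | zero => simp
    | add w w' h h' => simp only [map_add, h, h']
    | single d s =>
      simp only [heckeZero, Finsupp.linearCombination_single, map_smul, LinearMap.smul_apply,
        smul_eq_mul]
      rw [height_e₀ hα hβ, height_comm, height_e₀ hα hβ]
      ring

/-! ### Splitting of nondegenerate quaternion algebras over finite fields -/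

/-- Trace and norm on an algebra in which every element satisfies its quadratic equation. -/
structure TraceNorm (K A : Type*) [Field K] [Ring A] [Algebra K A] where
  T : A →ₗ[K] K
  N : A → K
  mul_self : ∀ x, x * x = T x • x - N x • 1
  mul_mul_self : ∀ x w, x * w * x = T (x * w) • x - N x • (T w • 1 - w)
  T_one : T 1 = 2
  N_one : N 1 = 1
  T_mul_comm : ∀ x y, T (x * y) = T (y * x)
  N_mul : ∀ x y, N (x * y) = N x * N y
  N_add : ∀ x y, N (x + y) = N x + N y + (T x * T y - T (x * y))
  N_smul : ∀ (c : K) x, N (c • x) = c ^ 2 * N x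
  nondegenerate : ∀ x, (∀ y, T (x * y) = 0) → x = 0

namespace TraceNorm

variable {K A : Type*} [Field K] [Ring A] [Algebra K A] (D : TraceNorm K A)

/-- The norm form in coordinates. -/
theorem N_sum (a : Fin 4 → A) (n : Fin 4 → K) : D.N (∑ i, n i • a i)
    = ∑ i, ∑ j, (if i = j then D.N (a i) else
        if i < j then D.T (a i) * D.T (a j) - D.T (a i * a j) else 0) * n i * n j := by
  simp only [Fin.sum_univ_four, D.N_add, D.N_smul, map_add, map_smul, add_mul, smul_mul_smul_comm,
    smul_eq_mul]
  simp
  ring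

/-- A quaternion algebra over a finite field is isotropic. -/
theorem exists_isotropic [Finite K] {a : Fin 4 → A} (ha : LinearIndependent K a) :
    ∃ e ≠ 0, D.N e = 0 := by
  classical
  have := Fintype.ofFinite K
  obtain ⟨p, hp⟩ := CharP.exists K
  have hpp : p.Prime := CharP.char_is_prime K p
  let c : Fin 4 → Fin 4 → K := fun i j => if i = j then D.N (a i) else
        if i < j then D.T (a i) * D.T (a j) - D.T (a i * a j) else 0
  let F : MvPolynomial (Fin 4) K :=
    ∑ i, ∑ j, MvPolynomial.C (c i j) * MvPolynomial.X i * MvPolynomial.X j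
  have hF : ∀ n : Fin 4 → K, MvPolynomial.eval n F = D.N (∑ i, n i • a i) := by
    intro n
    rw [D.N_sum]
    simp [F, c]
  -- Chevalley–Warning: a form of degree `2` in `4` variables has a number of zeros divisible by the
  -- characteristic. As the origin is one, there is another.
  have hdeg : F.totalDegree < Fintype.card (Fin 4) := by
    have : F.totalDegree ≤ 2 := by
      refine MvPolynomial.totalDegree_finsetSum_le fun i _ =>
        MvPolynomial.totalDegree_finsetSum_le fun j _ => ?_
      refine (MvPolynomial.totalDegree_mul _ _).trans ?_
      have h1 := MvPolynomial.totalDegree_mul (MvPolynomial.C (c i j)) (MvPolynomial.X (R := K) i)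
      rw [MvPolynomial.totalDegree_C, MvPolynomial.totalDegree_X] at h1
      rw [MvPolynomial.totalDegree_X]
      omega
    rw [Fintype.card_fin]; omega
  have hdvd := char_dvd_card_solutions p hdeg
  have h0 : MvPolynomial.eval (0 : Fin 4 → K) F = 0 := by
    rw [hF]
    have := D.N_smul 0 0
    simpa using this
  have hcard : 1 < Fintype.card {x : Fin 4 → K // MvPolynomial.eval x F = 0} :=
    hpp.one_lt.trans_le (Nat.le_of_dvd (Fintype.card_pos_iff.2 ⟨⟨0, h0⟩⟩) hdvd)
  obtain ⟨⟨n, hn⟩, hne⟩ := Fintype.exists_ne_of_one_lt_card hcard ⟨0, h0⟩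
  refine ⟨∑ i, n i • a i, fun h => hne (Subtype.ext ?_), by rw [← hF, hn]⟩
  funext i
  exact Fintype.linearIndependent_iff.1 ha n h i

/-- Two linear conditions on a space of dimension four. It shows below that the algebra is larger
than its diagonal part `K f + K g`. -/
theorem exists_ne_zero_T_eq_zero {a : Fin 4 → A} (ha : LinearIndependent K a) (f g : A) :
    ∃ w ≠ 0, D.T (f * w) = 0 ∧ D.T (g * w) = 0 := by
  let L : (Fin 4 → K) →ₗ[K] (Fin 2 → K) := LinearMap.pi
    ![D.T ∘ₗ LinearMap.mulLeft K f ∘ₗ Fintype.linearCombination K a,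
      D.T ∘ₗ LinearMap.mulLeft K g ∘ₗ Fintype.linearCombination K a]
  have hker : LinearMap.ker L ≠ ⊥ := LinearMap.ker_ne_bot_of_finrank_lt (by simp)
  obtain ⟨n, hn, hn0⟩ := (Submodule.ne_bot_iff _).1 hker
  rw [LinearMap.mem_ker] at hn
  refine ⟨∑ i, n i • a i, fun h => hn0 (funext fun i => Fintype.linearIndependent_iff.1 ha n h i),
    ?_, ?_⟩
  · exact congrFun hn 0
  · exact congrFun hn 1

theorem exists_T_eq_one {x : A} (hx : x ≠ 0) : ∃ y, D.T (x * y) = 1 := by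
  by_contra! h
  refine hx (D.nondegenerate x fun y => ?_)
  by_contra hy
  refine h ((D.T (x * y))⁻¹ • y) ?_
  rw [mul_smul_comm, map_smul, smul_eq_mul, inv_mul_cancel₀ hy]

/-- Matrix units adapted to the trace. -/
structure MatrixUnits where
  f : A
  g : A
  u : A
  v : A
  f_add_g : f + g = 1
  u_mul_v : u * v = f
  v_mul_u : v * u = g
  f_mul_u : f * u = u
  u_mul_g : u * g = u
  v_mul_f : v * f = v
  g_mul_v : g * v = v
  f_mul_g : f * g = 0
  g_mul_f : g * f = 0
  f_mul_mul : ∀ x, f * x * f = D.T (f * x) • f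
  g_mul_mul : ∀ x, g * x * g = D.T (g * x) • g
  u_mul_mul : ∀ x, u * x * u = D.T (u * x) • u
  v_mul_mul : ∀ x, v * x * v = D.T (v * x) • v
  T_f : D.T f = 1
  T_g : D.T g = 1

/-- Scaling an isotropic `e` by nondegeneracy gives `f = e y` of norm `0` and trace `1`, hence
idempotent; put `g = 1 - f`. A nonzero off-diagonal element `u = f w g` pairs to trace one with some
`w'`, and `v = g w' f` completes the matrix units. -/
theorem exists_matrixUnits [Finite K] {a : Fin 4 → A} (ha : LinearIndependent K a) :
    Nonempty (MatrixUnits D) := by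
  obtain ⟨e, he, hNe⟩ := D.exists_isotropic ha
  obtain ⟨y, hy⟩ := D.exists_T_eq_one he
  obtain ⟨f, hNf, hTf⟩ : ∃ f, D.N f = 0 ∧ D.T f = 1 :=
    ⟨e * y, by rw [D.N_mul, hNe, zero_mul], hy⟩
  have hff : f * f = f := by rw [D.mul_self, hTf, hNf, one_smul, zero_smul, sub_zero]
  obtain ⟨g, hg⟩ : ∃ g, g = 1 - f := ⟨_, rfl⟩
  have hfg : f + g = 1 := by rw [hg]; abel
  have hfg0 : f * g = 0 := by rw [hg, mul_sub, mul_one, hff, sub_self]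
  have hgf0 : g * f = 0 := by rw [hg, sub_mul, one_mul, hff, sub_self]
  have hgg : g * g = g := by
    nth_rewrite 1 [hg]
    rw [sub_mul, one_mul, hfg0, sub_zero]
  have hTg : D.T g = 1 := by rw [hg, map_sub, D.T_one, hTf]; norm_num
  have hNg : D.N g = 0 := by
    have h1 : g = 1 + (-1 : K) • f := by rw [hg, neg_smul, one_smul, sub_eq_add_neg]
    rw [h1, D.N_add, D.N_smul, one_mul, map_smul, D.T_one, hTf, hNf, D.N_one, smul_eq_mul]
    ring
  -- Elements of norm zero behave as matrices of rank at most one; this applies to `f`, `g`, `u` and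
  -- `v` alike.
  have hN0 : ∀ z, D.N z = 0 → ∀ x, z * x * z = D.T (z * x) • z := fun z hz x => by
    rw [D.mul_mul_self, hz, zero_smul, sub_zero]
  -- If `f A g` vanished, then `g A f` would vanish by nondegeneracy, and every `w` would equal `T(f
  -- w) f + T(g w) g`.
  obtain ⟨w, hw⟩ : ∃ w, f * w * g ≠ 0 := by
    by_contra! h
    have h' : ∀ w, g * w * f = 0 := fun w => D.nondegenerate _ fun z => by
      rw [mul_assoc, mul_assoc, D.T_mul_comm, mul_assoc, h, mul_zero, map_zero]
    obtain ⟨w, hw0, hw1, hw2⟩ := D.exists_ne_zero_T_eq_zero ha f g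
    apply hw0
    calc w = (f + g) * w * (f + g) := by rw [hfg, one_mul, mul_one]
      _ = f * w * f + f * w * g + (g * w * f + g * w * g) := by
        rw [add_mul, add_mul, mul_add, mul_add]
      _ = 0 := by rw [hN0 f hNf, hN0 g hNg, h, h', hw1, hw2]; simp
  obtain ⟨w', hw'⟩ := D.exists_T_eq_one hw
  refine ⟨⟨f, g, f * w * g, g * w' * f, hfg, ?_, ?_, ?_, ?_, ?_, ?_, hfg0, hgf0, hN0 f hNf,
    hN0 g hNg, hN0 _ ?_, hN0 _ ?_, hTf, hTg⟩⟩
  · have h1 : f * w * g * (g * w' * f) = f * (w * g * w') * f := by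
      rw [show f * w * g * (g * w' * f) = f * w * (g * g) * w' * f by simp only [mul_assoc], hgg]
      simp only [mul_assoc]
    have h2 : f * (w * g * w') = f * w * g * w' := by simp only [mul_assoc]
    rw [h1, hN0 f hNf, h2, hw', one_smul]
  · have h1 : g * w' * f * (f * w * g) = g * (w' * f * w) * g := by
      rw [show g * w' * f * (f * w * g) = g * w' * (f * f) * w * g by simp only [mul_assoc], hff]
      simp only [mul_assoc]
    have h2 : g * (w' * f * w) = g * w' * (f * w) := by simp only [mul_assoc]
    rw [h1, hN0 g hNg, h2, D.T_mul_comm, ← mul_assoc, hw', one_smul]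
  · rw [← mul_assoc, ← mul_assoc, hff]
  · rw [mul_assoc, hgg]
  · rw [mul_assoc, hff]
  · rw [← mul_assoc, ← mul_assoc, hgg]
  · rw [D.N_mul, hNg, mul_zero]
  · rw [D.N_mul, hNf, mul_zero]

namespace MatrixUnits

variable {D} (U : MatrixUnits D)

/-- Writing `f = u v` and `g = v u` exposes `v x v`, which is a multiple of `v`. -/
theorem f_mul_g_mul (x : A) : U.f * x * U.g = D.T (U.v * x) • U.u := by
  calc U.f * x * U.g = U.u * (U.v * x * U.v) * U.u := by
        rw [← U.u_mul_v, ← U.v_mul_u]; simp only [mul_assoc]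
    _ = D.T (U.v * x) • U.u := by
        rw [U.v_mul_mul, mul_smul_comm, smul_mul_assoc, U.u_mul_v, U.f_mul_u]

theorem g_mul_f_mul (x : A) : U.g * x * U.f = D.T (U.u * x) • U.v := by
  calc U.g * x * U.f = U.v * (U.u * x * U.u) * U.v := by
        rw [← U.u_mul_v, ← U.v_mul_u]; simp only [mul_assoc]
    _ = D.T (U.u * x) • U.v := by
        rw [U.u_mul_mul, mul_smul_comm, smul_mul_assoc, U.v_mul_u, U.g_mul_v]

theorem decompose (x : A) : x = D.T (U.f * x) • U.f + D.T (U.v * x) • U.u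
    + (D.T (U.u * x) • U.v + D.T (U.g * x) • U.g) := by
  rw [← U.f_mul_mul, ← U.f_mul_g_mul, ← U.g_mul_f_mul, ← U.g_mul_mul, ← mul_add, ← mul_add,
    ← add_mul, ← add_mul, U.f_add_g, one_mul, mul_one]

theorem T_u : D.T U.u = 0 := by
  rw [← U.f_mul_u, D.T_mul_comm, ← U.u_mul_g, mul_assoc, U.g_mul_f, mul_zero, map_zero]

theorem T_v : D.T U.v = 0 := by
  rw [← U.g_mul_v, D.T_mul_comm, ← U.v_mul_f, mul_assoc, U.f_mul_g, mul_zero, map_zero]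

/-- The matrix of an element. -/
def mat (x : A) : Matrix (Fin 2) (Fin 2) K :=
  !![D.T (U.f * x), D.T (U.v * x); D.T (U.u * x), D.T (U.g * x)]

/-- Splitting `z x y` along `f + g = 1`. -/
theorem T_split (z x y : A) :
    D.T (z * (x * y)) = D.T (z * x * U.f * y) + D.T (z * x * U.g * y) := by
  rw [← map_add, ← add_mul, ← mul_add, U.f_add_g, mul_one, mul_assoc]

/-- The isomorphism with the matrix algebra given by matrix units. -/
def toMatrix : A →+* Matrix (Fin 2) (Fin 2) K where
  toFun := U.mat
  map_one' := by
    simp only [mat, mul_one, U.T_f, U.T_g, U.T_u, U.T_v]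
    exact Matrix.one_fin_two.symm
  map_zero' := by
    ext i j; fin_cases i <;> fin_cases j <;> simp [mat]
  map_add' x y := by
    ext i j; fin_cases i <;> fin_cases j <;> simp [mat, mul_add]
  map_mul' x y := by
    rw [mat, mat, mat, Matrix.mul_fin_two, T_split U U.f, T_split U U.v, T_split U U.u,
      T_split U U.g]
    have e1 : U.v * x * U.f = D.T (U.f * x) • U.v := by
      calc U.v * x * U.f = U.v * (U.f * x * U.f) := by
            nth_rewrite 1 [← U.v_mul_f]; simp only [mul_assoc]
        _ = _ := by rw [U.f_mul_mul, mul_smul_comm, U.v_mul_f]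
    have e2 : U.v * x * U.g = D.T (U.v * x) • U.g := by
      calc U.v * x * U.g = U.v * (U.f * x * U.g) := by
            nth_rewrite 1 [← U.v_mul_f]; simp only [mul_assoc]
        _ = _ := by rw [U.f_mul_g_mul, mul_smul_comm, U.v_mul_u]
    have e3 : U.u * x * U.f = D.T (U.u * x) • U.f := by
      calc U.u * x * U.f = U.u * (U.g * x * U.f) := by
            nth_rewrite 1 [← U.u_mul_g]; simp only [mul_assoc]
        _ = _ := by rw [U.g_mul_f_mul, mul_smul_comm, U.u_mul_v]
    have e4 : U.u * x * U.g = D.T (U.g * x) • U.u := by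
      calc U.u * x * U.g = U.u * (U.g * x * U.g) := by
            nth_rewrite 1 [← U.u_mul_g]; simp only [mul_assoc]
        _ = _ := by rw [U.g_mul_mul, mul_smul_comm, U.u_mul_g]
    rw [U.f_mul_mul, U.f_mul_g_mul, U.g_mul_mul, U.g_mul_f_mul, e1, e2, e3, e4]
    simp only [smul_mul_assoc, map_smul, smul_eq_mul]

theorem toMatrix_apply (x : A) : U.toMatrix x = U.mat x := rfl

theorem toMatrix_injective : Function.Injective U.toMatrix := by
  rw [injective_iff_map_eq_zero]
  intro x hx
  rw [toMatrix_apply, mat] at hx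
  have h00 := congrFun (congrFun hx 0) 0
  have h01 := congrFun (congrFun hx 0) 1
  have h10 := congrFun (congrFun hx 1) 0
  have h11 := congrFun (congrFun hx 1) 1
  simp at h00 h01 h10 h11
  rw [U.decompose x, h00, h01, h10, h11]
  simp

theorem toMatrix_surjective : Function.Surjective U.toMatrix := by
  intro X
  have h1 : U.v * U.v = 0 := by
    calc U.v * U.v = U.v * U.f * (U.g * U.v) := by rw [U.v_mul_f, U.g_mul_v]
      _ = U.v * (U.f * U.g) * U.v := by simp only [mul_assoc]
      _ = 0 := by rw [U.f_mul_g, mul_zero, zero_mul]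
  have h2 : U.u * U.u = 0 := by
    calc U.u * U.u = U.u * U.g * (U.f * U.u) := by rw [U.u_mul_g, U.f_mul_u]
      _ = U.u * (U.g * U.f) * U.u := by simp only [mul_assoc]
      _ = 0 := by rw [U.g_mul_f, mul_zero, zero_mul]
  have h3 : U.f * U.f = U.f := by
    have := U.f_mul_mul 1
    rwa [mul_one, U.T_f, one_smul] at this
  have h4 : U.g * U.g = U.g := by
    have := U.g_mul_mul 1
    rwa [mul_one, U.T_g, one_smul] at this
  have h5 : U.f * U.v = 0 := by rw [← U.g_mul_v, ← mul_assoc, U.f_mul_g, zero_mul]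
  have h6 : U.g * U.u = 0 := by rw [← U.f_mul_u, ← mul_assoc, U.g_mul_f, zero_mul]
  have h7 : U.v * U.g = 0 := by rw [← U.v_mul_f, mul_assoc, U.f_mul_g, mul_zero]
  have h8 : U.u * U.f = 0 := by rw [← U.u_mul_g, mul_assoc, U.g_mul_f, mul_zero]
  refine ⟨X 0 0 • U.f + X 0 1 • U.u + X 1 0 • U.v + X 1 1 • U.g, ?_⟩
  rw [toMatrix_apply, mat]
  simp only [mul_add, mul_smul_comm, h1, h2, h3, h4, h5, h6, h7, h8, U.f_mul_u, U.f_mul_g,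
    U.v_mul_f, U.v_mul_u, U.u_mul_v, U.u_mul_g, U.g_mul_v, U.g_mul_f, map_add, map_smul, U.T_f,
    U.T_g, U.T_u, U.T_v]
  ext i j; fin_cases i <;> fin_cases j <;> simp

/-- The quadratic equation of `x` becomes the Cayley–Hamilton equation of its matrix; comparing one
entry identifies the constant terms. -/
theorem det_toMatrix (x : A) : (U.toMatrix x).det = D.N x := by
  have h1 : D.T (U.f * x) + D.T (U.g * x) = D.T x := by
    rw [← map_add, ← add_mul, U.f_add_g, one_mul]
  have h2 := congrArg U.toMatrix (D.mul_self x)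
  have hsmul : ∀ (c : K) (z : A), U.toMatrix (c • z) = c • U.toMatrix z := by
    intro c z
    ext i j; fin_cases i <;> fin_cases j <;> simp [toMatrix_apply, mat]
  rw [map_mul, map_sub, hsmul, hsmul, map_one, ← h1] at h2
  have h3 := congrFun (congrFun h2 0) 0
  rw [Matrix.mul_apply] at h3
  rw [Matrix.det_fin_two]
  simp [toMatrix_apply, mat] at h3 ⊢
  linear_combination -h3

end MatrixUnits

end TraceNorm

/-! ### The discriminant of an order -/

section Disc

variable {O : Subring ℍ[ℚ,α,β]} [IsOrder O]

theorem polar_normForm_order (x y : ℍ[ℚ,α,β]) :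
    QuadraticMap.polar (normForm (toLat O)) x y = trd (x * star y) := by
  simp only [QuadraticMap.polar, normForm, latticeNorm_order, div_one, nrd_add]
  ring

/-- The Gram determinant of the trace form is a square. -/
theorem isSquare_det_trd {ι : Type*} [Fintype ι] [DecidableEq ι] (e : ι ≃ Fin 4)
    (b : ι → ℍ[ℚ,α,β]) : IsSquare (Matrix.det (Matrix.of fun i j => trd (b i * star (b j)))) := by
  let P : Matrix (Fin 4) (Fin 4) ℚ := Matrix.of fun i =>
    ![(b (e.symm i)).re, (b (e.symm i)).imI, (b (e.symm i)).imJ, (b (e.symm i)).imK]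
  let D : Matrix (Fin 4) (Fin 4) ℚ := Matrix.diagonal ![2, -2 * α, -2 * β, 2 * α * β]
  -- In the standard basis the trace form is diagonal, of determinant `(4αβ)²`; a change of basis
  -- multiplies this by a square.
  have h : (Matrix.of fun i j => trd (b i * star (b j))).submatrix e.symm e.symm
      = P * D * P.transpose := by
    ext i j
    simp [P, D, Matrix.mul_apply, Fin.sum_univ_four, trd_eq, Matrix.diagonal_apply]
    ring
  rw [← Matrix.det_submatrix_equiv_self e.symm, h, Matrix.det_mul, Matrix.det_mul,
    Matrix.det_transpose, Matrix.det_diagonal, Fin.prod_univ_four]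
  exact ⟨4 * α * β * P.det, by simp; ring⟩

/-- At primes not dividing the discriminant the trace form is nondegenerate. -/
theorem trace_nondegenerate {p : ℕ} [hp : Fact p.Prime] (hd : ¬ p ∣ disc (toLat O))
    {x : ℍ[ℚ,α,β]} (hx : x ∈ O) (h : ∀ y ∈ O, ∃ k : ℤ, trd (x * y) = p * k) :
    ∃ z ∈ O, x = (p : ℤ) • z := by
  classical
  let e := Module.Free.chooseBasis ℤ (toLat O)
  let ι := Module.Free.ChooseBasisIndex ℤ (toLat O)
  have heO : ∀ i, (e i : ℍ[ℚ,α,β]) ∈ O := fun i => (e i).2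
  have hc : Fintype.card ι = 4 := by
    rw [← Module.finrank_eq_card_basis (e.extendOfIsLattice ℚ), QuaternionAlgebra.finrank_eq_four]
  choose G hG using fun i j => trd_int (O := O) (O.mul_mem (heO i) (star_mem_order (heO j)))
  have hgram : gramDet (toLat O) = ((Matrix.of G).det : ℤ) := by
    rw [gramDet, Int.cast_det]
    congr 1
    ext i j
    rw [Matrix.of_apply, polar_normForm_order, Matrix.map_apply, Matrix.of_apply]
    exact hG i j
  -- The determinant being a perfect square, `Nat.sqrt` in `disc` is exact, and `p ∤ disc` gives
  -- that `p` does not divide the Gram determinant.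
  have hsq : IsSquare ((Matrix.of G).det) := by
    rw [← Rat.isSquare_intCast_iff, ← hgram]
    have := isSquare_det_trd (Fintype.equivFinOfCardEq hc) (fun i => (e i : ℍ[ℚ,α,β]))
    convert this using 2
    rw [gramDet]
    congr 1
    ext i j
    exact polar_normForm_order _ _
  have hdet : ¬ (p : ℤ) ∣ (Matrix.of G).det := by
    obtain ⟨d, hd'⟩ := hsq
    intro hdvd
    apply hd
    rw [disc, hgram, Rat.num_intCast, hd', Int.natAbs_mul, Nat.sqrt_eq]
    rw [hd'] at hdvd
    rw [← Int.natCast_dvd]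
    exact ((Nat.prime_iff_prime_int.1 hp.out).dvd_or_dvd hdvd).elim id id
  let n : ι → ℤ := fun i => e.repr ⟨x, hx⟩ i
  have hxn : x = ∑ i, n i • (e i : ℍ[ℚ,α,β]) := by
    have := congrArg (toLat O).subtype (e.sum_repr ⟨x, hx⟩)
    rw [map_sum] at this
    simp only [map_smul, Submodule.subtype_apply] at this
    exact this.symm
  -- Testing the hypothesis on the conjugates of the basis vectors shows that the coordinates of `x`
  -- modulo `p` lie in the kernel of the invertible Gram matrix.
  have hv : Matrix.vecMul (fun i => (n i : ZMod p)) ((Matrix.of G).map (Int.castRingHom (ZMod p)))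
      = 0 := by
    funext j
    obtain ⟨k, hk⟩ := h _ (star_mem_order (O := O) (heO j))
    have h1 : (∑ i, n i * G i j : ℤ) = p * k := by
      have : ((∑ i, n i * G i j : ℤ) : ℚ) = p * k := by
        rw [← hk, hxn, Finset.sum_mul]
        have hsum : ∀ (s : Finset ι) (F : ι → ℍ[ℚ,α,β]), trd (∑ i ∈ s, F i) = ∑ i ∈ s, trd (F i) := by
          intro s F
          induction s using Finset.induction_on with
          | empty => simp [trd_eq]
          | insert a s ha ih => rw [Finset.sum_insert ha, Finset.sum_insert ha, trd_add, ih]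
        rw [hsum]
        push_cast
        refine Finset.sum_congr rfl fun i _ => ?_
        rw [smul_mul_assoc, trd_zsmul, hG]
      exact_mod_cast this
    have h2 := congrArg (Int.cast : ℤ → ZMod p) h1
    push_cast at h2
    rw [CharP.cast_eq_zero, zero_mul] at h2
    simpa [Matrix.vecMul, dotProduct] using h2
  have hn0 := Matrix.eq_zero_of_vecMul_eq_zero (by
    rw [← RingHom.mapMatrix_apply, ← RingHom.map_det, eq_intCast, Ne,
      ZMod.intCast_zmod_eq_zero_iff_dvd]
    exact hdet) hv
  have hdvd : ∀ i, (p : ℤ) ∣ n i := fun i =>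
    (ZMod.intCast_zmod_eq_zero_iff_dvd _ _).1 (congrFun hn0 i)
  choose m hm using hdvd
  refine ⟨∑ i, m i • (e i : ℍ[ℚ,α,β]), (toLat O).sum_mem fun i _ => (toLat O).smul_mem _ (heO i), ?_⟩
  rw [hxn, Finset.smul_sum]
  refine Finset.sum_congr rfl fun i _ => ?_
  rw [smul_smul, ← hm]

/-! ### Reduction modulo a prime not dividing the discriminant -/

/-- The integral norm on an order. -/
def normInt (x : O) : ℤ := (nrd (x : ℍ[ℚ,α,β])).num

/-- The integral trace on an order. -/
def traceInt (x : O) : ℤ := (trd (x : ℍ[ℚ,α,β])).num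

theorem coe_normInt (x : O) : (normInt x : ℚ) = nrd (x : ℍ[ℚ,α,β]) := by
  obtain ⟨n, hn⟩ := nrd_int x.2
  rw [normInt, hn, Rat.num_intCast]

theorem coe_traceInt (x : O) : (traceInt x : ℚ) = trd (x : ℍ[ℚ,α,β]) := by
  obtain ⟨n, hn⟩ := trd_int x.2
  rw [traceInt, hn, Rat.num_intCast]

theorem coe_star_eq (x : O) : star (x : ℍ[ℚ,α,β]) = (((traceInt x : ℤ) - x : O) : ℍ[ℚ,α,β]) := by
  rw [star_eq_trd_sub, ← coe_traceInt, map_intCast]; rfl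

theorem traceInt_add (x y : O) : traceInt (x + y) = traceInt x + traceInt y := by
  have : ((traceInt (x + y) : ℤ) : ℚ) = traceInt x + traceInt y := by
    rw [coe_traceInt, coe_traceInt, coe_traceInt, ← trd_add]; rfl
  exact_mod_cast this

theorem traceInt_zsmul (n : ℤ) (x : O) : traceInt (n • x) = n * traceInt x := by
  have : ((traceInt (n • x) : ℤ) : ℚ) = n * traceInt x := by
    rw [coe_traceInt, coe_traceInt, ← trd_zsmul]; rfl
  exact_mod_cast this

theorem traceInt_mul_comm (x y : O) : traceInt (x * y) = traceInt (y * x) := by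
  have : ((traceInt (x * y) : ℤ) : ℚ) = traceInt (y * x) := by
    rw [coe_traceInt, coe_traceInt]; exact trd_mul_comm _ _
  exact_mod_cast this

theorem traceInt_one : traceInt (1 : O) = 2 := by
  have : ((traceInt (1 : O) : ℤ) : ℚ) = 2 := by
    rw [coe_traceInt]; simp [trd_eq]
  exact_mod_cast this

theorem normInt_one : normInt (1 : O) = 1 := by
  have : ((normInt (1 : O) : ℤ) : ℚ) = 1 := by
    rw [coe_normInt]; exact nrd_one
  exact_mod_cast this

theorem normInt_mul (x y : O) : normInt (x * y) = normInt x * normInt y := by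
  have : ((normInt (x * y) : ℤ) : ℚ) = normInt x * normInt y := by
    rw [coe_normInt, coe_normInt, coe_normInt]; exact nrd_mul _ _
  exact_mod_cast this

theorem normInt_zsmul (n : ℤ) (x : O) : normInt (n • x) = n ^ 2 * normInt x := by
  have : ((normInt (n • x) : ℤ) : ℚ) = n ^ 2 * normInt x := by
    rw [coe_normInt, coe_normInt]; exact nrd_zsmul _ _
  exact_mod_cast this

theorem normInt_add (x y : O) : normInt (x + y)
    = normInt x + normInt y + (traceInt x * traceInt y - traceInt (x * y)) := by
  have : ((normInt (x + y) : ℤ) : ℚ)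
      = normInt x + normInt y + (traceInt x * traceInt y - traceInt (x * y)) := by
    simp only [coe_normInt, coe_traceInt, Subring.coe_add, Subring.coe_mul]
    simp [nrd_eq, trd_eq]
    ring
  exact_mod_cast this

theorem order_mul_self (x : O) : x * x = traceInt x • x - normInt x • 1 := by
  refine Subtype.ext ?_
  have h : (x : ℍ[ℚ,α,β]) * x = trd (x : ℍ[ℚ,α,β]) • (x : ℍ[ℚ,α,β]) - nrd (x : ℍ[ℚ,α,β]) • 1 := by
    ext <;> simp [nrd_eq, trd_eq] <;> ring
  rw [← coe_normInt, ← coe_traceInt, Int.cast_smul_eq_zsmul, Int.cast_smul_eq_zsmul] at h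
  exact h

theorem order_mul_mul_self (x w : O) : x * w * x
    = traceInt (x * w) • x - normInt x • (traceInt w • 1 - w) := by
  refine Subtype.ext ?_
  have h := mul_mul_self_eq (x : ℍ[ℚ,α,β]) w
  rw [star_eq_trd_sub, Algebra.algebraMap_eq_smul_one, ← coe_normInt, ← coe_traceInt w,
    show trd ((x : ℍ[ℚ,α,β]) * (w : ℍ[ℚ,α,β])) = traceInt (x * w) from (coe_traceInt (x * w)).symm,
    Int.cast_smul_eq_zsmul, Int.cast_smul_eq_zsmul, Int.cast_smul_eq_zsmul] at h
  exact h

section Reduction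

variable {p : ℕ} [hp : Fact p.Prime]

theorem traceInt_congr {x y z : O} (h : x = y + (p : ℤ) • z) :
    (traceInt x : ZMod p) = traceInt y := by
  rw [h, traceInt_add, traceInt_zsmul]
  push_cast
  rw [CharP.cast_eq_zero, zero_mul, add_zero]

theorem normInt_congr {x y z : O} (h : x = y + (p : ℤ) • z) :
    (normInt x : ZMod p) = normInt y := by
  rw [h, normInt_add, normInt_zsmul, traceInt_zsmul, mul_smul_comm, traceInt_zsmul]
  push_cast
  rw [CharP.cast_eq_zero]
  ring

/-- Trace and norm on the reduction of an order modulo a prime not dividing the discriminant. -/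
theorem exists_traceNorm (hd : ¬ p ∣ disc (toLat O)) {A : Type*} [Ring A] [Algebra (ZMod p) A]
    (π : O →+* A) (hsurj : Function.Surjective π) (hπ : ∀ x, π x = 0 ↔ ∃ z : O, x = (p : ℤ) • z) :
    ∃ D : TraceNorm (ZMod p) A, ∀ x, D.N (π x) = normInt x := by
  -- Trace and norm are read off an arbitrary lift; modulo `p` the choice is immaterial.
  let s := Function.surjInv hsurj
  have hs : ∀ a, π (s a) = a := Function.surjInv_eq hsurj
  have hsπ : ∀ x, ∃ z, s (π x) = x + (p : ℤ) • z := by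
    intro x
    obtain ⟨z, hz⟩ := (hπ (s (π x) - x)).1 (by rw [map_sub, hs, sub_self])
    exact ⟨z, by rw [← hz]; abel⟩
  have hcast : ∀ (n : ℤ) (x : O), ((n : ℤ) : ZMod p) • π x = π (n • x) := fun n x => by
    rw [Int.cast_smul_eq_zsmul, map_zsmul]
  have hT : ∀ x, (traceInt (s (π x)) : ZMod p) = traceInt x := fun x =>
    traceInt_congr (hsπ x).choose_spec
  have hN : ∀ x, (normInt (s (π x)) : ZMod p) = normInt x := fun x =>
    normInt_congr (hsπ x).choose_spec
  let T : A →ₗ[ZMod p] ZMod p :=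
    { toFun := fun a => (traceInt (s a) : ZMod p)
      map_add' := fun a b => by
        obtain ⟨x, rfl⟩ := hsurj a
        obtain ⟨y, rfl⟩ := hsurj b
        rw [← map_add, hT, hT, hT, traceInt_add]; push_cast; rfl
      map_smul' := fun c a => by
        obtain ⟨x, rfl⟩ := hsurj a
        obtain ⟨n, rfl⟩ := ZMod.intCast_surjective c
        rw [hcast, hT, hT, traceInt_zsmul]; push_cast; rfl }
  have hT' : ∀ x, T (π x) = traceInt x := hT
  refine ⟨⟨T, fun a => (normInt (s a) : ZMod p), ?_, ?_, ?_, ?_, ?_, ?_, ?_, ?_, ?_⟩, hN⟩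
  · intro a
    obtain ⟨x, rfl⟩ := hsurj a
    rw [hT', hN, ← map_one π, hcast, hcast, ← map_mul, ← map_sub, ← order_mul_self]
  · intro a b
    obtain ⟨x, rfl⟩ := hsurj a
    obtain ⟨w, rfl⟩ := hsurj b
    rw [← map_mul, ← map_mul, hT', hT', hN, ← map_one π, hcast, hcast, ← map_sub, hcast, ← map_sub,
      ← order_mul_mul_self]
  · rw [← map_one π, hT', traceInt_one]; norm_num
  · rw [← map_one π, hN, normInt_one, Int.cast_one]
  · intro a b
    obtain ⟨x, rfl⟩ := hsurj a
    obtain ⟨y, rfl⟩ := hsurj b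
    rw [← map_mul, ← map_mul, hT', hT', traceInt_mul_comm]
  · intro a b
    obtain ⟨x, rfl⟩ := hsurj a
    obtain ⟨y, rfl⟩ := hsurj b
    rw [← map_mul, hN, hN, hN, normInt_mul, Int.cast_mul]
  · intro a b
    obtain ⟨x, rfl⟩ := hsurj a
    obtain ⟨y, rfl⟩ := hsurj b
    rw [← map_add π, ← map_mul π, hN, hN, hN, hT', hT', hT', normInt_add]
    push_cast; rfl
  · intro c a
    obtain ⟨x, rfl⟩ := hsurj a
    obtain ⟨n, rfl⟩ := ZMod.intCast_surjective c
    rw [hcast, hN, hN, normInt_zsmul]; push_cast; rfl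
  · intro a h
    obtain ⟨x, rfl⟩ := hsurj a
    rw [hπ]
    obtain ⟨z, hz, hxz⟩ := trace_nondegenerate hd x.2 fun y hy => by
      have h1 := h (π ⟨y, hy⟩)
      rw [← map_mul, hT', ZMod.intCast_zmod_eq_zero_iff_dvd] at h1
      obtain ⟨k, hk⟩ := h1
      refine ⟨k, ?_⟩
      have h2 := coe_traceInt (x * ⟨y, hy⟩)
      rw [hk] at h2
      push_cast at h2
      exact h2.symm
    exact ⟨⟨z, hz⟩, Subtype.ext hxz⟩

/-- Modulo a prime not dividing its discriminant, an order is a matrix algebra. -/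
theorem exists_reduction (hd : ¬ p ∣ disc (toLat O)) :
    ∃ φ : O →+* Matrix (Fin 2) (Fin 2) (ZMod p), Function.Surjective φ ∧
      (∀ x, φ x = 0 ↔ ∃ z : O, x = (p : ℤ) • z) ∧ ∀ x, (φ x).det = normInt x := by
  let I : Ideal O := Ideal.span {(p : O)}
  have hI : ∀ x, x ∈ I ↔ ∃ z : O, x = (p : ℤ) • z := by
    intro x
    rw [Ideal.mem_span_singleton']
    refine exists_congr fun z => ?_
    rw [eq_comm, zsmul_eq_mul, Int.cast_natCast, Nat.cast_comm]
  have : I.IsTwoSided := ⟨fun {a} b ha => by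
    rw [hI] at ha ⊢
    obtain ⟨z, rfl⟩ := ha
    exact ⟨z * b, smul_mul_assoc _ _ _⟩⟩
  let π : O →+* O ⧸ I := Ideal.Quotient.mk I
  have hsurj : Function.Surjective π := Ideal.Quotient.mk_surjective
  have hπ : ∀ x, π x = 0 ↔ ∃ z : O, x = (p : ℤ) • z := fun x => by
    rw [← hI]; exact Ideal.Quotient.eq_zero_iff_mem
  have hp0 : ((p : ℕ) : O ⧸ I) = 0 := by
    rw [← map_natCast π, hπ]
    exact ⟨1, by simp⟩
  obtain ⟨b, hb⟩ := exists_basis (toLat O)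
  have hbO : ∀ i, b i ∈ O := fun i => by
    have : b i ∈ toLat O := hb ▸ Submodule.subset_span ⟨i, rfl⟩
    exact this
  -- A `ℤ`-basis of `O` stays independent modulo `p`. This gives both the nontriviality of the
  -- quotient and the four independent vectors needed for the matrix units.
  have hlift : ∀ n : Fin 4 → ℤ, π (∑ i, n i • ⟨b i, hbO i⟩) = 0 → ∀ i, (p : ℤ) ∣ n i := by
    intro n hn i
    obtain ⟨z, hz⟩ := (hπ _).1 hn
    have hzO : (z : ℍ[ℚ,α,β]) ∈ toLat O := z.2
    rw [hb, mem_span_basis] at hzO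
    obtain ⟨m, hm⟩ := hzO i
    have h1 : ∑ i, n i • b i = (p : ℤ) • (z : ℍ[ℚ,α,β]) := by
      have := congrArg O.subtype hz
      rw [map_sum, map_zsmul] at this
      simp only [map_zsmul] at this
      exact this
    have h2 := congrArg (fun y => b.repr y i) h1
    simp only [← Int.cast_smul_eq_zsmul ℚ, b.repr_sum_self, map_smul, Finsupp.smul_apply,
      smul_eq_mul, hm] at h2
    exact ⟨m, by exact_mod_cast h2⟩
  have hnt : Nontrivial (O ⧸ I) := by
    refine ⟨π ⟨b 0, hbO 0⟩, 0, fun h => ?_⟩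
    have := hlift (Pi.single 0 1) (by
      rw [Finset.sum_eq_single 0]
      · simpa using h
      · intro j _ hj; simp [hj]
      · simp) 0
    rw [Pi.single_eq_same] at this
    exact prime_not_dvd_one p this
  have : CharP (O ⧸ I) p := by
    obtain ⟨q, hq⟩ := CharP.exists (O ⧸ I)
    have h1 : q ∣ p := (CharP.cast_eq_zero_iff (O ⧸ I) q p).1 hp0
    rcases (Nat.dvd_prime hp.out).1 h1 with rfl | rfl
    · have h0 := CharP.cast_eq_zero (O ⧸ I) 1
      rw [Nat.cast_one] at h0
      exact absurd h0 one_ne_zero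
    · exact hq
  let _ : Algebra (ZMod p) (O ⧸ I) := ZMod.algebra _ p
  obtain ⟨D, hD⟩ := exists_traceNorm hd π hsurj hπ
  have hli : LinearIndependent (ZMod p) fun i => π ⟨b i, hbO i⟩ := by
    rw [Fintype.linearIndependent_iff]
    intro c hc i
    choose n hn using fun i => ZMod.intCast_surjective (c i)
    rw [← hn i, ZMod.intCast_zmod_eq_zero_iff_dvd]
    refine hlift n ?_ i
    rw [map_sum, ← hc]
    refine Finset.sum_congr rfl fun j _ => ?_
    rw [← hn j, Int.cast_smul_eq_zsmul, map_zsmul]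
  obtain ⟨U⟩ := D.exists_matrixUnits hli
  refine ⟨U.toMatrix.comp π, U.toMatrix_surjective.comp hsurj, fun x => ?_, fun x => ?_⟩
  · rw [← hπ, RingHom.comp_apply, map_eq_zero_iff _ U.toMatrix_injective]
  · rw [RingHom.comp_apply, U.det_toMatrix, hD]

end Reduction
end Disc

/-! ### Ideals of prime index -/

section Normalize

variable {p : ℕ} [hp : Fact p.Prime]

/-- The product of multipliers for finitely many generators serves all of `L`. -/
theorem exists_common_multiplier {L M : Submodule ℤ ℍ[ℚ,α,β]} (hL : L.FG) (h : L ≤ loc p M) :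
    ∃ s : ℤ, ¬ (p : ℤ) ∣ s ∧ ∀ z ∈ L, s • z ∈ M := by
  classical
  obtain ⟨S, rfl⟩ := hL
  choose! t ht htM using fun z (hz : z ∈ S) => h (Submodule.subset_span hz)
  refine ⟨∏ z ∈ S, t z, ?_, fun z hz => ?_⟩
  · rw [Prime.dvd_finsetProd_iff (Nat.prime_iff_prime_int.1 hp.out)]
    rintro ⟨z, hz, hd⟩
    exact ht z hz hd
  · induction hz using Submodule.span_induction with
    | mem z hz =>
      rw [← Finset.mul_prod_erase _ _ hz, mul_comm, mul_smul]
      exact M.smul_mem _ (htM z hz)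
    | zero => rw [smul_zero]; exact M.zero_mem
    | add x y _ _ hx hy => rw [smul_add]; exact M.add_mem hx hy
    | smul n x _ hx => rw [smul_comm]; exact M.smul_mem _ hx

/-- Every ideal class contains an ideal contained in the order, of index prime to `p`. -/
theorem exists_mul_le_order (hα : α < 0) (hβ : β < 0) {O : Subring ℍ[ℚ,α,β]} [hO : IsOrder O]
    (a : LeftIdeal O) : ∃ g : (ℍ[ℚ,α,β])ˣ, (a.mul g).1 ≤ toLat O ∧
      ∃ s : ℤ, ¬ (p : ℤ) ∣ s ∧ ∀ o ∈ O, s • o ∈ (a.mul g).1 := by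
  obtain ⟨x, hx⟩ := a.2.exists_isGen hα hβ p
  have hgen : loc p (a.mul x⁻¹).1 = loc p (toLat O) := by
    have h1 : IsGen p O (a.mul x⁻¹).1 (x * x⁻¹) := hx.mul_right x⁻¹
    rw [mul_inv_cancel] at h1
    exact h1.trans (mulRight_one _)
  obtain ⟨s, hs, hs'⟩ := exists_common_multiplier (p := p) (a.mul x⁻¹).fg
    ((le_loc _).trans hgen.le)
  obtain ⟨t, ht, ht'⟩ := exists_common_multiplier (p := p) hO.isLattice.fg
    ((le_loc _).trans hgen.ge)
  have hs0 : s ≠ 0 := fun h => hs (h ▸ dvd_zero _)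
  -- Multiplying by `x⁻¹` makes the ideal agree with `O` at `p`; scaling by `s`, prime to `p`, then
  -- moves it into `O` without disturbing this.
  refine ⟨x⁻¹ * intUnit s hs0, ?_, s * t, prime_not_dvd_mul p hs ht, fun o ho => ?_⟩
  · rw [← LeftIdeal.mul_mul]
    intro y hy
    obtain ⟨z, hz, rfl⟩ := mem_mulRight.1 hy
    rw [mul_intUnit]
    exact hs' z hz
  · rw [← LeftIdeal.mul_mul, mul_smul, ← mul_intUnit s hs0]
    exact mem_mulRight.2 ⟨_, ht' o ho, rfl⟩

end Normalize

/-! ### Lines in the plane over `ZMod p` -/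

section Lines

variable {p : ℕ} [hp : Fact p.Prime]

/-- Representatives of the lines in the plane over `ZMod p`. -/
def lineVec : Option (ZMod p) → Fin 2 → ZMod p
  | none => ![0, 1]
  | some t => ![1, t]

theorem lineVec_ne_zero (i : Option (ZMod p)) : lineVec i ≠ 0 := by
  intro h
  cases i with
  | none => simpa [lineVec] using congrFun h 1
  | some t => simpa [lineVec] using congrFun h 0

theorem exists_eq_smul_lineVec {v : Fin 2 → ZMod p} (hv : v ≠ 0) :
    ∃ (i : Option (ZMod p)) (c : ZMod p), c ≠ 0 ∧ v = c • lineVec i := by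
  by_cases h0 : v 0 = 0
  · refine ⟨none, v 1, fun h1 => hv ?_, ?_⟩
    · ext i; fin_cases i <;> simp [h0, h1]
    · ext i; fin_cases i <;> simp [h0, lineVec]
  · refine ⟨some ((v 0)⁻¹ * v 1), v 0, h0, ?_⟩
    ext i; fin_cases i <;> simp [lineVec, h0]

/-- Two distinct representatives are linearly independent, and by Cramer's rule a matrix killing
both is zero. -/
theorem lineVec_eq_of_mulVec_eq_zero {M : Matrix (Fin 2) (Fin 2) (ZMod p)} (hM : M ≠ 0)
    {i j : Option (ZMod p)} (hi : M.mulVec (lineVec i) = 0) (hj : M.mulVec (lineVec j) = 0) :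
    i = j := by
  have key : ∀ r : Fin 2, ∀ i : Option (ZMod p), M.mulVec (lineVec i) = 0 →
      M r 0 * lineVec i 0 + M r 1 * lineVec i 1 = 0 := fun r i h => by
    have := congrFun h r
    simpa [Matrix.mulVec, dotProduct, Fin.sum_univ_two] using this
  by_contra hne
  apply hM
  ext r c
  have h1 := key r i hi
  have h2 := key r j hj
  have hdet : lineVec i 0 * lineVec j 1 - lineVec i 1 * lineVec j 0 ≠ 0 := by
    cases i <;> cases j <;> simp_all [lineVec, sub_eq_zero]
    exact fun h => hne h.symm
  have e0 : M r 0 * (lineVec i 0 * lineVec j 1 - lineVec i 1 * lineVec j 0) = 0 := by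
    linear_combination lineVec j 1 * h1 - lineVec i 1 * h2
  have e1 : M r 1 * (lineVec i 0 * lineVec j 1 - lineVec i 1 * lineVec j 0) = 0 := by
    linear_combination lineVec i 0 * h2 - lineVec j 0 * h1
  fin_cases c
  · simpa [hdet] using e0
  · simpa [hdet] using e1

end Lines

section PrimeIndex

variable {p : ℕ} [hp : Fact p.Prime] {O : Subring ℍ[ℚ,α,β]}

/-- The elements of `L` whose reduction kills the vector `v`. -/
def lineSubmodule (φ : O →+* Matrix (Fin 2) (Fin 2) (ZMod p)) (L : Submodule ℤ ℍ[ℚ,α,β])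
    (v : Fin 2 → ZMod p) : Submodule ℤ ℍ[ℚ,α,β] where
  carrier := {z | z ∈ L ∧ ∃ h : z ∈ O, (φ ⟨z, h⟩).mulVec v = 0}
  add_mem' := by
    rintro x y ⟨hx, hxO, hx0⟩ ⟨hy, hyO, hy0⟩
    refine ⟨L.add_mem hx hy, O.add_mem hxO hyO, ?_⟩
    rw [show (⟨x + y, O.add_mem hxO hyO⟩ : O) = ⟨x, hxO⟩ + ⟨y, hyO⟩ from rfl, map_add,
      Matrix.add_mulVec, hx0, hy0, add_zero]
  zero_mem' := ⟨L.zero_mem, O.zero_mem, by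
    rw [show (⟨0, O.zero_mem⟩ : O) = 0 from rfl, map_zero, Matrix.zero_mulVec]⟩
  smul_mem' := by
    rintro n x ⟨hx, hxO, hx0⟩
    refine ⟨L.smul_mem n hx, O.zsmul_mem hxO n, ?_⟩
    rw [show (⟨n • x, O.zsmul_mem hxO n⟩ : O) = n • ⟨x, hxO⟩ from rfl, map_zsmul,
      Matrix.smul_mulVec, hx0, smul_zero]

variable {φ : O →+* Matrix (Fin 2) (Fin 2) (ZMod p)} {L : Submodule ℤ ℍ[ℚ,α,β]}
  {v : Fin 2 → ZMod p}

theorem mem_lineSubmodule {z : ℍ[ℚ,α,β]} :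
    z ∈ lineSubmodule φ L v ↔ z ∈ L ∧ ∃ h : z ∈ O, (φ ⟨z, h⟩).mulVec v = 0 := Iff.rfl

theorem lineSubmodule_le : lineSubmodule φ L v ≤ L := fun _ h => h.1

theorem lineSubmodule_smul {c : ZMod p} (hc : c ≠ 0) :
    lineSubmodule φ L (c • v) = lineSubmodule φ L v := by
  ext z
  simp only [mem_lineSubmodule, Matrix.mulVec_smul, smul_eq_zero, hc, false_or]

theorem map_zsmul_reduction (n : ℤ) (x : O) : φ (n • x) = (n : ZMod p) • φ x := by
  rw [map_zsmul, Int.cast_smul_eq_zsmul]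

variable {a : LeftIdeal O} {s : ℤ}

theorem loc_eq_order (ha : a.1 ≤ toLat O) (hs : ¬ (p : ℤ) ∣ s) (has : ∀ o ∈ O, s • o ∈ a.1) :
    loc p a.1 = loc p (toLat O) :=
  loc_eq_of_le_of_smul_le ha hs has

/-- Elements of trivial reduction are divisible by `p`. -/
theorem exists_eq_smul_of_reduction_eq_zero (hker : ∀ x, φ x = 0 ↔ ∃ z : O, x = (p : ℤ) • z)
    (hs : ¬ (p : ℤ) ∣ s) (has : ∀ o ∈ O, s • o ∈ a.1) {x : O} (hx : (x : ℍ[ℚ,α,β]) ∈ a.1)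
    (h : φ x = 0) : ∃ w ∈ a.1, (x : ℍ[ℚ,α,β]) = (p : ℤ) • w := by
  obtain ⟨z, rfl⟩ := (hker x).1 h
  have hcop : IsCoprime (p : ℤ) s :=
    (Nat.prime_iff_prime_int.1 hp.out).irreducible.coprime_iff_not_dvd.2 hs
  obtain ⟨m, n, hmn⟩ := hcop
  refine ⟨z, ?_, rfl⟩
  have h1 := a.1.add_mem (a.1.smul_mem m hx) (a.1.smul_mem n (has z z.2))
  have h2 : m • (((p : ℤ) • z : O) : ℍ[ℚ,α,β]) + n • s • (z : ℍ[ℚ,α,β]) = z := by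
    change m • (p : ℤ) • (z : ℍ[ℚ,α,β]) + n • s • (z : ℍ[ℚ,α,β]) = z
    rw [smul_smul, smul_smul, ← add_smul, hmn, one_smul]
  rwa [h2] at h1

variable [IsOrder O]

/-- The trace of the reduction. -/
theorem trace_reduction (hdet : ∀ x, (φ x).det = normInt x) (x : O) :
    (traceInt x : ZMod p) = (φ x).trace := by
  have h1 := congrArg (Int.cast : ℤ → ZMod p) (normInt_add 1 x)
  rw [normInt_one, traceInt_one, one_mul] at h1
  push_cast at h1
  rw [← hdet, ← hdet, map_add, map_one, Matrix.det_fin_two, Matrix.det_fin_two] at h1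
  simp at h1
  rw [Matrix.trace_fin_two]
  linear_combination -h1

/-- A singular reduction with given kernel lifts to an element of norm exactly divisible by `p`. -/
theorem exists_lift_line (hsurj : Function.Surjective φ) (hdet : ∀ x, (φ x).det = normInt x)
    (hv : v ≠ 0) : ∃ (y : O) (n : ℤ), φ y = !![v 1, -v 0; 0, 0] ∧ ¬ (p : ℤ) ∣ n ∧
      normInt y = p * n := by
  obtain ⟨y, hy⟩ := hsurj !![v 1, -v 0; 0, 0]
  -- A complementary row making the determinant `1`. If the first lift `y` has norm divisible by
  -- `p²`, then `y + p w` has norm `N(y) + p B + p² N(w)` with `B ≡ 1` modulo `p`, so `p` divides it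
  -- exactly once.
  obtain ⟨w₀, w₁, hw⟩ : ∃ w₀ w₁ : ZMod p, v 1 * w₁ + v 0 * w₀ = 1 := by
    by_cases h0 : v 0 = 0
    · have h1 : v 1 ≠ 0 := fun h1 => hv (by ext i; fin_cases i <;> simp [h0, h1])
      exact ⟨0, (v 1)⁻¹, by rw [mul_inv_cancel₀ h1]; ring⟩
    · exact ⟨(v 0)⁻¹, 0, by rw [mul_inv_cancel₀ h0]; ring⟩
  obtain ⟨w, hw'⟩ := hsurj !![0, 0; w₀, w₁]
  have hNy : (normInt y : ZMod p) = 0 := by rw [← hdet, hy]; simp [Matrix.det_fin_two]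
  have hNw : (normInt w : ZMod p) = 0 := by rw [← hdet, hw']; simp [Matrix.det_fin_two]
  have hNyw : (normInt (y + w) : ZMod p) = 1 := by
    rw [← hdet, map_add, hy, hw', ← hw]; simp [Matrix.det_fin_two]
  obtain ⟨n, hn⟩ := (ZMod.intCast_zmod_eq_zero_iff_dvd _ _).1 hNy
  by_cases hpn : (p : ℤ) ∣ n
  · set B := traceInt y * traceInt w - traceInt (y * w) with hB
    have hB1 : (B : ZMod p) = 1 := by
      have := congrArg (Int.cast : ℤ → ZMod p) (normInt_add y w)
      rw [hNyw, ← hB] at this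
      push_cast at this
      rw [hNy, hNw] at this
      linear_combination -this
    have hBn : ¬ (p : ℤ) ∣ B := by
      rw [← ZMod.intCast_zmod_eq_zero_iff_dvd, hB1]; exact one_ne_zero
    refine ⟨y + (p : ℤ) • w, n + B + p * normInt w, ?_, ?_, ?_⟩
    · rw [map_add, map_zsmul_reduction, hy]; simp
    · intro h
      apply hBn
      have := (dvd_sub (dvd_sub h hpn) (dvd_mul_right (p : ℤ) (normInt w)))
      rwa [show n + B + p * normInt w - n - p * normInt w = B by ring] at this
    · rw [normInt_add, normInt_zsmul, traceInt_zsmul, mul_smul_comm, traceInt_zsmul, hn]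
      ring
  · exact ⟨y, n, hy, hpn, hn⟩

theorem padicNorm_latticeNorm_eq_one (ha : a.1 ≤ toLat O) (hs : ¬ (p : ℤ) ∣ s)
    (has : ∀ o ∈ O, s • o ∈ a.1) : padicNorm p (latticeNorm a.1) = 1 := by
  have hgen : IsGen p O a.1 1 := (loc_eq_order ha hs has).trans (mulRight_one _).symm
  rw [hgen.padicNorm_latticeNorm a.fg, Units.val_one, nrd_one, padicNorm.one]

/-- The sublattice attached to a line is a left ideal of index norm `p`. -/
theorem exists_lineIdeal (hα : α < 0) (hβ : β < 0) (hsurj : Function.Surjective φ)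
    (hker : ∀ x, φ x = 0 ↔ ∃ z : O, x = (p : ℤ) • z) (hdet : ∀ x, (φ x).det = normInt x)
    (ha : a.1 ≤ toLat O) (hs : ¬ (p : ℤ) ∣ s) (has : ∀ o ∈ O, s • o ∈ a.1) (hv : v ≠ 0) :
    ∃ b ∈ heckeSet p a, b.1 = lineSubmodule φ a.1 v := by
  obtain ⟨y, n, hy, hpn, hny⟩ := exists_lift_line hsurj hdet hv
  set B := lineSubmodule φ a.1 v with hB
  have hp0 : (p : ℤ) ≠ 0 := by exact_mod_cast hp.out.ne_zero
  have hn0 : n ≠ 0 := fun h => hpn (h ▸ dvd_zero _)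
  have hpB : ∀ z ∈ a.1, (p : ℤ) • z ∈ B := fun z hz =>
    ⟨a.1.smul_mem _ hz, O.zsmul_mem (ha hz) _, by
      rw [show (⟨(p : ℤ) • z, O.zsmul_mem (ha hz) _⟩ : O) = (p : ℤ) • ⟨z, ha hz⟩ from rfl,
        (hker _).2 ⟨_, rfl⟩, Matrix.zero_mulVec]⟩
  have hBa : B ≤ a.1 := lineSubmodule_le
  have hBL : B.IsLattice ℚ := by
    have := (a.mul (intUnit p hp0)).2.isLattice
    refine Submodule.IsLattice.of_le_of_isLattice_of_fg ℚ
      (M := (a.mul (intUnit p hp0)).1) ?_ ?_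
    · intro y hy
      obtain ⟨z, hz, rfl⟩ := mem_mulRight.1 hy
      rw [mul_intUnit]
      exact hpB z hz
    · have := a.2.isLattice
      have : IsNoetherian ℤ a.1 := inferInstance
      have : IsNoetherian ℤ B := isNoetherian_of_le hBa
      exact Module.Finite.iff_fg.1 inferInstance
  have hN : nrd (y : ℍ[ℚ,α,β]) = p * n := by
    rw [← coe_normInt, hny]; push_cast; rfl
  have hy0 : (y : ℍ[ℚ,α,β]) ≠ 0 := by
    intro h0
    rw [h0, nrd_zero] at hN
    have : (p : ℤ) * n = 0 := by exact_mod_cast hN.symm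
    exact mul_ne_zero hp0 hn0 this
  obtain ⟨u, hu⟩ := exists_unit hα hβ hy0
  have hloc : ∀ (q : ℕ) [Fact q.Prime], q ≠ p → loc q B = loc q a.1 := fun q hq hqp =>
    loc_eq_of_le_of_smul_le hBa (fun h => hqp
      ((Nat.prime_dvd_prime_iff_eq hq.out hp.out).1 (Int.natCast_dvd_natCast.1 h))) hpB
  -- The lift `y` generates `B` at `p`. Its conjugate reduces to the adjugate matrix, whose columns
  -- are multiples of `v`; so for `z ∈ B` the product `z ȳ` reduces to zero, equals `p o`, and `z
  -- y⁻¹ = o / n` with `n` prime to `p`.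
  have hgen : IsGen p O B u := by
    ext z
    rw [mem_mulRight_unit]
    constructor
    · rintro ⟨t, ht, hzB⟩
      obtain ⟨-, hzO, hz0⟩ := hzB
      have hstar : φ (⟨t • z, hzO⟩ * ((traceInt y : O) - y)) = 0 := by
        rw [map_mul, map_sub, map_intCast, show ((traceInt y : ℤ) : Matrix (Fin 2) (Fin 2) (ZMod p))
          = (traceInt y : ZMod p) • 1 by rw [Int.cast_smul_eq_zsmul, zsmul_one],
          trace_reduction hdet, hy]
        generalize φ ⟨t • z, hzO⟩ = Z at hz0
        have h0 := congrFun hz0 0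
        have h1 := congrFun hz0 1
        simp [Matrix.mulVec, dotProduct, Fin.sum_univ_two] at h0 h1
        ext i j
        fin_cases i <;> fin_cases j <;>
          simp [Matrix.mul_apply, Fin.sum_univ_two, Matrix.trace_fin_two, h0, h1]
      obtain ⟨o, ho⟩ := (hker _).1 hstar
      have ho' : t • z * star (y : ℍ[ℚ,α,β]) = (p : ℤ) • (o : ℍ[ℚ,α,β]) := by
        rw [coe_star_eq]
        exact congrArg Subtype.val ho
      refine ⟨n * t, prime_not_dvd_mul p hpn ht, ?_⟩
      have key : (n * t) • (z * ((u⁻¹ : (ℍ[ℚ,α,β])ˣ) : ℍ[ℚ,α,β])) = o := by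
        have hpq : (p : ℚ) ≠ 0 := by exact_mod_cast hp0
        have hnq : (n : ℚ) ≠ 0 := by exact_mod_cast hn0
        rw [unit_inv_eq, hu, mul_smul, ← smul_mul_assoc, mul_smul_comm, ho', hN,
          ← Int.cast_smul_eq_zsmul ℚ, ← Int.cast_smul_eq_zsmul ℚ, smul_smul, smul_smul]
        have : (n : ℚ) * ((p * n : ℚ)⁻¹ * ((p : ℤ) : ℚ)) = 1 := by
          push_cast; field_simp
        rw [← mul_assoc] at this
        rw [this, one_smul]
      rw [key]
      exact o.2
    · rintro ⟨t, ht, ho⟩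
      have hz : t • z = (t • (z * ((u⁻¹ : (ℍ[ℚ,α,β])ˣ) : ℍ[ℚ,α,β]))) * y := by
        rw [smul_mul_assoc, mul_assoc, ← hu, Units.inv_mul, mul_one]
      set o := t • (z * ((u⁻¹ : (ℍ[ℚ,α,β])ˣ) : ℍ[ℚ,α,β])) with ho_def
      have hoO : o ∈ O := ho
      -- The extra factor `s` brings `o y` from `O` into `a`.
      refine ⟨s * t, prime_not_dvd_mul p hs ht, ?_⟩
      have e : (s * t) • z = s • (o * y) := by rw [mul_smul, hz]
      rw [e]
      have hoyO := O.mul_mem hoO y.2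
      refine ⟨has _ hoyO, O.zsmul_mem hoyO s, ?_⟩
      rw [show (⟨s • (o * y), O.zsmul_mem hoyO s⟩ : O) = s • (⟨o, hoO⟩ * y) from rfl,
        map_zsmul, map_mul, hy, Matrix.smul_mulVec, ← Matrix.mulVec_mulVec]
      have : (!![v 1, -v 0; 0, 0] : Matrix (Fin 2) (Fin 2) (ZMod p)).mulVec v = 0 := by
        ext i
        fin_cases i <;> simp [Matrix.mulVec, dotProduct, Fin.sum_univ_two]
        ring
      rw [this, Matrix.mulVec_zero, smul_zero]
  have hBI : IsLeftIdeal O B := isLeftIdeal_of_isGen hBL fun q _ => by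
    by_cases hqp : q = p
    · subst hqp
      exact ⟨u, hgen⟩
    · obtain ⟨x, hx⟩ := a.2.exists_isGen hα hβ q
      exact ⟨x, hx.congr (hloc q hqp)⟩
  refine ⟨⟨B, hBI⟩, ⟨hBa, ?_⟩, rfl⟩
  have hppos : (0 : ℚ) < p := by exact_mod_cast hp.out.pos
  refine eq_of_padicNorm_eq (latticeNorm_pos hα hβ B) (mul_pos hppos (a.norm_pos hα hβ))
    fun q hq => ?_
  by_cases hqp : q = p
  · subst hqp
    have hn1 : padicNorm q n = 1 := padicNorm_int_eq_one hpn
    rw [hgen.padicNorm_latticeNorm hBL.fg, hu, hN, padicNorm.mul, padicNorm.mul, hn1,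
      padicNorm_latticeNorm_eq_one ha hs has]
  · obtain ⟨x, hx⟩ := a.2.exists_isGen hα hβ q
    rw [padicNorm.mul, hx.padicNorm_latticeNorm a.fg,
      (hx.congr (hloc q hqp)).padicNorm_latticeNorm hBL.fg, padicNorm.padicNorm_of_prime_of_ne hqp,
      one_mul]

/-- A proper ideal at `p` is contained in the ideal of some line. -/
theorem exists_le_lineSubmodule (hα : α < 0) (hβ : β < 0) (hdet : ∀ x, (φ x).det = normInt x)
    (ha : a.1 ≤ toLat O) {c : LeftIdeal O} (hca : c.1 ≤ a.1)
    (hc : padicNorm p (latticeNorm c.1) < 1) :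
    ∃ i, c.1 ≤ lineSubmodule φ a.1 (lineVec i) := by
  obtain ⟨x, hx⟩ := c.2.exists_isGen hα hβ p
  obtain ⟨t, ht, htx⟩ := hx.self_mem
  have hyO : t • (x : ℍ[ℚ,α,β]) ∈ O := ha (hca htx)
  set y : O := ⟨t • (x : ℍ[ℚ,α,β]), hyO⟩ with hy
  have hN : padicNorm p (normInt y) < 1 := by
    rw [coe_normInt, hy, nrd_zsmul, padicNorm.mul, sq, padicNorm.mul, padicNorm_int_eq_one ht,
      one_mul, one_mul, ← hx.padicNorm_latticeNorm c.fg]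
    exact hc
  -- Up to integers prime to `p`, every element of `c` is a left multiple of `y`; hence a vector
  -- killed by the singular matrix `φ y` is killed by the reductions of all of `c`.
  have hdet0 : (φ y).det = 0 := by
    rw [hdet, ZMod.intCast_zmod_eq_zero_iff_dvd]
    exact (padicNorm.int_lt_one_iff _).1 hN
  obtain ⟨v, hv, hyv⟩ := Matrix.exists_mulVec_eq_zero_iff.2 hdet0
  obtain ⟨i, k, hk, rfl⟩ := exists_eq_smul_lineVec hv
  refine ⟨i, ?_⟩
  rw [← lineSubmodule_smul hk]
  intro z hz
  obtain ⟨r, hr, ho⟩ := hx.mem_iff.1 (le_loc _ hz)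
  set o : O := ⟨r • (z * ((x⁻¹ : (ℍ[ℚ,α,β])ˣ) : ℍ[ℚ,α,β])), ho⟩ with ho_def
  have hzO : z ∈ O := ha (hca hz)
  have e : (t * r) • (⟨z, hzO⟩ : O) = o * y := by
    refine Subtype.ext ?_
    change (t * r) • z = r • (z * ((x⁻¹ : (ℍ[ℚ,α,β])ˣ) : ℍ[ℚ,α,β])) * t • (x : ℍ[ℚ,α,β])
    rw [smul_mul_smul_comm, mul_assoc, Units.inv_mul, mul_one, mul_comm]
  have h1 := congrArg φ e
  rw [map_zsmul_reduction, map_mul] at h1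
  have h2 := congrArg (fun M => M.mulVec (k • lineVec i)) h1
  simp only [Matrix.smul_mulVec, ← Matrix.mulVec_mulVec, hyv, Matrix.mulVec_zero] at h2
  have htr : ((t * r : ℤ) : ZMod p) ≠ 0 := by
    rw [Ne, ZMod.intCast_zmod_eq_zero_iff_dvd]
    exact prime_not_dvd_mul p ht hr
  exact ⟨hca hz, hzO, (smul_eq_zero.1 h2).resolve_left htr⟩

end PrimeIndex

/-! ### Powers of a prime not dividing the discriminant -/

section PrimePower

variable {p : ℕ} [hp : Fact p.Prime] {O : Subring ℍ[ℚ,α,β]} [IsOrder O]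

open Classical in
/-- The number of ideals of norm `p N(a)` between `c` and `a`. -/
theorem card_intermediate (hα : α < 0) (hβ : β < 0) {φ : O →+* Matrix (Fin 2) (Fin 2) (ZMod p)}
    (hsurj : Function.Surjective φ) (hker : ∀ x, φ x = 0 ↔ ∃ z : O, x = (p : ℤ) • z)
    (hdet : ∀ x, (φ x).det = normInt x) {a : LeftIdeal O} {s : ℤ}
    (ha : a.1 ≤ toLat O) (hs : ¬ (p : ℤ) ∣ s) (has : ∀ o ∈ O, s • o ∈ a.1) {k : ℕ}
    {c : LeftIdeal O} (hc : c ∈ heckeSet (p ^ (k + 1) * p) a) :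
    ({b ∈ (heckeSet_finite hα hβ hp.out.one_le a).toFinset | c.1 ≤ b.1}).card
      = 1 + if ∀ z ∈ c.1, ∃ w ∈ a.1, z = (p : ℤ) • w then p else 0 := by
  choose B hB hBv using fun i : Option (ZMod p) =>
    exists_lineIdeal hα hβ hsurj hker hdet ha hs has (lineVec_ne_zero i)
  have hnorm1 := padicNorm_latticeNorm_eq_one ha hs has
  have hp1 : padicNorm p p < 1 := padicNorm.padicNorm_p_lt_one_of_prime
  have hall : ∀ b ∈ heckeSet p a, ∃ i, b = B i := by
    intro b hb
    obtain ⟨i, hi⟩ := exists_le_lineSubmodule hα hβ hdet ha hb.1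
      (by rw [hb.2, padicNorm.mul, hnorm1, mul_one]; exact hp1)
    exact ⟨i, eq_of_le_of_norm_eq hα hβ (by rw [hBv]; exact hi) (hb.2.trans (hB i).2.symm)⟩
  have hinj : ∀ {z : O} {i j : Option (ZMod p)}, φ z ≠ 0 → (z : ℍ[ℚ,α,β]) ∈ (B i).1 →
      (z : ℍ[ℚ,α,β]) ∈ (B j).1 → i = j := by
    intro z i j hz hi hj
    rw [hBv] at hi hj
    obtain ⟨-, _, hi⟩ := hi
    obtain ⟨-, _, hj⟩ := hj
    exact lineVec_eq_of_mulVec_eq_zero hz hi hj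
  split_ifs with hcp
  -- When `c ⊆ p a`, all the line ideals contain `p a` and hence `c`. They are distinct: a lift of a
  -- nonzero matrix killing line `i`, scaled by `s` into `a`, lies in `B i` and in no other.
  · have hBinj : Function.Injective B := by
      intro i j hij
      obtain ⟨y, n, hy, hpn, hny⟩ := exists_lift_line hsurj hdet (lineVec_ne_zero i)
      have hsy : ((s • y : O) : ℍ[ℚ,α,β]) ∈ (B i).1 := by
        rw [hBv]
        refine ⟨has _ y.2, (s • y).2, ?_⟩
        rw [Subtype.coe_eta, map_zsmul, hy, Matrix.smul_mulVec]
        have : (!![lineVec i 1, -lineVec i 0; 0, 0] : Matrix (Fin 2) (Fin 2) (ZMod p)).mulVec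
            (lineVec i) = 0 := by
          ext r
          fin_cases r <;> simp [Matrix.mulVec, dotProduct, Fin.sum_univ_two]
          ring
        rw [this, smul_zero]
      refine hinj (z := s • y) ?_ hsy (hij ▸ hsy)
      intro h0
      rw [map_zsmul_reduction, smul_eq_zero, ZMod.intCast_zmod_eq_zero_iff_dvd] at h0
      have h1 := h0.resolve_left hs
      rw [hy] at h1
      apply lineVec_ne_zero i
      have e0 := congrFun (congrFun h1 0) 0
      have e1 := congrFun (congrFun h1 0) 1
      simp at e0 e1
      ext r
      fin_cases r
      · exact e1
      · exact e0
    have : ({b ∈ (heckeSet_finite hα hβ hp.out.one_le a).toFinset | c.1 ≤ b.1})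
        = Finset.univ.image B := by
      ext b
      simp only [Finset.mem_filter, Set.Finite.mem_toFinset, Finset.mem_image, Finset.mem_univ,
        true_and]
      constructor
      · rintro ⟨hb, -⟩
        obtain ⟨i, rfl⟩ := hall b hb
        exact ⟨i, rfl⟩
      · rintro ⟨i, rfl⟩
        refine ⟨hB i, fun z hz => ?_⟩
        obtain ⟨w, hw, rfl⟩ := hcp z hz
        exact smul_mem_of_mem_heckeSet hα hβ hp.out.one_le (hB i) hw
    rw [this, Finset.card_image_of_injective _ hBinj, Finset.card_univ, Fintype.card_option,
      ZMod.card, add_comm]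
  · push Not at hcp
    -- An element of `c` outside `p a` has nonzero reduction, which kills at most one line; some
    -- line is killed because `p` divides the relative norm of `c`.
    obtain ⟨z, hz, hzp⟩ := hcp
    have hzO : z ∈ O := ha (hc.1 hz)
    have hφz : φ ⟨z, hzO⟩ ≠ 0 := fun h0 => by
      obtain ⟨w, hw, hzw⟩ := exists_eq_smul_of_reduction_eq_zero hker hs has (hc.1 hz) h0
      exact hzp w hw hzw
    obtain ⟨i, hi⟩ := exists_le_lineSubmodule hα hβ hdet ha hc.1 (by
      rw [hc.2, padicNorm.mul, hnorm1, mul_one, Nat.cast_mul, padicNorm.mul]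
      exact mul_lt_one_of_nonneg_of_lt_one_right (padicNorm.of_nat _) (padicNorm.nonneg _) hp1)
    rw [← hBv] at hi
    rw [add_zero, Finset.card_eq_one]
    refine ⟨B i, ?_⟩
    ext b
    simp only [Finset.mem_filter, Set.Finite.mem_toFinset, Finset.mem_singleton]
    constructor
    · rintro ⟨hb, hcb⟩
      obtain ⟨j, rfl⟩ := hall b hb
      rw [hinj (z := ⟨z, hzO⟩) hφz (hcb hz) (hi hz)]
    · rintro rfl
      exact ⟨hB i, hi⟩

open Classical in
/-- The ideals in `T_{p^{k+2}}(a)` contained in `p a` are the `p c` with `c` in `T_{p^k}(a)`. -/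
theorem sum_heckeSet_smul (hα : α < 0) (hβ : β < 0) (R : Type*) [CommRing R] (a : LeftIdeal O)
    {k : ℕ} (h1 : 1 ≤ p ^ (k + 1) * p) :
    ∑ c ∈ (heckeSet_finite hα hβ h1 a).toFinset with ∀ z ∈ c.1, ∃ w ∈ a.1, z = (p : ℤ) • w,
      Finsupp.single (cls c) (1 : R) = heckeClass R (p ^ k) (cls a) := by
  have hp0 : (p : ℤ) ≠ 0 := by exact_mod_cast hp.out.ne_zero
  have hpq : (p : ℚ) ≠ 0 := by exact_mod_cast hp0
  have hk : 1 ≤ p ^ k := Nat.one_le_pow _ _ hp.out.pos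
  rw [heckeClass_cls hα hβ R hk]
  symm
  refine Finset.sum_bij' (fun c _ => c.mul (intUnit p hp0)) (fun c _ => c.mul (intUnit p hp0)⁻¹)
    ?_ ?_ ?_ ?_ ?_
  · intro c hc
    rw [Set.Finite.mem_toFinset] at hc
    rw [Finset.mem_filter, Set.Finite.mem_toFinset]
    refine ⟨⟨?_, ?_⟩, ?_⟩
    · intro y hy
      obtain ⟨z, hz, rfl⟩ := mem_mulRight.1 hy
      rw [mul_intUnit]
      exact a.1.smul_mem _ (hc.1 hz)
    · rw [LeftIdeal.norm_mul, nrd_intUnit, abs_of_nonneg (sq_nonneg _), hc.2]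
      push_cast; ring
    · intro y hy
      obtain ⟨z, hz, rfl⟩ := mem_mulRight.1 hy
      exact ⟨z, hc.1 hz, mul_intUnit _ _ _⟩
  · intro c hc
    rw [Finset.mem_filter, Set.Finite.mem_toFinset] at hc
    rw [Set.Finite.mem_toFinset]
    obtain ⟨hc, hcp⟩ := hc
    refine ⟨?_, ?_⟩
    · intro y hy
      rw [LeftIdeal.mul, mem_mulRight_unit, inv_inv] at hy
      obtain ⟨w, hw, hyw⟩ := hcp _ hy
      rw [← mul_intUnit p hp0] at hyw
      rw [(Units.mul_left_inj _).1 hyw]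
      exact hw
    · rw [LeftIdeal.norm_mul, nrd_unit_inv, nrd_intUnit, hc.2, abs_inv,
        abs_of_nonneg (sq_nonneg _)]
      push_cast
      field_simp
      ring
  · intro c _
    rw [LeftIdeal.mul_mul, mul_inv_cancel, LeftIdeal.mul_one]
  · intro c _
    rw [LeftIdeal.mul_mul, inv_mul_cancel, LeftIdeal.mul_one]
  · intro c _
    rw [cls_mul]

/-- The recursion for prime powers. -/
theorem hecke_prime_pow (hα : α < 0) (hβ : β < 0) (R : Type*) [CommRing R]
    (hd : ¬ p ∣ disc (toLat O)) (k : ℕ) :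
    hecke R O (p ^ (k + 2))
      = hecke R O (p ^ (k + 1)) ∘ₗ hecke R O p - (p : R) • hecke R O (p ^ k) := by
  classical
  obtain ⟨φ, hsurj, hker, hdet⟩ := exists_reduction hd
  refine hecke_ext fun a => ?_
  -- Only the class of `a` matters, so `a` may be assumed to lie in `O` with index prime to `p`,
  -- where the reduction map applies.
  obtain ⟨g, ha, s, hs, has⟩ := exists_mul_le_order (p := p) hα hβ a
  rw [← cls_mul a g]
  generalize a.mul g = a at ha has
  have hk1 : 1 ≤ p ^ (k + 1) := Nat.one_le_pow _ _ hp.out.pos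
  have h1 : 1 ≤ p ^ (k + 1) * p := Nat.mul_pos hk1 hp.out.pos
  rw [LinearMap.sub_apply, LinearMap.smul_apply, LinearMap.comp_apply, hecke_single, hecke_single,
    hecke_single, one_smul, one_smul, one_smul, hecke_heckeClass hα hβ R hk1 hp.out.one_le h1,
    eq_sub_iff_add_eq, ← sum_heckeSet_smul hα hβ R a h1, show p ^ (k + 2) = p ^ (k + 1) * p from
    pow_succ _ _, heckeClass_cls hα hβ R h1, Finset.smul_sum, Finset.sum_filter,
    ← Finset.sum_add_distrib]
  refine Finset.sum_congr rfl fun c hc => ?_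
  rw [Set.Finite.mem_toFinset] at hc
  rw [card_intermediate hα hβ hsurj hker hdet ha hs has hc, add_smul, one_smul]
  split_ifs
  · rw [Nat.cast_smul_eq_nsmul]
  · rw [zero_smul]

end PrimePower

end QuatHecke

end

/-! ### Assembly of the three assertions -/

open scoped Quaternion in
open QuatHecke in
theorem mainTheorem5 (α β : ℚ) (hα : α < 0) (hβ : β < 0) (O : Subring ℍ[ℚ,α,β]) [IsOrder O] :
    (∀ m : ℕ, 1 ≤ m → ∀ a : LeftIdeal O, (heckeSet m a).Finite) ∧
    (∀ m : ℕ, 1 ≤ m → ∀ v w : IdealModule ℤ O,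
      height O (toReal (hecke ℤ O m v)) (toReal w) =
        height O (toReal v) (toReal (hecke ℤ O m w))) ∧
    (∀ (m : ℕ) (v w : IdealModule ℝ O),
      height O (heckeReal O m v) w = height O v (heckeReal O m w)) ∧
    (∀ m m' : ℕ, 1 ≤ m → 1 ≤ m' → Nat.Coprime m m' →
      hecke ℤ O (m * m') = hecke ℤ O m ∘ₗ hecke ℤ O m') ∧
    (∀ m m' : ℕ, Nat.Coprime m m' →
      heckeReal O (m * m') = heckeReal O m ∘ₗ heckeReal O m') ∧
    (∀ p : ℕ, p.Prime → ¬ p ∣ disc (toLat O) → ∀ k : ℕ,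
      hecke ℤ O (p ^ (k + 2)) =
        hecke ℤ O (p ^ (k + 1)) ∘ₗ hecke ℤ O p - (p : ℤ) • hecke ℤ O (p ^ k)) := by
  refine ⟨fun m hm a => heckeSet_finite hα hβ hm a, fun m hm v w => ?_, fun m v w => ?_,
    fun m m' hm hm' h => hecke_mul_of_coprime hα hβ ℤ hm hm' h, fun m m' h => ?_,
    fun p hp hd k => ?_⟩
  · rw [toReal_hecke hα hβ hm, toReal_hecke hα hβ hm, height_hecke hα hβ hm]
  · rw [heckeReal]
    split_ifs with hm
    · exact height_heckeZero hα hβ v w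
    · exact height_hecke hα hβ (Nat.one_le_iff_ne_zero.2 hm) v w
  -- Only `1` is coprime to `0`, so the cases with a zero index reduce to `t_1` being the identity.
  · rcases Nat.eq_zero_or_pos m with rfl | hm
    · obtain rfl : m' = 1 := Nat.coprime_zero_left m' |>.1 h
      simp [heckeReal, hecke_one hα hβ]
    · rcases Nat.eq_zero_or_pos m' with rfl | hm'
      · obtain rfl : m = 1 := Nat.coprime_zero_right m |>.1 h
        simp [heckeReal, hecke_one hα hβ]
      · rw [heckeReal, heckeReal, heckeReal, if_neg hm.ne', if_neg hm'.ne',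
          if_neg (Nat.mul_pos hm hm').ne']
        exact hecke_mul_of_coprime hα hβ ℝ hm hm' h
  · have : Fact p.Prime := ⟨hp⟩
    exact hecke_prime_pow hα hβ ℤ hd k
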